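/- **Setting.** Let $H$ be a separable complex Hilbert space (inner products are linear in the second variable), $A$ a bounded operator on $H$ with $A^*A=AA^*=r_AI$, $r_A>0$ real, and $\phi\in H$ a unit vector that is cyclic, i.e. $\{P(A,A^*)\phi : P\in\mathbb C[X,Y]\}$ is dense in $H$. For $N<\omega$ let $H_N$, $H_N^-$, $H_N^+$ be the spans of the vectors $A^i(A^*)^j\phi$ with, respectively, $i,j\le N$; $i<N$, $j\le N$; $0<i\le N$, $j\le N$. Let $W_N^\mp$ be the orthogonal complement of $H_N^\mp$ in $H_N$, $U_N:W_N^-\to W_N^+$ any unitary map, and $A_N$ the operator on $H_N$ that equals $A$ on $H_N^-$ and $\sqrt{r_A}\,U_N$ on $W_N^-$. Choose an orthonormal basis $u_N(k)$, $k<D_N=\dim H_N$, of $H_N$ with $A_Nu_N(k)=\lambda_N(k)u_N(k)$ and $\xi_N(k)=\langle u_N(k)|\phi\rangle\ge 0$. Fix a natural number $M>\max(\|A\|,\sqrt{r_A})$, put $S=\{\lambda\in\mathbb C:|\mathrm{Re}\,\lambda|,|\mathrm{Im}\,\lambda|\le M\}$, and let $C(S)$ be the space of continuous functions $S\to\mathbb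 C$. Let $D$ be an ultrafilter on $\omega$ containing $\{N\neq0:\sqrt N\in\omega,\ m\mid\sqrt N\}$ for every $m\ge1$. **Measures.** Let $\mu_N(X)=\sum_{\lambda_N(k)\in X}\xi_N(k)^2$ and $\mu^n(X)=\lim_D\mu_N(X)$ for $X\subseteq\mathbb C$. For real $s$ and $\varepsilon>0$ let $I_s^\varepsilon=\{\lambda\in S:|\mathrm{Re}\,\lambda-s|<\varepsilon\}$ and $J_s^\varepsilon=\{\lambda\in S:|\mathrm{Im}\,\lambda-s|<\varepsilon\}$. Call $s\in[-M,M]$ nice if for all $\delta>0$ there is $\varepsilon>0$ with $\mu^n(I_s^\varepsilon),\mu^n(J_s^\varepsilon)<\delta$. Fix a countable dense set $NI\subseteq[-M,M]$ of nice reals with $\pm M\in NI$, let $Sq^*$ be the set of boxes $\{\lambda\in S: a<\mathrm{Re}\,\lambda<b,\ c<\mathrm{Im}\,\lambda<d\}$ with $a,b,c,d\in NI$, and let $\mu$ be the Borel measure $$\mu(X)=\inf\Big\{\sum_{i<\omega}\mu^n(X_i):X_i\in Sq^*,\ X\cap\mathrm{Int}\,S\subseteq\bigcup_iX_i\Big\}.$$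 Fix finite sets $Sq_n\subseteq Sq^*$, $n<\omega$, such that: the elements of $Sq_n$ are disjoint and their closures cover $S$; if $n<m$, the closure of each element of $Sq_n$ is a union of closures of elements of $Sq_m$; for every $X\in Sq^*$ and $m<\omega$ there is $n>m$ such that $\overline X$ is a union of closures of elements of $Sq_n$; and the elements of $Sq_n$ are non-empty with side lengths $<2M/(n+1)$. **Ultraproducts.** Let $H^u=\prod_NH_N/D$. For $v=\sum_ka_ku_N(k)\in H_N$ let $\|v\|_0=\sum_k\xi_N(k)|a_k|$ and $\|v\|^X_\infty=\sup\{\xi_N(k)^{-1}|a_k|:\lambda_N(k)\in X\}$ (with $0^{-1}=0$). For $Y\subseteq Sq_n$ let $S_1^Y=\bigcup_{R\in Sq_n\setminus Y}\overline R$, and call $Y$ good if $\sigma(A)$ has positive distance to $S_1^Y$. An element $v=(\sum_ka_k^Nu_N(k))_N/D$ of $H^u$ is $0$-good if $\lim_D\sum_{\lambda_N(k)\in S_1^Y}\xi_N(k)|a_k^N|=0$ for all $n$ and all good $Y\subseteq Sq_n$. Let $H^{m0}$ be the set of $0$-good $v$ such that, for some natural $p$, $\|v_N\|_0<p$ for $D$-many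 $N$; let $v\sim_0w$ mean $\lim_D\|v_N-w_N\|_0=0$, let $[v]_0$ be the $\sim_0$-class of $v$, and $H^m_0=H^{m0}/{\sim_0}$. Let $X_\varepsilon=\{\lambda\in\mathbb C:\mathrm{dist}(\lambda,\sigma(A))\le\varepsilon\}$ and $\|v\|_\infty=\lim_{\varepsilon\to0}\lim_D\|v_N\|_\infty^{X_\varepsilon}$ if for some natural $p$ one has $\xi_N(k)^{-1}|a^N_k|<p$ for $D$-many $N$ and all $k<D_N$, and $\|v\|_\infty=\infty$ otherwise. Let $H^{m\infty}=\{v\in H^u:\|v\|_\infty<\infty\}$, let $[v]_\infty$ be the class of $v$ modulo $\|v-w\|_\infty=0$, and $H^m_\infty$ the set of classes of elements of $H^{m\infty}$. For classes $x,y$ write $\langle x|y\rangle=q\in\mathbb C$ if $\lim_D\langle v_N|w_N\rangle=q$ for all $(v_N)/D\in x$ and $(w_N)/D\in y$; if there is no such $q$, put $\langle x|y\rangle=\infty$. For $f\in C(S)$ let $F(f)=\big(\sum_k\xi_N(k)f(\lambda_N(k))u_N(k)\big)_N/D\in H^u$. **Distributions.** A generalized distribution is an antilinear map $\theta:C(S)\to\mathbb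 C$ such that for some $K$, $|\theta(f)|\le K\sup_{\lambda\in\sigma(A)}|f(\lambda)|$ for all $f$. Fix one. For $X\subseteq\mathbb C$, an $X$-function is an $f\in C(S)$ with $|f|\le1$ that vanishes on $S\setminus X$. The line $I_s$ is very good if for all $\delta>0$ there is $\varepsilon>0$ such that $|\theta(f)|<\delta$ for all $I_s^\varepsilon$-functions $f$, and for all $\delta>0$ there is $\varepsilon>0$ with $\mu^n(I_s^\varepsilon)<\delta$; similarly for $J_s$. A *$\theta$-grid* consists of reals $r^n_i\in[-M,M]$, $n<\omega$, $i\le2^{n+2}$, such that $0<r^n_{i+1}-r^n_i<2M/(n+1)$, all $I_{r^n_i}$ and $J_{r^n_i}$ are very good, $r^0_0=-M$, $r^0_4=M$, and $\{r^n_i\}_i\subseteq\{r^{n+1}_j\}_j$. Given a $\theta$-grid, let, for $i,j<2^{n+2}$, $B^n_{ij}=\{\lambda\in S:r^n_i<\mathrm{Re}\,\lambda<r^n_{i+1},\ r^n_j<\mathrm{Im}\,\lambda<r^n_{j+1}\}$, let $R^n_\varepsilon=\bigcup_{i\le2^{n+2}}(I^\varepsilon_{r^n_i}\cup J^\varepsilon_{r^n_i})$,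 and let $\theta(B^n_{ij},1)=\lim_{\varepsilon\to0}\theta(f_\varepsilon)$, where $f_\varepsilon$ is any $B^n_{ij}$-function that equals $1$ wherever $r^n_i+\varepsilon<\mathrm{Re}<r^n_{i+1}-\varepsilon$ and $r^n_j+\varepsilon<\mathrm{Im}<r^n_{j+1}-\varepsilon$. A pair of functions $n:\omega\to\omega$, $\varepsilon:\omega\to(0,\infty)$ is *$\theta$-good* if (i) $\{N:n(N)>m,\ \varepsilon(N)<1/m\}\in D$ for all $m\ge1$; (ii) there is $U\in D$ such that for all $N\in U$ with $n=n(N)>0$, writing $\varepsilon=\varepsilon(N)$ and $\delta=2^{-3(n+2)}\min\{\mu_N(B^n_{ij}):\mu(B^n_{ij})>0\}$: (a) $|\theta(f)|<\delta$ for all $R^n_\varepsilon$-functions $f$; (b) $\mu_N(R^n_\varepsilon)<\delta$; (c) $|\mu_N(B^n_{ij})-\mu(B^n_{ij})|<\delta$ for all $i,j<2^{n+2}$; (iii) for all $N$ and all $i<2^{n(N)+2}$, each of $r^{n(N)}_i\pm\varepsilon(N)$ is nice or outside $[-M,M]$. For such a pair let $u(\theta)=(u_N(\theta))_N/D\in H^u$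 with, for $n=n(N)$, $$u_N(\theta)=\sum_{\mu(B^n_{ij})\ne0}\ \sum_{\lambda_N(k)\in B^n_{ij}}\frac{\xi_N(k)\,\theta(B^n_{ij},1)}{\mu_N(B^n_{ij})}\,u_N(k).$$ **Theorem.** For every generalized distribution $\theta$ there is a $\theta$-grid. For every $\theta$-grid the limits $\theta(B^n_{ij},1)$ exist and do not depend on the choice of the functions $f_\varepsilon$, and there is a $\theta$-good pair $(n,\varepsilon)$, even one for which $U=\omega$ works in (ii) and $r^{n(N)}_i+\varepsilon(N)<r^{n(N)}_{i+1}-\varepsilon(N)$ for all $N$ and $i<2^{n(N)+2}$. For every $\theta$-good pair $(n,\varepsilon)$, $[u(\theta)]_0\in H^m_0$, and for all $f\in C(S)$, $[F(f)]_\infty\in H^m_\infty$ and $$\theta(f)=\langle[F(f)]_\infty\,|\,[u(\theta)]_0\rangle .$$ -/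

import Mathlib

open Filter Topology Set
open scoped ENNReal InnerProductSpace

noncomputable section

namespace UltraDist

section Spaces

variable {H : Type*} [NormedAddCommGroup H] [InnerProductSpace ℂ H] [CompleteSpace H]

/-- The vector `A ^ i (A*) ^ j φ`. -/
def word (A : H →L[ℂ] H) (φ : H) (i j : ℕ) : H :=
  (A ^ i * (ContinuousLinearMap.adjoint A) ^ j) φ

/-- The operator `P(A, A*)` for a polynomial `P ∈ ℂ[X, Y]`; the variable `0` is `X` and the
variable `1` is `Y`. -/
def polyOp (A : H →L[ℂ] H) (P : MvPolynomial (Fin 2) ℂ) : H →L[ℂ] H :=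
  ∑ m ∈ P.support, P.coeff m • (A ^ (m 0) * (ContinuousLinearMap.adjoint A) ^ (m 1))

/-- `φ` is cyclic: the vectors `P(A, A*) φ`, `P ∈ ℂ[X, Y]`, are dense in `H`. -/
def IsCyclic (A : H →L[ℂ] H) (φ : H) : Prop :=
  DenseRange fun P : MvPolynomial (Fin 2) ℂ => polyOp A P φ

/-- `H_N`, spanned by `A ^ i (A*) ^ j φ` with `i ≤ N` and `j ≤ N`. -/
def HN (A : H →L[ℂ] H) (φ : H) (N : ℕ) : Submodule ℂ H :=
  Submodule.span ℂ {x | ∃ i j, i ≤ N ∧ j ≤ N ∧ x = word A φ i j}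

/-- `H_N⁻`, spanned by `A ^ i (A*) ^ j φ` with `i < N` and `j ≤ N`. -/
def HNminus (A : H →L[ℂ] H) (φ : H) (N : ℕ) : Submodule ℂ H :=
  Submodule.span ℂ {x | ∃ i j, i < N ∧ j ≤ N ∧ x = word A φ i j}

/-- `H_N⁺`, spanned by `A ^ i (A*) ^ j φ` with `0 < i ≤ N` and `j ≤ N`. -/
def HNplus (A : H →L[ℂ] H) (φ : H) (N : ℕ) : Submodule ℂ H :=
  Submodule.span ℂ {x | ∃ i j, 0 < i ∧ i ≤ N ∧ j ≤ N ∧ x = word A φ i j}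

/-- `W⁻`, the orthogonal complement of `H_N⁻` in `H_N`. -/
def Wminus (A : H →L[ℂ] H) (φ : H) (N : ℕ) : Submodule ℂ H :=
  HN A φ N ⊓ (HNminus A φ N)ᗮ

/-- `W⁺`, the orthogonal complement of `H_N⁺` in `H_N`. -/
def Wplus (A : H →L[ℂ] H) (φ : H) (N : ℕ) : Submodule ℂ H :=
  HN A φ N ⊓ (HNplus A φ N)ᗮ

/-- The choices made in the construction of the finite dimensional approximations: a unitary
`U : W⁻ → W⁺`, which determines the operator `A_N` on `H_N` (equal to `A` on `H_N⁻` and to `√r U`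
on `W⁻`), and an orthonormal basis of `H_N` of eigenvectors of `A_N` whose inner products with `φ`
are non-negative reals. -/
structure ApproxSystem (A : H →L[ℂ] H) (r : ℝ) (φ : H) where
  /-- the unitary map `W⁻ → W⁺` -/
  U : ∀ N, Wminus A φ N ≃ₗᵢ[ℂ] Wplus A φ N
  /-- the operator `A_N` -/
  op : ∀ N, HN A φ N →ₗ[ℂ] HN A φ N
  op_minus : ∀ N (v : HN A φ N), (v : H) ∈ HNminus A φ N → (op N v : H) = A v
  op_perp : ∀ N (w : Wminus A φ N),
    (op N ⟨(w : H), w.property.1⟩ : H) = ((Real.sqrt r : ℝ) : ℂ) • (U N w : H)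
  /-- the eigenvectors `u_N(k)`, `k < D_N = dim H_N` -/
  u : ∀ N, OrthonormalBasis (Fin (Module.finrank ℂ (HN A φ N))) ℂ (HN A φ N)
  /-- the eigenvalues `λ_N(k)` -/
  lam : ∀ N, Fin (Module.finrank ℂ (HN A φ N)) → ℂ
  eigen : ∀ N k, op N (u N k) = lam N k • u N k
  xi_nonneg : ∀ N k, 0 ≤ (⟪(u N k : H), φ⟫_ℂ).re ∧ (⟪(u N k : H), φ⟫_ℂ).im = 0

end Spaces

/-! ### Subsets of the square -/

/-- The square `S = {λ : |Re λ| ≤ M, |Im λ| ≤ M}`. -/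
def square (M : ℕ) : Set ℂ :=
  {z | -(M : ℝ) ≤ z.re ∧ z.re ≤ M ∧ -(M : ℝ) ≤ z.im ∧ z.im ≤ M}

/-- The strip `I_r^ε`. -/
def stripI (M : ℕ) (r ε : ℝ) : Set ℂ := {z | z ∈ square M ∧ |z.re - r| < ε}

/-- The strip `J_r^ε`. -/
def stripJ (M : ℕ) (r ε : ℝ) : Set ℂ := {z | z ∈ square M ∧ |z.im - r| < ε}

/-- `{λ ∈ S : a < Re λ < b, c < Im λ < d}`. -/
def box (M : ℕ) (a b c d : ℝ) : Set ℂ :=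
  {z | z ∈ square M ∧ (a < z.re ∧ z.re < b) ∧ (c < z.im ∧ z.im < d)}

/-- The family `Sq*` of the open boxes with sides at elements of `NI`. -/
def SqStar (M : ℕ) (NI : Set ℝ) : Set (Set ℂ) :=
  {Y | ∃ a ∈ NI, ∃ b ∈ NI, ∃ c ∈ NI, ∃ d ∈ NI, Y = box M a b c d}

/-- The value of `f ∈ C(S)` at a point of `ℂ` (and `0` off `S`, which is never used). -/
def evalAt {M : ℕ} (f : C(square M, ℂ)) (z : ℂ) : ℂ :=
  open Classical in if h : z ∈ square M then f ⟨z, h⟩ else 0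

/-- `f ∈ C(S)` is an `X`-function: `|f| ≤ 1` on `S` and `f = 0` on `S - X`. -/
def IsXFunction {M : ℕ} (X : Set ℂ) (f : C(square M, ℂ)) : Prop :=
  (∀ x, ‖f x‖ ≤ 1) ∧ ∀ x : square M, (x : ℂ) ∉ X → f x = 0

section Construction

variable {H : Type*} [NormedAddCommGroup H] [InnerProductSpace ℂ H] [CompleteSpace H]
variable {A : H →L[ℂ] H} {r : ℝ} {φ : H}

/-! ### The measures -/

/-- `ξ_N(k) = ⟨u_N(k) | φ⟩`, a non-negative real. -/
def xi (𝒜 : ApproxSystem A r φ) (N : ℕ) (k : Fin (Module.finrank ℂ (HN A φ N))) : ℝ :=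
  (⟪(𝒜.u N k : H), φ⟫_ℂ).re

/-- `μ_N(X)`, the sum of `ξ_N(k)²` over the `k` with `λ_N(k) ∈ X`. -/
def muN (𝒜 : ApproxSystem A r φ) (N : ℕ) (X : Set ℂ) : ℝ :=
  open Classical in ∑ k with 𝒜.lam N k ∈ X, xi 𝒜 N k ^ 2

/-- The naive measure `μⁿ(X)`, the ultralimit of `μ_N(X)`. -/
def muNaive (𝒜 : ApproxSystem A r φ) (D : Ultrafilter ℕ) (X : Set ℂ) : ℝ :=
  limUnder (D : Filter ℕ) fun N => muN 𝒜 N X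

/-- `s ∈ [-M, M]` is nice. -/
def IsNice (𝒜 : ApproxSystem A r φ) (D : Ultrafilter ℕ) (M : ℕ) (s : ℝ) : Prop :=
  s ∈ Icc (-(M : ℝ)) M ∧ ∀ δ > 0, ∃ ε > 0,
    muNaive 𝒜 D (stripI M s ε) < δ ∧ muNaive 𝒜 D (stripJ M s ε) < δ

/-- `NI` is a countable dense subset of `[-M, M]` that consists of nice reals and contains
`-M` and `M`. -/
structure IsNiceDense (𝒜 : ApproxSystem A r φ) (D : Ultrafilter ℕ) (M : ℕ) (NI : Set ℝ) :
    Prop where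
  countable : NI.Countable
  dense : Icc (-(M : ℝ)) M ⊆ closure NI
  nice : ∀ s ∈ NI, IsNice 𝒜 D M s
  left_mem : -(M : ℝ) ∈ NI
  right_mem : (M : ℝ) ∈ NI

/-- The outer measure `μ*` obtained from `μⁿ` on `Sq*`, with `μ*(X) = μ*(X ∩ Int S)`. -/
def muStar (𝒜 : ApproxSystem A r φ) (D : Ultrafilter ℕ) (M : ℕ) (NI : Set ℝ) (X : Set ℂ) :
    ℝ≥0∞ :=
  ⨅ (Y : ℕ → Set ℂ) (_ : (∀ i, Y i ∈ SqStar M NI) ∧ X ∩ interior (square M) ⊆ ⋃ i, Y i),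
    ∑' i, ENNReal.ofReal (muNaive 𝒜 D (Y i))

/-- `μ(X)`, the value of `μ*`; it is only used for Borel sets, where `μ*` is a measure of total
mass `1`. -/
def mu (𝒜 : ApproxSystem A r φ) (D : Ultrafilter ℕ) (M : ℕ) (NI : Set ℝ) (X : Set ℂ) : ℝ :=
  (muStar 𝒜 D M NI X).toReal

/-- The conditions on the finite families `Sq_n ⊆ Sq*`. -/
structure IsTiling (M : ℕ) (NI : Set ℝ) (Sq : ℕ → Set (Set ℂ)) : Prop where
  finite : ∀ n, (Sq n).Finite
  subset : ∀ n, Sq n ⊆ SqStar M NI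
  disjoint : ∀ n, (Sq n).PairwiseDisjoint id
  cover : ∀ n, ⋃ X ∈ Sq n, closure X = square M
  cofinal : ∀ X ∈ SqStar M NI, ∀ m, ∃ n > m, ∃ Z ⊆ Sq n, closure X = ⋃ Y ∈ Z, closure Y
  refine : ∀ n m, n < m → ∀ X ∈ Sq n, ∃ Z ⊆ Sq m, closure X = ⋃ Y ∈ Z, closure Y
  mesh : ∀ n, ∀ a ∈ NI, ∀ b ∈ NI, ∀ c ∈ NI, ∀ d ∈ NI, box M a b c d ∈ Sq n →
    (a < b ∧ b - a < 2 * M / (n + 1)) ∧ (c < d ∧ d - c < 2 * M / (n + 1))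

/-! ### Norms on the finite dimensional spaces -/

/-- The part `∑_{λ_N(k) ∈ X} ξ_N(k) |a_k|` of the `0`-norm of `∑ a_k u_N(k)`. -/
def partNorm0 (𝒜 : ApproxSystem A r φ) (X : Set ℂ) (N : ℕ) (v : HN A φ N) : ℝ :=
  open Classical in ∑ k with 𝒜.lam N k ∈ X, xi 𝒜 N k * ‖(𝒜.u N).repr v k‖

/-- `‖∑ a_k u_N(k)‖₀ = ∑ ξ_N(k) |a_k|`. -/
def norm0 (𝒜 : ApproxSystem A r φ) (N : ℕ) (v : HN A φ N) : ℝ :=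
  ∑ k, xi 𝒜 N k * ‖(𝒜.u N).repr v k‖

/-- `‖∑ a_k u_N(k)‖_∞^X = sup {ξ_N(k)⁻¹ |a_k| : λ_N(k) ∈ X}`, with `0⁻¹ = 0` and `sup ∅ = 0`. -/
def normSup (𝒜 : ApproxSystem A r φ) (X : Set ℂ) (N : ℕ) (v : HN A φ N) : ℝ :=
  sSup {t | ∃ k, 𝒜.lam N k ∈ X ∧ t = (xi 𝒜 N k)⁻¹ * ‖(𝒜.u N).repr v k‖}

/-! ### The ultraproduct -/

/-- The ultraproduct `H^u` of the spaces `H_N`. -/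
abbrev Hu (A : H →L[ℂ] H) (φ : H) (D : Ultrafilter ℕ) : Type _ :=
  Filter.Product (D : Filter ℕ) fun N => HN A φ N

/-- The class of a sequence of vectors in the ultraproduct. -/
def toHu (D : Ultrafilter ℕ) (v : ∀ N, HN A φ N) : Hu A φ D :=
  Quotient.mk (Filter.productSetoid (D : Filter ℕ) fun N => HN A φ N) v

/-- The ultraproduct of a family of unary functions on the spaces `H_N`. -/
def ultra {β : Type*} (D : Ultrafilter ℕ) (g : ∀ N, HN A φ N → β) :
    Hu A φ D → Filter.Germ (D : Filter ℕ) β :=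
  Quotient.map (fun v N => g N (v N)) fun _ _ h => h.mono fun N hN => congrArg (g N) hN

/-- The ultraproduct of a family of binary functions on the spaces `H_N`. -/
def ultra₂ {β : Type*} (D : Ultrafilter ℕ) (g : ∀ N, HN A φ N → HN A φ N → β) :
    Hu A φ D → Hu A φ D → Filter.Germ (D : Filter ℕ) β :=
  Quotient.map₂ (fun v w N => g N (v N) (w N)) fun _ _ h _ _ h' =>
    (h.and h').mono fun N hN => congrArg₂ (g N) hN.1 hN.2

/-- Subtraction in `H^u`. -/
def subHu (D : Ultrafilter ℕ) : Hu A φ D → Hu A φ D → Hu A φ D :=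
  Quotient.map₂ (fun v w N => v N - w N) fun _ _ h _ _ h' =>
    (h.and h').mono fun _ hN => congrArg₂ (· - ·) hN.1 hN.2

/-! ### The space `H^m_0` -/

/-- `S_1^Y` for `Y ⊆ Sq_n`. -/
def farPart (Sqn Y : Set (Set ℂ)) : Set ℂ := ⋃ R ∈ Sqn \ Y, closure R

/-- `Y ⊆ Sq_n` is good: `σ(A)` has a positive distance to the closure of `S_1^Y`. -/
def IsGoodTiles (A : H →L[ℂ] H) (Sqn Y : Set (Set ℂ)) : Prop :=
  Y ⊆ Sqn ∧ ∃ d > 0, ∀ x ∈ spectrum ℂ A, ∀ y ∈ closure (farPart Sqn Y), d ≤ dist x y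

/-- `v ∈ H^u` is `0`-good. -/
def IsZeroGood (𝒜 : ApproxSystem A r φ) (D : Ultrafilter ℕ) (Sq : ℕ → Set (Set ℂ))
    (v : Hu A φ D) : Prop :=
  ∀ n Y, IsGoodTiles A (Sq n) Y → (ultra D (partNorm0 𝒜 (farPart (Sq n) Y)) v).Tendsto (𝓝 0)

/-- `H^{m0}`: the `0`-good elements of `H^u` with a finite `0`-norm. -/
def Hm0pre (𝒜 : ApproxSystem A r φ) (D : Ultrafilter ℕ) (Sq : ℕ → Set (Set ℂ)) :
    Set (Hu A φ D) :=
  {v | IsZeroGood 𝒜 D Sq v ∧ ∃ p : ℕ, (ultra D (norm0 𝒜) v).LiftPred (· < (p : ℝ))}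

/-- `[v]_0`: the class of `v` modulo `v ∼_0 w`, i.e. `‖v - w‖₀` is infinitesimal. -/
def cls0 (𝒜 : ApproxSystem A r φ) (D : Ultrafilter ℕ) (v : Hu A φ D) : Set (Hu A φ D) :=
  {w | (ultra D (norm0 𝒜) (subHu D v w)).Tendsto (𝓝 0)}

/-- `H^m_0 = H^{m0} / ∼_0`, as the set of equivalence classes. -/
def Hm0 (𝒜 : ApproxSystem A r φ) (D : Ultrafilter ℕ) (Sq : ℕ → Set (Set ℂ)) :
    Set (Set (Hu A φ D)) :=
  cls0 𝒜 D '' Hm0pre 𝒜 D Sq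

/-! ### The space `H^m_∞` -/

/-- The finite real that a germ of non-negative reals is infinitely close to, and `∞` if there is
none. -/
def stdPart {D : Ultrafilter ℕ} (g : Filter.Germ (D : Filter ℕ) ℝ) : ℝ≥0∞ :=
  open Classical in if h : ∃ q : ℝ, g.Tendsto (𝓝 q) then ENNReal.ofReal h.choose else ⊤

/-- `X_ε`, the points of `ℂ` whose distance to `σ(A)` is at most `ε`. -/
def nearSpectrum (A : H →L[ℂ] H) (ε : ℝ) : Set ℂ := {z | Metric.infDist z (spectrum ℂ A) ≤ ε}

/-- `‖v‖_∞^ε` for `v ∈ H^u`. -/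
def normEps (𝒜 : ApproxSystem A r φ) (D : Ultrafilter ℕ) (ε : ℝ) (v : Hu A φ D) : ℝ≥0∞ :=
  stdPart (ultra D (normSup 𝒜 (nearSpectrum A ε)) v)

/-- `‖v‖_∞` for `v ∈ H^u`: the limit of `‖v‖_∞^ε` as `ε → 0` if all the `ξ_N(k)⁻¹ |a_k|` are
uniformly bounded for `D`-many `N`, and `∞` otherwise. -/
def normInf (𝒜 : ApproxSystem A r φ) (D : Ultrafilter ℕ) (v : Hu A φ D) : ℝ≥0∞ :=
  open Classical in
  if ∃ p : ℕ, (ultra D (fun N x => ∀ k, (xi 𝒜 N k)⁻¹ * ‖(𝒜.u N).repr x k‖ < (p : ℝ)) v).LiftPred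
      (fun P : Prop => P)
  then limUnder (𝓝[>] (0 : ℝ)) fun ε => normEps 𝒜 D ε v
  else ⊤

/-- `H^{m∞}`. -/
def HmInfpre (𝒜 : ApproxSystem A r φ) (D : Ultrafilter ℕ) : Set (Hu A φ D) :=
  {v | normInf 𝒜 D v < ⊤}

/-- `[v]_∞`: the class of `v` modulo `‖v - w‖_∞ = 0`. -/
def clsInf (𝒜 : ApproxSystem A r φ) (D : Ultrafilter ℕ) (v : Hu A φ D) : Set (Hu A φ D) :=
  {w | normInf 𝒜 D (subHu D v w) = 0}

/-- `H^m_∞ = H^{m∞} / ∼_∞`, as the set of equivalence classes. -/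
def HmInf (𝒜 : ApproxSystem A r φ) (D : Ultrafilter ℕ) : Set (Set (Hu A φ D)) :=
  clsInf 𝒜 D '' HmInfpre 𝒜 D

/-! ### The pairing -/

/-- `q ∈ ℂ` is infinitely close to `⟨f' | g'⟩^u` for all `f' ∈ x` and `g' ∈ y`. -/
def IsPairingValue (D : Ultrafilter ℕ) (x y : Set (Hu A φ D)) (q : ℂ) : Prop :=
  ∀ f ∈ x, ∀ g ∈ y, (ultra₂ D (fun _ v w => ⟪v, w⟫_ℂ) f g).Tendsto (𝓝 q)

/-- The partial pairing `⟨x | y⟩` of classes, with value `∞` where it is not well defined. -/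
def pairing (D : Ultrafilter ℕ) (x y : Set (Hu A φ D)) : OnePoint ℂ :=
  open Classical in
  if h : ∃ q : ℂ, IsPairingValue D x y q then ((h.choose : ℂ) : OnePoint ℂ) else OnePoint.infty

/-- `F_N(f) = ∑ ξ_N(k) f(λ_N(k)) u_N(k)`. -/
def FN {M : ℕ} (𝒜 : ApproxSystem A r φ) (f : C(square M, ℂ)) (N : ℕ) : HN A φ N :=
  ∑ k, ((xi 𝒜 N k : ℂ) * evalAt f (𝒜.lam N k)) • 𝒜.u N k

/-- `F(f) ∈ H^u`. -/
def F {M : ℕ} (𝒜 : ApproxSystem A r φ) (D : Ultrafilter ℕ) (f : C(square M, ℂ)) : Hu A φ D :=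
  toHu D (FN 𝒜 f)

/-! ### Generalized distributions -/

/-- `‖f‖_∞^σ`, the supremum of `|f|` over `σ(A)`. -/
def normSigma {M : ℕ} (A : H →L[ℂ] H) (f : C(square M, ℂ)) : ℝ :=
  sSup {t | ∃ x : square M, (x : ℂ) ∈ spectrum ℂ A ∧ t = ‖f x‖}

/-- An antilinear `θ : C(S) → ℂ` is a generalized distribution if it is bounded in the sense of
`‖·‖_∞^σ`. -/
def IsGenDistribution {M : ℕ} (A : H →L[ℂ] H) (θ : C(square M, ℂ) →ₛₗ[starRingEnd ℂ] ℂ) : Prop :=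
  ∃ K : ℕ, ∀ f, ‖θ f‖ ≤ K * normSigma A f

/-- The line `I_s` is very good for `θ`. -/
def IsVeryGoodI {M : ℕ} (𝒜 : ApproxSystem A r φ) (D : Ultrafilter ℕ)
    (θ : C(square M, ℂ) →ₛₗ[starRingEnd ℂ] ℂ) (s : ℝ) : Prop :=
  (∀ δ > 0, ∃ ε > 0, ∀ f, IsXFunction (stripI M s ε) f → ‖θ f‖ < δ) ∧
    ∀ δ > 0, ∃ ε > 0, muNaive 𝒜 D (stripI M s ε) < δ

/-- The line `J_s` is very good for `θ`. -/
def IsVeryGoodJ {M : ℕ} (𝒜 : ApproxSystem A r φ) (D : Ultrafilter ℕ)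
    (θ : C(square M, ℂ) →ₛₗ[starRingEnd ℂ] ℂ) (s : ℝ) : Prop :=
  (∀ δ > 0, ∃ ε > 0, ∀ f, IsXFunction (stripJ M s ε) f → ‖θ f‖ < δ) ∧
    ∀ δ > 0, ∃ ε > 0, muNaive 𝒜 D (stripJ M s ε) < δ

/-- The conditions on the subdivision points `r^n_i`, `i < 2 ^ (n + 2) + 1`; here `ρ n i` is
`r^n_i`, and the values of `ρ n` at larger indices are irrelevant. -/
structure IsGrid {M : ℕ} (𝒜 : ApproxSystem A r φ) (D : Ultrafilter ℕ)
    (θ : C(square M, ℂ) →ₛₗ[starRingEnd ℂ] ℂ) (ρ : ℕ → ℕ → ℝ) : Prop where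
  mem : ∀ n, ∀ i < 2 ^ (n + 2) + 1, ρ n i ∈ Icc (-(M : ℝ)) M
  mesh : ∀ n, ∀ i < 2 ^ (n + 2),
    ρ n i < ρ n (i + 1) ∧ ρ n (i + 1) - ρ n i < 2 * M / (n + 1)
  veryGood : ∀ n, ∀ i < 2 ^ (n + 2) + 1,
    IsVeryGoodI 𝒜 D θ (ρ n i) ∧ IsVeryGoodJ 𝒜 D θ (ρ n i)
  first : ρ 0 0 = -(M : ℝ)
  last : ρ 0 4 = M
  refine : ∀ n, ∀ i < 2 ^ (n + 2) + 1, ∃ j < 2 ^ (n + 3) + 1, ρ n i = ρ (n + 1) j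

/-- The open box `B^n_{ij}`. -/
def B (M : ℕ) (ρ : ℕ → ℕ → ℝ) (n i j : ℕ) : Set ℂ :=
  box M (ρ n i) (ρ n (i + 1)) (ρ n j) (ρ n (j + 1))

/-- `R^n_ε`, the `ε`-neighbourhood of the lines of the `n`-th subdivision. -/
def R (M : ℕ) (ρ : ℕ → ℕ → ℝ) (n : ℕ) (ε : ℝ) : Set ℂ :=
  ⋃ i ∈ Finset.range (2 ^ (n + 2) + 1), (stripI M (ρ n i) ε ∪ stripJ M (ρ n i) ε)

/-- The `B^n_{ij}`-functions that are equal to `1` at all points of `B^n_{ij}` with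
`r^n_i + ε < Re < r^n_{i+1} - ε` and `r^n_j + ε < Im < r^n_{j+1} - ε`. -/
def plateau (M : ℕ) (ρ : ℕ → ℕ → ℝ) (n i j : ℕ) (ε : ℝ) : Set C(square M, ℂ) :=
  {f | IsXFunction (B M ρ n i j) f ∧ ∀ x : square M,
    (x : ℂ) ∈ box M (ρ n i + ε) (ρ n (i + 1) - ε) (ρ n j + ε) (ρ n (j + 1) - ε) → f x = 1}

/-- The filter generated by the sets `plateau M ρ n i j ε`, `ε > 0`. A limit along it is a common
limit, as `ε → 0`, for all choices of one function from each of these sets. -/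
def plateauFilter (M : ℕ) (ρ : ℕ → ℕ → ℝ) (n i j : ℕ) : Filter C(square M, ℂ) :=
  ⨅ ε ∈ Ioi (0 : ℝ), 𝓟 (plateau M ρ n i j ε)

/-- `θ(B^n_{ij}, 1)`, the limit of `θ(f)` for `f ∈ plateau M ρ n i j ε` as `ε → 0`. -/
def thetaBox {M : ℕ} (θ : C(square M, ℂ) →ₛₗ[starRingEnd ℂ] ℂ) (ρ : ℕ → ℕ → ℝ) (n i j : ℕ) : ℂ :=
  limUnder (plateauFilter M ρ n i j) θ

/-- `ε` is very nice for `n`: for all `i < 2 ^ (n + 2)`, each of `r^n_i - ε` and `r^n_i + ε` is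
nice or outside `[-M, M]`. -/
def IsVeryNice (𝒜 : ApproxSystem A r φ) (D : Ultrafilter ℕ) (M : ℕ) (ρ : ℕ → ℕ → ℝ) (n : ℕ)
    (ε : ℝ) : Prop :=
  ∀ i < 2 ^ (n + 2), ∀ s, s = ρ n i - ε ∨ s = ρ n i + ε →
    IsNice 𝒜 D M s ∨ s < -(M : ℝ) ∨ (M : ℝ) < s

/-- `δ = δ' / 2 ^ (3 (n + 2))`, where `δ'` is the least `μ_N(B^n_{ij})` with `μ(B^n_{ij}) > 0`. -/
def deltaN (𝒜 : ApproxSystem A r φ) (D : Ultrafilter ℕ) (M : ℕ) (NI : Set ℝ) (ρ : ℕ → ℕ → ℝ)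
    (N n : ℕ) : ℝ :=
  sInf {t | ∃ i < 2 ^ (n + 2), ∃ j < 2 ^ (n + 2),
    0 < mu 𝒜 D M NI (B M ρ n i j) ∧ t = muN 𝒜 N (B M ρ n i j)} / 2 ^ (3 * (n + 2))

/-- The pair `(n, ε)` is `θ`-good, witnessed by the set `U = U(θ, n, ε)`. -/
structure IsThetaGoodOn {M : ℕ} (𝒜 : ApproxSystem A r φ) (D : Ultrafilter ℕ) (NI : Set ℝ)
    (θ : C(square M, ℂ) →ₛₗ[starRingEnd ℂ] ℂ) (ρ : ℕ → ℕ → ℝ) (U : Set ℕ) (n : ℕ → ℕ)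
    (ε : ℕ → ℝ) : Prop where
  pos : ∀ N, 0 < ε N
  large : ∀ m : ℕ, 0 < m → ∀ᶠ N in (D : Filter ℕ), m < n N ∧ ε N < 1 / m
  theta_small : ∀ N ∈ U, 0 < n N → ∀ f, IsXFunction (R M ρ (n N) (ε N)) f →
    ‖θ f‖ < deltaN 𝒜 D M NI ρ N (n N)
  mass_small : ∀ N ∈ U, 0 < n N → muN 𝒜 N (R M ρ (n N) (ε N)) < deltaN 𝒜 D M NI ρ N (n N)
  mass_close : ∀ N ∈ U, 0 < n N → ∀ i < 2 ^ (n N + 2), ∀ j < 2 ^ (n N + 2),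
    |muN 𝒜 N (B M ρ (n N) i j) - mu 𝒜 D M NI (B M ρ (n N) i j)| < deltaN 𝒜 D M NI ρ N (n N)
  veryNice : ∀ N, IsVeryNice 𝒜 D M ρ (n N) (ε N)

/-- The pair `(n, ε)` is `θ`-good. -/
def IsThetaGood {M : ℕ} (𝒜 : ApproxSystem A r φ) (D : Ultrafilter ℕ) (NI : Set ℝ)
    (θ : C(square M, ℂ) →ₛₗ[starRingEnd ℂ] ℂ) (ρ : ℕ → ℕ → ℝ) (n : ℕ → ℕ) (ε : ℕ → ℝ) : Prop :=
  ∃ U ∈ D, IsThetaGoodOn 𝒜 D NI θ ρ U n ε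

/-- `u_N(θ)`, the sum over the `i, j < 2 ^ (n(N) + 2)` with `μ(B^n_{ij}) ≠ 0` and the `k` with
`λ_N(k) ∈ B^n_{ij}` of `(ξ_N(k) θ(B^n_{ij}, 1) / μ_N(B^n_{ij})) u_N(k)`. -/
def uN {M : ℕ} (𝒜 : ApproxSystem A r φ) (D : Ultrafilter ℕ) (NI : Set ℝ)
    (θ : C(square M, ℂ) →ₛₗ[starRingEnd ℂ] ℂ) (ρ : ℕ → ℕ → ℝ) (n : ℕ → ℕ) (N : ℕ) : HN A φ N :=
  open Classical in
  ∑ p ∈ Finset.range (2 ^ (n N + 2)) ×ˢ Finset.range (2 ^ (n N + 2)) with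
      mu 𝒜 D M NI (B M ρ (n N) p.1 p.2) ≠ 0,
    ∑ k with 𝒜.lam N k ∈ B M ρ (n N) p.1 p.2,
      ((xi 𝒜 N k : ℂ) * thetaBox θ ρ (n N) p.1 p.2 / (muN 𝒜 N (B M ρ (n N) p.1 p.2) : ℂ)) •
        𝒜.u N k

/-- `u(θ) ∈ H^u`. -/
def uTheta {M : ℕ} (𝒜 : ApproxSystem A r φ) (D : Ultrafilter ℕ) (NI : Set ℝ)
    (θ : C(square M, ℂ) →ₛₗ[starRingEnd ℂ] ℂ) (ρ : ℕ → ℕ → ℝ) (n : ℕ → ℕ) : Hu A φ D :=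
  toHu D (uN 𝒜 D NI θ ρ n)

end Construction

end UltraDist

end

noncomputable section

namespace UltraDist

/-! ### Eigenvalues and coordinates of the finite-dimensional approximations -/

section Spectral

variable {H : Type*} [NormedAddCommGroup H] [InnerProductSpace ℂ H] [CompleteSpace H]
variable {A : H →L[ℂ] H} {r : ℝ} {φ : H}

/-! Up to the factor `√r`, both `A` and every `A_N` are unitary: `A` carries `H_N⁻` into `H_N⁺`, and
`U_N` carries one complement to the other. So every `λ_N(k)` has modulus `√r` (`norm_lam`), and the
`k`-th coordinate of `A^i (A*)^j φ` has modulus `√r^(i+j) ξ_N(k)` for `i, j ≤ N`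
(`norm_inner_word`). Hence `ξ_N(k) > 0`, and the coordinates of a fixed vector `P(A, A*) φ` are at
most `C ξ_N(k)` with `C` independent of `N`. If a neighbourhood of `z` had `μⁿ`-mass zero, its
eigenvalues would contribute nothing to such vectors in the limit, so `A - z` would be bounded below
on a dense set; as `A` is normal, `z ∉ σ(A)`. Thus open sets that meet `σ(A)` have positive mass
(`muNaive_pos`). On boxes whose sides carry no mass, `μ` and `μⁿ` agree (`mu_box_eq`).

The functional `θ` behaves like a measure of finite total variation carried by `σ(A)`: for functions
with disjoint supports, the sum of the `|θ(f_i)|` is at most `K` times a common bound of the `f_i`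
(`IsBoundedOn.sum_norm_le`). Therefore only countably many lines carry some of `θ` or of the mass, a
grid can avoid them, and the Riemann sums `∑ conj(c_B) θ(B, 1)` approximate `θ(f)` up to `K` times a
bound for `|f - c_B|` on the boxes (`IsGrid.norm_sub_sum_le`).

For `D`-many `N`, `⟨F_N(f) | u_N(θ)⟩` is exactly such a sum, with `c_B` the `ξ²`-weighted mean of
`f` over the eigenvalues in `B`. The boxes left out of `u_N(θ)` have `μ(B) = 0`, so they miss `σ(A)`
and `θ(B, 1) = 0`. Since the mesh tends to `0`, uniform continuity of `f` gives the limit `θ(f)`.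
Independence of the representatives is a weighted `ℓ¹`-`ℓ^∞` duality: `‖u_N(θ)‖₀ ≤ K`, and the
coordinates of `u_N(θ)` live within the mesh of `σ(A)`, where `‖·‖_∞` controls the error. -/

lemma norm_apply_eq (hr : 0 < r)
    (hA : ContinuousLinearMap.adjoint A * A = (r : ℂ) • (1 : H →L[ℂ] H)) (x : H) :
    ‖A x‖ = Real.sqrt r * ‖x‖ := by
  have h := ContinuousLinearMap.apply_norm_sq_eq_inner_adjoint_left A x
  have h2 : (ContinuousLinearMap.adjoint A ∘L A) = (r : ℂ) • (1 : H →L[ℂ] H) := hA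
  rw [h2] at h
  have h3 : ‖A x‖ ^ 2 = r * ‖x‖ ^ 2 := by
    rw [h]
    have : ((r : ℂ) • (1 : H →L[ℂ] H)) x = (r : ℂ) • x := rfl
    rw [this, inner_smul_left, inner_self_eq_norm_sq_to_K]
    simp [← Complex.ofReal_pow, ← Complex.ofReal_mul]
  have h4 : ‖A x‖ ^ 2 = (Real.sqrt r * ‖x‖) ^ 2 := by
    rw [mul_pow, Real.sq_sqrt hr.le, h3]
  exact (sq_eq_sq₀ (norm_nonneg _) (by positivity)).1 h4

lemma word_succ_left (i j : ℕ) : word A φ (i + 1) j = A (word A φ i j) := by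
  simp [word, pow_succ', mul_assoc]

lemma apply_word_zero_succ
    (hA' : A * ContinuousLinearMap.adjoint A = (r : ℂ) • (1 : H →L[ℂ] H)) (j : ℕ) :
    A (word A φ 0 (j + 1)) = (r : ℂ) • word A φ 0 j := by
  have : A * (ContinuousLinearMap.adjoint A) ^ (j + 1) =
      (r : ℂ) • (ContinuousLinearMap.adjoint A) ^ j := by
    rw [pow_succ', ← mul_assoc, hA', smul_mul_assoc, one_mul]
  have h := congrArg (fun T : H →L[ℂ] H => T φ) this
  simpa [word] using h

lemma word_mem_HN {i j N : ℕ} (hi : i ≤ N) (hj : j ≤ N) : word A φ i j ∈ HN A φ N :=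
  Submodule.subset_span ⟨i, j, hi, hj, rfl⟩

lemma word_mem_HNminus {i j N : ℕ} (hi : i < N) (hj : j ≤ N) : word A φ i j ∈ HNminus A φ N :=
  Submodule.subset_span ⟨i, j, hi, hj, rfl⟩

lemma HNminus_le_HN (N : ℕ) : HNminus A φ N ≤ HN A φ N :=
  Submodule.span_mono fun _ ⟨i, j, hi, hj, h⟩ => ⟨i, j, hi.le, hj, h⟩

lemma phi_mem_HN (N : ℕ) : φ ∈ HN A φ N := by
  simpa [word] using word_mem_HN (A := A) (φ := φ) (Nat.zero_le N) (Nat.zero_le N)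

lemma apply_mem_HNplus {N : ℕ} {x : H} (hx : x ∈ HNminus A φ N) : A x ∈ HNplus A φ N := by
  have : HNminus A φ N ≤ (HNplus A φ N).comap (A : H →ₗ[ℂ] H) := by
    refine Submodule.span_le.2 ?_
    rintro _ ⟨i, j, hi, hj, rfl⟩
    refine Submodule.subset_span ⟨i + 1, j, Nat.succ_pos _, hi, hj, ?_⟩
    exact (word_succ_left i j).symm
  exact this hx

lemma apply_mem_HN {N : ℕ} {x : H} (hx : x ∈ HNminus A φ N) : A x ∈ HN A φ N :=
  (Submodule.span_mono fun _ ⟨i, j, _, hi, hj, h⟩ => ⟨i, j, hi, hj, h⟩ :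
    HNplus A φ N ≤ HN A φ N) (apply_mem_HNplus hx)

lemma finiteDimensional_HN (𝒜 : ApproxSystem A r φ) (N : ℕ) : FiniteDimensional ℂ (HN A φ N) :=
  (𝒜.u N).toBasis.finiteDimensional_of_finite

/-- Split an eigenvector as `a + w` along `H_N⁻ ⊕ W⁻`. The images `A a ∈ H_N⁺` and `√r U w ∈ W⁺` are
again orthogonal and both norms are multiplied by `√r`, so Pythagoras applied twice gives the
modulus of the eigenvalue. -/
lemma norm_lam (hr : 0 < r)
    (hA : ContinuousLinearMap.adjoint A * A = (r : ℂ) • (1 : H →L[ℂ] H))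
    (𝒜 : ApproxSystem A r φ) (N : ℕ) (k) : ‖𝒜.lam N k‖ = Real.sqrt r := by
  have := finiteDimensional_HN 𝒜 N
  have : FiniteDimensional ℂ (HNminus A φ N) :=
    Submodule.finiteDimensional_of_le (HNminus_le_HN (A := A) (φ := φ) N)
  obtain ⟨a, ha, w, hw, hu⟩ :=
    (HNminus A φ N).exists_add_mem_mem_orthogonal ((𝒜.u N k : HN A φ N) : H)
  have hw' : w ∈ HN A φ N := by
    have : w = ((𝒜.u N k : HN A φ N) : H) - a := by rw [hu]; abel
    rw [this]
    exact Submodule.sub_mem _ (𝒜.u N k).2 (HNminus_le_HN N ha)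
  have hw2 : w ∈ Wminus A φ N := ⟨hw', hw⟩
  have hu2 : 𝒜.u N k = ⟨a, HNminus_le_HN N ha⟩ + ⟨w, hw'⟩ := Subtype.ext hu
  have hnu : ‖((𝒜.u N k : HN A φ N) : H)‖ = 1 := by
    exact (𝒜.u N).orthonormal.1 k
  have h1 : (𝒜.lam N k • 𝒜.u N k : HN A φ N) =
      (A a + ((Real.sqrt r : ℝ) : ℂ) • (𝒜.U N ⟨w, hw2⟩ : H) : H) := by
    rw [← 𝒜.eigen N k]
    conv_lhs => rw [hu2, map_add]
    rw [Submodule.coe_add, 𝒜.op_minus N ⟨a, _⟩ ha, ← 𝒜.op_perp N ⟨w, hw2⟩]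
  have horth : ⟪A a, ((Real.sqrt r : ℝ) : ℂ) • (𝒜.U N ⟨w, hw2⟩ : H)⟫_ℂ = 0 := by
    rw [inner_smul_right,
      Submodule.inner_right_of_mem_orthogonal (apply_mem_HNplus ha) (𝒜.U N ⟨w, hw2⟩).2.2, mul_zero]
  have horth2 : ⟪a, w⟫_ℂ = 0 := Submodule.inner_right_of_mem_orthogonal ha hw
  have e1 := norm_add_sq_eq_norm_sq_add_norm_sq_of_inner_eq_zero _ _ horth
  have e2 := norm_add_sq_eq_norm_sq_add_norm_sq_of_inner_eq_zero _ _ horth2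
  rw [← h1] at e1
  rw [← hu, hnu] at e2
  have hUw : ‖(𝒜.U N ⟨w, hw2⟩ : H)‖ = ‖w‖ := by
    exact (𝒜.U N).norm_map ⟨w, hw2⟩
  rw [Submodule.coe_smul, norm_smul, hnu, norm_smul, hUw, norm_apply_eq hr hA, Complex.norm_real,
    Real.norm_of_nonneg (Real.sqrt_nonneg r)] at e1
  have : ‖𝒜.lam N k‖ * ‖𝒜.lam N k‖ = Real.sqrt r * Real.sqrt r := by
    have : (Real.sqrt r * ‖a‖ * (Real.sqrt r * ‖a‖) + Real.sqrt r * ‖w‖ * (Real.sqrt r * ‖w‖)) =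
      Real.sqrt r * Real.sqrt r * (‖a‖ * ‖a‖ + ‖w‖ * ‖w‖) := by ring
    rw [this, ← e2] at e1
    simpa using e1
  exact (mul_self_inj (norm_nonneg _) (Real.sqrt_nonneg r)).1 this

lemma inner_op (𝒜 : ApproxSystem A r φ) (N : ℕ) (k) (x : HN A φ N) :
    ⟪𝒜.u N k, 𝒜.op N x⟫_ℂ = 𝒜.lam N k * ⟪𝒜.u N k, x⟫_ℂ := by
  conv_lhs => rw [← (𝒜.u N).sum_repr x]
  rw [map_sum, inner_sum]
  simp only [map_smul, 𝒜.eigen, inner_smul_right]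
  rw [Finset.sum_eq_single k]
  · rw [orthonormal_iff_ite.1 (𝒜.u N).orthonormal, if_pos rfl, OrthonormalBasis.repr_apply_apply]
    ring
  · intro b _ hb
    rw [orthonormal_iff_ite.1 (𝒜.u N).orthonormal, if_neg (Ne.symm hb)]
    simp
  · simp

/-- An orthonormal eigenbasis diagonalises `A_N`, and `A_N` is `A` on `H_N⁻`: this is how the
coordinates see the true operator. -/
lemma inner_apply (𝒜 : ApproxSystem A r φ) (N : ℕ) (k) {x : H} (hx : x ∈ HNminus A φ N) :
    ⟪(𝒜.u N k : H), A x⟫_ℂ = 𝒜.lam N k * ⟪(𝒜.u N k : H), x⟫_ℂ := by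
  have h := inner_op 𝒜 N k ⟨x, HNminus_le_HN N hx⟩
  rw [Submodule.coe_inner, Submodule.coe_inner, 𝒜.op_minus N _ hx] at h
  exact h

lemma inner_phi (𝒜 : ApproxSystem A r φ) (N : ℕ) (k) :
    ⟪(𝒜.u N k : H), φ⟫_ℂ = (xi 𝒜 N k : ℂ) :=
  Complex.ext rfl (by simpa using (𝒜.xi_nonneg N k).2)

lemma xi_nonneg (𝒜 : ApproxSystem A r φ) (N : ℕ) (k) : 0 ≤ xi 𝒜 N k := (𝒜.xi_nonneg N k).1

lemma norm_inner_word (hr : 0 < r)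
    (hA : ContinuousLinearMap.adjoint A * A = (r : ℂ) • (1 : H →L[ℂ] H))
    (hA' : A * ContinuousLinearMap.adjoint A = (r : ℂ) • (1 : H →L[ℂ] H))
    (𝒜 : ApproxSystem A r φ) (N : ℕ) (k) {i j : ℕ} (hi : i ≤ N) (hj : j ≤ N) :
    ‖⟪(𝒜.u N k : H), word A φ i j⟫_ℂ‖ = Real.sqrt r ^ (i + j) * xi 𝒜 N k := by
  have hs : 0 < Real.sqrt r := Real.sqrt_pos.2 hr
  induction i with
  | zero =>
    induction j with
    | zero =>
      have : word A φ 0 0 = φ := by simp [word]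
      rw [this, inner_phi, Complex.norm_real, Real.norm_of_nonneg (xi_nonneg 𝒜 N k)]
      simp
    | succ j ih =>
      -- Powers of `A*` are reached backwards: `A` maps the word `(0, j+1)` to `r` times the word
      -- `(0, j)`. As the eigenvalue has modulus `√r`, one factor `√r` cancels.
      have h := inner_apply 𝒜 N k (word_mem_HNminus (A := A) (φ := φ) (i := 0) (by omega) hj)
      rw [apply_word_zero_succ hA', inner_smul_right] at h
      have h2 := congrArg norm h
      rw [norm_mul, norm_mul, ih (by omega), norm_lam hr hA, Complex.norm_real,
        Real.norm_of_nonneg hr.le] at h2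
      nth_rewrite 1 [← Real.mul_self_sqrt hr.le] at h2
      rw [mul_assoc] at h2
      have h3 := mul_left_cancel₀ hs.ne' h2
      rw [← h3]
      ring
  | succ i ih =>
    rw [word_succ_left, inner_apply 𝒜 N k (word_mem_HNminus (by omega) hj), norm_mul,
      norm_lam hr hA, ih (by omega)]
    ring

lemma xi_pos (hr : 0 < r)
    (hA : ContinuousLinearMap.adjoint A * A = (r : ℂ) • (1 : H →L[ℂ] H))
    (hA' : A * ContinuousLinearMap.adjoint A = (r : ℂ) • (1 : H →L[ℂ] H))
    (𝒜 : ApproxSystem A r φ) (N : ℕ) (k) : 0 < xi 𝒜 N k := by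
  refine lt_of_le_of_ne (xi_nonneg 𝒜 N k) fun h0 => ?_
  -- If `ξ_N(k) = 0`, the eigenvector is orthogonal to every generator of `H_N`, hence to itself.
  have : HN A φ N ≤ LinearMap.ker (innerSL ℂ (𝒜.u N k : H)).toLinearMap := by
    refine Submodule.span_le.2 ?_
    rintro _ ⟨i, j, hi, hj, rfl⟩
    have := norm_inner_word hr hA hA' 𝒜 N k hi hj
    rw [← h0, mul_zero, norm_eq_zero] at this
    simpa using this
  have h1 := this (𝒜.u N k).2
  have h2 : ⟪(𝒜.u N k : H), (𝒜.u N k : H)⟫_ℂ = 0 := by simpa using h1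
  rw [inner_self_eq_zero] at h2
  have h3 : ‖(𝒜.u N k : H)‖ = 1 := (𝒜.u N).orthonormal.1 k
  rw [h2, norm_zero] at h3
  exact zero_ne_one h3

lemma sum_sq_inner (𝒜 : ApproxSystem A r φ) (N : ℕ) {x : H} (hx : x ∈ HN A φ N) :
    ∑ k, ‖⟪(𝒜.u N k : H), x⟫_ℂ‖ ^ 2 = ‖x‖ ^ 2 := by
  have := (𝒜.u N).sum_sq_norm_inner_right ⟨x, hx⟩
  simpa [Submodule.coe_inner] using this

lemma sum_xi_sq (hφ : ‖φ‖ = 1) (𝒜 : ApproxSystem A r φ) (N : ℕ) :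
    ∑ k, xi 𝒜 N k ^ 2 = 1 := by
  have := sum_sq_inner 𝒜 N (phi_mem_HN (A := A) (φ := φ) N)
  simp only [inner_phi, Complex.norm_real, Real.norm_eq_abs, sq_abs, hφ] at this
  simpa using this

/-- The vectors of the dense subspace generated by `φ` have, for large `N`, coordinates that are
dominated by those of `φ`. -/
lemma exists_inner_polyOp_le (hr : 0 < r)
    (hA : ContinuousLinearMap.adjoint A * A = (r : ℂ) • (1 : H →L[ℂ] H))
    (hA' : A * ContinuousLinearMap.adjoint A = (r : ℂ) • (1 : H →L[ℂ] H))
    (𝒜 : ApproxSystem A r φ) (P : MvPolynomial (Fin 2) ℂ) :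
    ∃ (N₀ : ℕ) (C : ℝ), ∀ N ≥ N₀, polyOp A P φ ∈ HNminus A φ N ∧
      ∀ k, ‖⟪(𝒜.u N k : H), polyOp A P φ⟫_ℂ‖ ≤ C * xi 𝒜 N k := by
  have hsum : polyOp A P φ = ∑ m ∈ P.support, P.coeff m • word A φ (m 0) (m 1) := by
    simp [polyOp, word]
  rw [hsum]
  refine Finset.sum_induction _ (fun x : H => ∃ (N₀ : ℕ) (C : ℝ), ∀ N ≥ N₀, x ∈ HNminus A φ N ∧
      ∀ k, ‖⟪(𝒜.u N k : H), x⟫_ℂ‖ ≤ C * xi 𝒜 N k) ?_ ?_ ?_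
  · rintro x y ⟨N₁, C₁, h₁⟩ ⟨N₂, C₂, h₂⟩
    refine ⟨max N₁ N₂, C₁ + C₂, fun N hN => ⟨Submodule.add_mem _
      (h₁ N (le_trans (le_max_left _ _) hN)).1 (h₂ N (le_trans (le_max_right _ _) hN)).1,
      fun k => ?_⟩⟩
    rw [inner_add_right, add_mul]
    exact (norm_add_le _ _).trans (add_le_add ((h₁ N (le_trans (le_max_left _ _) hN)).2 k)
      ((h₂ N (le_trans (le_max_right _ _) hN)).2 k))
  · exact ⟨0, 0, fun N _ => ⟨Submodule.zero_mem _, by simp⟩⟩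
  · intro m _
    -- The extra `1` places the word in `H_N⁻`, where `A_N` agrees with `A`.
    refine ⟨m 0 + m 1 + 1, ‖P.coeff m‖ * Real.sqrt r ^ (m 0 + m 1), fun N hN =>
      ⟨Submodule.smul_mem _ _ (word_mem_HNminus (by omega) (by omega)), fun k => ?_⟩⟩
    rw [inner_smul_right, norm_mul, norm_inner_word hr hA hA' 𝒜 N k (by omega) (by omega),
      mul_assoc]

lemma isStarNormal_sub_algebraMap
    (hA : ContinuousLinearMap.adjoint A * A = (r : ℂ) • (1 : H →L[ℂ] H))
    (hA' : A * ContinuousLinearMap.adjoint A = (r : ℂ) • (1 : H →L[ℂ] H)) (z : ℂ) :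
    IsStarNormal (A - algebraMap ℂ (H →L[ℂ] H) z) := by
  have hn : star A * A = A * star A := by
    rw [ContinuousLinearMap.star_eq_adjoint, hA, hA']
  refine ⟨?_⟩
  rw [commute_iff_eq, star_sub, ← algebraMap_star_comm, sub_mul, sub_mul, mul_sub, mul_sub,
    mul_sub, mul_sub, hn, Algebra.commutes (star z) A, Algebra.commutes z (star A),
    Algebra.commutes (star z) (algebraMap ℂ (H →L[ℂ] H) z)]
  abel

/-- For a normal operator the orthogonal complement of the range is the kernel. So a lower bound,
which makes the kernel trivial, also makes the range dense, and the operator is invertible. -/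
lemma not_mem_spectrum_of_bounded_below
    (hA : ContinuousLinearMap.adjoint A * A = (r : ℂ) • (1 : H →L[ℂ] H))
    (hA' : A * ContinuousLinearMap.adjoint A = (r : ℂ) • (1 : H →L[ℂ] H)) {z : ℂ} {d : ℝ}
    (hd : 0 < d) (h : ∀ x, d * ‖x‖ ≤ ‖A x - z • x‖) : z ∉ spectrum ℂ A := by
  set T := A - algebraMap ℂ (H →L[ℂ] H) z with hT
  have hTx : ∀ x, T x = A x - z • x := fun x => by
    simp [hT, Algebra.algebraMap_eq_smul_one]
  have hanti : AntilipschitzWith (Real.toNNReal d⁻¹) T := by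
    refine AddMonoidHomClass.antilipschitz_of_bound T fun x => ?_
    rw [Real.coe_toNNReal _ (inv_pos.2 hd).le, hTx, ← div_eq_inv_mul, le_div_iff₀ hd, mul_comm]
    exact h x
  have hker : T.ker = ⊥ := LinearMap.ker_eq_bot.2 hanti.injective
  have hrange : T.rangeᗮ = ⊥ := by
    rw [ContinuousLinearMap.IsStarNormal.orthogonal_range (isStarNormal_sub_algebraMap hA hA' z), hker]
  have hdense : T.range.topologicalClosure = ⊤ :=
    Submodule.topologicalClosure_eq_top_iff.2 hrange
  have hunit : IsUnit T := by
    rw [ContinuousLinearMap.isUnit_iff_bijective,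
      ContinuousLinearMap.bijective_iff_dense_range_and_antilipschitz]
    exact ⟨hdense, _, hanti⟩
  rw [spectrum.notMem_iff, ← IsUnit.neg_iff]
  simpa [hT] using hunit

end Spectral

/-! ### The measures `μ_N` and `μⁿ`, and positivity near the spectrum -/

section Masses

variable {H : Type*} [NormedAddCommGroup H] [InnerProductSpace ℂ H] [CompleteSpace H]
variable {A : H →L[ℂ] H} {r : ℝ} {φ : H}

lemma mem_square_of_norm_le {M : ℕ} {z : ℂ} (h : ‖z‖ ≤ M) : z ∈ square M := by
  have h1 := abs_le.1 ((Complex.abs_re_le_norm z).trans h)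
  have h2 := abs_le.1 ((Complex.abs_im_le_norm z).trans h)
  exact ⟨h1.1, h1.2, h2.1, h2.2⟩

lemma muN_eq (𝒜 : ApproxSystem A r φ) (N : ℕ) (X : Set ℂ) :
    muN 𝒜 N X = open Classical in ∑ k, if 𝒜.lam N k ∈ X then xi 𝒜 N k ^ 2 else 0 := by
  classical
  rw [muN, Finset.sum_filter]

lemma muN_nonneg (𝒜 : ApproxSystem A r φ) (N : ℕ) (X : Set ℂ) : 0 ≤ muN 𝒜 N X :=
  Finset.sum_nonneg fun _ _ => sq_nonneg _

lemma muN_le_one (hφ : ‖φ‖ = 1) (𝒜 : ApproxSystem A r φ) (N : ℕ) (X : Set ℂ) :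
    muN 𝒜 N X ≤ 1 := by
  classical
  rw [← sum_xi_sq hφ 𝒜 N]
  refine (muN_eq 𝒜 N X).trans_le (Finset.sum_le_sum fun k _ => ?_)
  split_ifs
  · exact le_rfl
  · exact sq_nonneg _

lemma muN_le_sum {ι : Type*} (𝒜 : ApproxSystem A r φ) (N : ℕ) {X : Set ℂ} (s : Finset ι)
    {Y : ι → Set ℂ} (h : ∀ k, 𝒜.lam N k ∈ X → ∃ i ∈ s, 𝒜.lam N k ∈ Y i) :
    muN 𝒜 N X ≤ ∑ i ∈ s, muN 𝒜 N (Y i) := by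
  classical
  simp only [muN_eq]
  rw [Finset.sum_comm]
  refine Finset.sum_le_sum fun k _ => ?_
  split_ifs with hk
  · obtain ⟨i, hi, hki⟩ := h k hk
    refine le_trans ?_ (Finset.single_le_sum (fun j _ => ?_) hi)
    · simp [hki]
    · split_ifs <;> positivity
  · exact Finset.sum_nonneg fun j _ => by split_ifs <;> positivity

lemma sum_muN_le {ι : Type*} (𝒜 : ApproxSystem A r φ) (N : ℕ) (s : Finset ι)
    {Y : ι → Set ℂ} {X : Set ℂ} (h : ∀ i ∈ s, Y i ⊆ X)
    (hd : ∀ i ∈ s, ∀ j ∈ s, ∀ z, z ∈ Y i → z ∈ Y j → i = j) :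
    ∑ i ∈ s, muN 𝒜 N (Y i) ≤ muN 𝒜 N X := by
  classical
  simp only [muN_eq]
  rw [Finset.sum_comm]
  refine Finset.sum_le_sum fun k _ => ?_
  by_cases hex : ∃ i ∈ s, 𝒜.lam N k ∈ Y i
  · obtain ⟨i, hi, hki⟩ := hex
    rw [Finset.sum_eq_single i]
    · rw [if_pos hki, if_pos (h i hi hki)]
    · intro j hj hji
      exact if_neg fun hkj => hji (hd j hj i hi _ hkj hki)
    · exact fun hni => absurd hi hni
  · push Not at hex
    rw [Finset.sum_eq_zero fun i hi => if_neg (hex i hi)]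
    split_ifs <;> positivity

lemma muN_mono (𝒜 : ApproxSystem A r φ) (N : ℕ) {X Y : Set ℂ} (h : X ⊆ Y) :
    muN 𝒜 N X ≤ muN 𝒜 N Y := by
  simpa using muN_le_sum 𝒜 N (X := X) {()} (Y := fun _ => Y) fun k hk => ⟨(), by simp, h hk⟩

/-- The masses lie in the compact interval `[0, 1]`, so the ultralimit exists and `limUnder` has its
intended value. -/
lemma tendsto_muN (hφ : ‖φ‖ = 1) (𝒜 : ApproxSystem A r φ) (D : Ultrafilter ℕ) (X : Set ℂ) :
    Tendsto (fun N => muN 𝒜 N X) D (𝓝 (muNaive 𝒜 D X)) := by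
  refine tendsto_nhds_limUnder ?_
  obtain ⟨x, _, hx⟩ := (isCompact_Icc (a := (0 : ℝ)) (b := 1)).ultrafilter_le_nhds'
    (D.map fun N => muN 𝒜 N X) (Filter.mem_map.2 <| Filter.univ_mem' fun N =>
      ⟨muN_nonneg 𝒜 N X, muN_le_one hφ 𝒜 N X⟩)
  exact ⟨x, hx⟩

lemma muNaive_nonneg (hφ : ‖φ‖ = 1) (𝒜 : ApproxSystem A r φ) (D : Ultrafilter ℕ) (X : Set ℂ) :
    0 ≤ muNaive 𝒜 D X :=
  ge_of_tendsto' (tendsto_muN hφ 𝒜 D X) fun N => muN_nonneg 𝒜 N X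

lemma muNaive_mono (hφ : ‖φ‖ = 1) (𝒜 : ApproxSystem A r φ) (D : Ultrafilter ℕ) {X Y : Set ℂ}
    (h : X ⊆ Y) : muNaive 𝒜 D X ≤ muNaive 𝒜 D Y :=
  le_of_tendsto_of_tendsto' (tendsto_muN hφ 𝒜 D X) (tendsto_muN hφ 𝒜 D Y) fun N => muN_mono 𝒜 N h

lemma muNaive_le_sum {ι : Type*} (hφ : ‖φ‖ = 1) (𝒜 : ApproxSystem A r φ) (D : Ultrafilter ℕ)
    {X : Set ℂ} (s : Finset ι) {Y : ι → Set ℂ} (h : ∀ z ∈ X, ∃ i ∈ s, z ∈ Y i) :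
    muNaive 𝒜 D X ≤ ∑ i ∈ s, muNaive 𝒜 D (Y i) :=
  le_of_tendsto_of_tendsto' (tendsto_muN hφ 𝒜 D X)
    (tendsto_finsetSum s fun i _ => tendsto_muN hφ 𝒜 D (Y i))
    fun N => muN_le_sum 𝒜 N s fun _ hk => h _ hk

lemma muNaive_union_le (hφ : ‖φ‖ = 1) (𝒜 : ApproxSystem A r φ) (D : Ultrafilter ℕ)
    (X Y : Set ℂ) : muNaive 𝒜 D (X ∪ Y) ≤ muNaive 𝒜 D X + muNaive 𝒜 D Y := by
  have := muNaive_le_sum hφ 𝒜 D (X := X ∪ Y) (Finset.univ : Finset Bool)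
    (Y := fun b => if b then X else Y) (fun z hz => by
      rcases hz with hz | hz
      · exact ⟨true, by simp, by simpa using hz⟩
      · exact ⟨false, by simp, by simpa using hz⟩)
  simpa using this

lemma sum_muNaive_le_one {ι : Type*} (hφ : ‖φ‖ = 1) (𝒜 : ApproxSystem A r φ) (D : Ultrafilter ℕ)
    (s : Finset ι) {Y : ι → Set ℂ}
    (hd : ∀ i ∈ s, ∀ j ∈ s, ∀ z, z ∈ Y i → z ∈ Y j → i = j) :
    ∑ i ∈ s, muNaive 𝒜 D (Y i) ≤ 1 :=
  le_of_tendsto' (tendsto_finsetSum s fun i _ => tendsto_muN hφ 𝒜 D (Y i))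
    fun N => (sum_muN_le 𝒜 N s (X := univ) (fun _ _ => subset_univ _) hd).trans
      (muN_le_one hφ 𝒜 N _)

/-- If the eigenvalues avoid `X`, then `X` has no mass. -/
lemma muNaive_eq_zero (hφ : ‖φ‖ = 1) (𝒜 : ApproxSystem A r φ) (D : Ultrafilter ℕ) {X : Set ℂ}
    (h : ∀ N k, 𝒜.lam N k ∉ X) : muNaive 𝒜 D X = 0 := by
  refine tendsto_nhds_unique (tendsto_muN hφ 𝒜 D X) ?_
  have : ∀ N, muN 𝒜 N X = 0 := fun N => by
    classical
    rw [muN_eq]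
    exact Finset.sum_eq_zero fun k _ => if_neg (h N k)
  simp [this]

/-- Every neighbourhood of a point of the spectrum has a positive mass. -/
lemma muNaive_pos (hr : 0 < r)
    (hA : ContinuousLinearMap.adjoint A * A = (r : ℂ) • (1 : H →L[ℂ] H))
    (hA' : A * ContinuousLinearMap.adjoint A = (r : ℂ) • (1 : H →L[ℂ] H))
    (hφ : ‖φ‖ = 1) (hcyc : IsCyclic A φ) (𝒜 : ApproxSystem A r φ) (D : Ultrafilter ℕ)
    (hD : ∀ m, ∀ᶠ N in (D : Filter ℕ), m ≤ N)
    {z : ℂ} (hz : z ∈ spectrum ℂ A) {X : Set ℂ} (hX : X ∈ 𝓝 z) : 0 < muNaive 𝒜 D X := by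
  classical
  obtain ⟨d, hd, hdX⟩ := Metric.mem_nhds_iff.1 hX
  refine lt_of_le_of_ne (muNaive_nonneg hφ 𝒜 D X) fun h0 => ?_
  refine not_mem_spectrum_of_bounded_below hA hA' hd ?_ hz
  -- The lower bound is a closed condition on `x`, so it suffices to check it on the dense set of
  -- the vectors `P(A, A*) φ`.
  refine fun x => hcyc.induction_on (p := fun x => d * ‖x‖ ≤ ‖A x - z • x‖) x
    (isClosed_le (by fun_prop) (by fun_prop)) fun P => ?_
  obtain ⟨N₀, C, hC⟩ := exists_inner_polyOp_le hr hA hA' 𝒜 P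
  set x := polyOp A P φ
  -- Coordinatewise: where the eigenvalue lies in `X`, the coordinate is at most `C ξ_N(k)`;
  -- elsewhere `|λ_N(k) - z| ≥ d`. The first kind contributes a multiple of `μ_N(X)`, which vanishes
  -- in the limit.
  have key : ∀ N ≥ N₀, d ^ 2 * ‖x‖ ^ 2 ≤ d ^ 2 * C ^ 2 * muN 𝒜 N X + ‖A x - z • x‖ ^ 2 := by
    intro N hN
    obtain ⟨hxm, hxC⟩ := hC N hN
    rw [← sum_sq_inner 𝒜 N (HNminus_le_HN N hxm), ← sum_sq_inner 𝒜 N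
      (Submodule.sub_mem _ (apply_mem_HN hxm) (Submodule.smul_mem _ z (HNminus_le_HN N hxm))),
      muN_eq, Finset.mul_sum, Finset.mul_sum, ← Finset.sum_add_distrib]
    refine Finset.sum_le_sum fun k _ => ?_
    rw [inner_sub_right, inner_apply 𝒜 N k hxm, inner_smul_right, ← sub_mul, norm_mul, mul_pow]
    split_ifs with hk
    · have h1 : ‖⟪(𝒜.u N k : H), x⟫_ℂ‖ ^ 2 ≤ (C * xi 𝒜 N k) ^ 2 :=
        pow_le_pow_left₀ (norm_nonneg _) (hxC k) 2
      have h2 := mul_le_mul_of_nonneg_left h1 (sq_nonneg d)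
      have h3 : 0 ≤ ‖𝒜.lam N k - z‖ ^ 2 * ‖⟪(𝒜.u N k : H), x⟫_ℂ‖ ^ 2 := by positivity
      calc _ ≤ _ := h2
        _ = d ^ 2 * C ^ 2 * xi 𝒜 N k ^ 2 := by ring
        _ ≤ _ := le_add_of_nonneg_right h3
    · have h1 : d ≤ ‖𝒜.lam N k - z‖ := by
        by_contra hlt
        exact hk (hdX (by rw [Metric.mem_ball, dist_eq_norm]; exact not_le.1 hlt))
      have h2 : d ^ 2 ≤ ‖𝒜.lam N k - z‖ ^ 2 := pow_le_pow_left₀ hd.le h1 2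
      rw [mul_zero, zero_add]
      exact mul_le_mul_of_nonneg_right h2 (sq_nonneg _)
  have hlim : Tendsto (fun N => d ^ 2 * C ^ 2 * muN 𝒜 N X + ‖A x - z • x‖ ^ 2) D
      (𝓝 (d ^ 2 * C ^ 2 * muNaive 𝒜 D X + ‖A x - z • x‖ ^ 2)) :=
    ((tendsto_muN hφ 𝒜 D X).const_mul _).add_const _
  rw [← h0, mul_zero, zero_add] at hlim
  have := ge_of_tendsto hlim ((hD N₀).mono key)
  rw [← mul_pow] at this
  exact (sq_le_sq₀ (by positivity) (norm_nonneg _)).1 this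

end Masses

/-- The real part (for `true`) or the imaginary part (for `false`). -/
def coord : Bool → ℂ → ℝ
  | true, z => z.re
  | false, z => z.im

lemma continuous_coord : ∀ b, Continuous (coord b)
  | true => Complex.continuous_re
  | false => Complex.continuous_im

lemma coord_mem_Icc {M : ℕ} {z : ℂ} (hz : z ∈ square M) :
    ∀ b, coord b z ∈ Icc (-(M : ℝ)) M
  | true => ⟨hz.1, hz.2.1⟩
  | false => ⟨hz.2.2.1, hz.2.2.2⟩

/-- The strip of the points of the square whose coordinate `b` differs from `s` by less than
`ε`. -/
def strip (M : ℕ) (b : Bool) (s ε : ℝ) : Set ℂ := {z | z ∈ square M ∧ |coord b z - s| < ε}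

lemma strip_mono (M : ℕ) (b : Bool) (s : ℝ) {ε ε' : ℝ} (h : ε ≤ ε') :
    strip M b s ε ⊆ strip M b s ε' := fun _ hz => ⟨hz.1, hz.2.trans_le h⟩

lemma isOpen_box {M : ℕ} {a b c d : ℝ} (ha : a ∈ Icc (-(M : ℝ)) M) (hb : b ∈ Icc (-(M : ℝ)) M)
    (hc : c ∈ Icc (-(M : ℝ)) M) (hd : d ∈ Icc (-(M : ℝ)) M) : IsOpen (box M a b c d) := by
  have : box M a b c d = {z : ℂ | (a < z.re ∧ z.re < b) ∧ (c < z.im ∧ z.im < d)} := by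
    ext z
    refine ⟨fun h => h.2, fun h => ⟨⟨?_, ?_, ?_, ?_⟩, h⟩⟩
    · linarith [h.1.1, ha.1]
    · linarith [h.1.2, hb.2]
    · linarith [h.2.1, hc.1]
    · linarith [h.2.2, hd.2]
  rw [this]
  have h1 := Complex.continuous_re
  have h2 := Complex.continuous_im
  exact ((isOpen_lt continuous_const h1).inter (isOpen_lt h1 continuous_const)).inter
    ((isOpen_lt continuous_const h2).inter (isOpen_lt h2 continuous_const))

/-! ### Agreement of `μ` and `μⁿ` on boxes with null sides -/

section BoxMass

variable {H : Type*} [NormedAddCommGroup H] [InnerProductSpace ℂ H] [CompleteSpace H]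
variable {A : H →L[ℂ] H} {r : ℝ} {φ : H}

/-- The strips around the line on which coordinate `b` equals `s` have arbitrarily small mass. -/
def IsNull (𝒜 : ApproxSystem A r φ) (D : Ultrafilter ℕ) (M : ℕ) (b : Bool) (s : ℝ) : Prop :=
  ∀ δ > 0, ∃ ε > 0, muNaive 𝒜 D (strip M b s ε) < δ

lemma exists_mem_near_left {𝒜 : ApproxSystem A r φ} {D : Ultrafilter ℕ} {M : ℕ} {NI : Set ℝ}
    (hNI : IsNiceDense 𝒜 D M NI) {a ε : ℝ} (ha : a ∈ Icc (-(M : ℝ)) M) (hε : 0 < ε) :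
    ∃ a' ∈ NI, a - ε < a' ∧ a' ≤ a := by
  rcases eq_or_lt_of_le ha.1 with h | h
  · exact ⟨_, hNI.left_mem, by linarith, h.le⟩
  · obtain ⟨x, hx1, hx2⟩ := exists_between (max_lt (sub_lt_self a hε) h)
    have hx : x ∈ closure NI := hNI.dense ⟨(le_max_right _ _).trans hx1.le, hx2.le.trans ha.2⟩
    obtain ⟨y, hy, hyNI⟩ := mem_closure_iff.1 hx _ isOpen_Ioo ⟨hx1, hx2⟩
    exact ⟨y, hyNI, (le_max_left _ _).trans_lt hy.1, hy.2.le⟩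

lemma exists_mem_near_right {𝒜 : ApproxSystem A r φ} {D : Ultrafilter ℕ} {M : ℕ} {NI : Set ℝ}
    (hNI : IsNiceDense 𝒜 D M NI) {a ε : ℝ} (ha : a ∈ Icc (-(M : ℝ)) M) (hε : 0 < ε) :
    ∃ a' ∈ NI, a ≤ a' ∧ a' < a + ε := by
  rcases eq_or_lt_of_le ha.2 with h | h
  · exact ⟨_, hNI.right_mem, h.le, by linarith⟩
  · obtain ⟨x, hx1, hx2⟩ := exists_between (lt_min (lt_add_of_pos_right a hε) h)
    have hx : x ∈ closure NI := hNI.dense ⟨ha.1.trans hx1.le, hx2.le.trans (min_le_right _ _)⟩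
    obtain ⟨y, hy, hyNI⟩ := mem_closure_iff.1 hx _ isOpen_Ioo ⟨hx1, hx2⟩
    exact ⟨y, hyNI, hy.1.le, hy.2.trans_le (min_le_left _ _)⟩

/-- A common width for which the strips at the four sides of a box are small. -/
lemma exists_sides_small (hφ : ‖φ‖ = 1) {𝒜 : ApproxSystem A r φ} {D : Ultrafilter ℕ} {M : ℕ}
    {a b c d : ℝ} (ha : IsNull 𝒜 D M true a) (hb : IsNull 𝒜 D M true b)
    (hc : IsNull 𝒜 D M false c) (hd : IsNull 𝒜 D M false d) {δ : ℝ} (hδ : 0 < δ) :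
    ∃ ε > 0, muNaive 𝒜 D ((strip M true a ε ∪ strip M true b ε) ∪
      (strip M false c ε ∪ strip M false d ε)) < δ := by
  obtain ⟨ε₁, h₁, ha⟩ := ha (δ / 4) (by positivity)
  obtain ⟨ε₂, h₂, hb⟩ := hb (δ / 4) (by positivity)
  obtain ⟨ε₃, h₃, hc⟩ := hc (δ / 4) (by positivity)
  obtain ⟨ε₄, h₄, hd⟩ := hd (δ / 4) (by positivity)
  refine ⟨min (min ε₁ ε₂) (min ε₃ ε₄), by positivity, ?_⟩
  have k₁ : min (min ε₁ ε₂) (min ε₃ ε₄) ≤ ε₁ := (min_le_left _ _).trans (min_le_left _ _)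
  have k₂ : min (min ε₁ ε₂) (min ε₃ ε₄) ≤ ε₂ := (min_le_left _ _).trans (min_le_right _ _)
  have k₃ : min (min ε₁ ε₂) (min ε₃ ε₄) ≤ ε₃ := (min_le_right _ _).trans (min_le_left _ _)
  have k₄ : min (min ε₁ ε₂) (min ε₃ ε₄) ≤ ε₄ := (min_le_right _ _).trans (min_le_right _ _)
  have e₁ := muNaive_mono hφ 𝒜 D (strip_mono M true a k₁)
  have e₂ := muNaive_mono hφ 𝒜 D (strip_mono M true b k₂)
  have e₃ := muNaive_mono hφ 𝒜 D (strip_mono M false c k₃)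
  have e₄ := muNaive_mono hφ 𝒜 D (strip_mono M false d k₄)
  generalize min (min ε₁ ε₂) (min ε₃ ε₄) = ε at *
  have u₁ := muNaive_union_le hφ 𝒜 D (strip M true a ε) (strip M true b ε)
  have u₂ := muNaive_union_le hφ 𝒜 D (strip M false c ε) (strip M false d ε)
  have u₃ := muNaive_union_le hφ 𝒜 D (strip M true a ε ∪ strip M true b ε)
    (strip M false c ε ∪ strip M false d ε)
  linarith

/-- The sides need not belong to `NI`, so the box is enlarged slightly to one in `Sq*`; the excess
lies in four strips of small total mass. -/
lemma muStar_box_le (hφ : ‖φ‖ = 1) {𝒜 : ApproxSystem A r φ} {D : Ultrafilter ℕ} {M : ℕ}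
    {NI : Set ℝ} (hNI : IsNiceDense 𝒜 D M NI) {a b c d : ℝ}
    (ha : a ∈ Icc (-(M : ℝ)) M) (hb : b ∈ Icc (-(M : ℝ)) M)
    (hc : c ∈ Icc (-(M : ℝ)) M) (hd : d ∈ Icc (-(M : ℝ)) M)
    (ha' : IsNull 𝒜 D M true a) (hb' : IsNull 𝒜 D M true b)
    (hc' : IsNull 𝒜 D M false c) (hd' : IsNull 𝒜 D M false d) :
    muStar 𝒜 D M NI (box M a b c d) ≤ ENNReal.ofReal (muNaive 𝒜 D (box M a b c d)) := by
  refine ENNReal.le_of_forall_pos_le_add fun δ hδ _ => ?_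
  obtain ⟨ε, hε, hlt⟩ := exists_sides_small hφ ha' hb' hc' hd' (δ := δ) (by exact_mod_cast hδ)
  obtain ⟨a₁, haN, ha₁, ha₂⟩ := exists_mem_near_left hNI ha hε
  obtain ⟨b₁, hbN, hb₁, hb₂⟩ := exists_mem_near_right hNI hb hε
  obtain ⟨c₁, hcN, hc₁, hc₂⟩ := exists_mem_near_left hNI hc hε
  obtain ⟨d₁, hdN, hd₁, hd₂⟩ := exists_mem_near_right hNI hd hε
  have hempty : box M (M : ℝ) M M M = ∅ :=
    eq_empty_of_forall_notMem fun z hz => lt_asymm hz.2.1.1 hz.2.1.2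
  -- The definition asks for a sequence of boxes; it is filled up with a degenerate, hence empty,
  -- member of `Sq*`.
  refine iInf₂_le_of_le (fun i => if i = 0 then box M a₁ b₁ c₁ d₁ else box M (M : ℝ) M M M)
    ⟨fun i => ?_, fun z hz => mem_iUnion.2 ⟨0, ?_⟩⟩ ?_
  · dsimp only
    split_ifs
    · exact ⟨a₁, haN, b₁, hbN, c₁, hcN, d₁, hdN, rfl⟩
    · exact ⟨_, hNI.right_mem, _, hNI.right_mem, _, hNI.right_mem, _, hNI.right_mem, rfl⟩
  · obtain ⟨h0, ⟨h1, h2⟩, h3, h4⟩ := hz.1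
    exact ⟨h0, ⟨by linarith, by linarith⟩, by linarith, by linarith⟩
  · have h0 : muNaive 𝒜 D (box M (M : ℝ) M M M) = 0 := by
      rw [hempty]
      exact muNaive_eq_zero hφ 𝒜 D fun _ _ h => h
    rw [tsum_eq_single 0 (fun i hi => by simp only [if_neg hi, h0, ENNReal.ofReal_zero])]
    simp only [if_true]
    rw [← ENNReal.ofReal_coe_nnreal, ← ENNReal.ofReal_add (muNaive_nonneg hφ 𝒜 D _) δ.coe_nonneg]
    refine ENNReal.ofReal_le_ofReal ?_
    have hsub : box M a₁ b₁ c₁ d₁ ⊆ box M a b c d ∪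
        ((strip M true a ε ∪ strip M true b ε) ∪ (strip M false c ε ∪ strip M false d ε)) := by
      rintro z ⟨h0, ⟨h1, h2⟩, h3, h4⟩
      by_cases k1 : a < z.re
      · by_cases k2 : z.re < b
        · by_cases k3 : c < z.im
          · by_cases k4 : z.im < d
            · exact Or.inl ⟨h0, ⟨k1, k2⟩, k3, k4⟩
            · exact Or.inr (Or.inr (Or.inr ⟨h0, abs_lt.2 ⟨by simp only [coord]; linarith,
                by simp only [coord]; linarith⟩⟩))
          · exact Or.inr (Or.inr (Or.inl ⟨h0, abs_lt.2 ⟨by simp only [coord]; linarith,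
              by simp only [coord]; linarith⟩⟩))
        · exact Or.inr (Or.inl (Or.inr ⟨h0, abs_lt.2 ⟨by simp only [coord]; linarith,
            by simp only [coord]; linarith⟩⟩))
      · exact Or.inr (Or.inl (Or.inl ⟨h0, abs_lt.2 ⟨by simp only [coord]; linarith,
          by simp only [coord]; linarith⟩⟩))
    exact ((muNaive_mono hφ 𝒜 D hsub).trans (muNaive_union_le hφ 𝒜 D _ _)).trans
      (add_le_add le_rfl hlt.le)

/-- The naive measure is only finitely subadditive, so compactness is needed: a slightly smaller
closed rectangle is covered by finitely many of the given open boxes, and the remaining frame lies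
in four strips of small mass. -/
lemma le_muStar_box (hφ : ‖φ‖ = 1) {𝒜 : ApproxSystem A r φ} {D : Ultrafilter ℕ} {M : ℕ}
    {NI : Set ℝ} (hNI : IsNiceDense 𝒜 D M NI) {a b c d : ℝ}
    (ha : a ∈ Icc (-(M : ℝ)) M) (hb : b ∈ Icc (-(M : ℝ)) M)
    (hc : c ∈ Icc (-(M : ℝ)) M) (hd : d ∈ Icc (-(M : ℝ)) M)
    (ha' : IsNull 𝒜 D M true a) (hb' : IsNull 𝒜 D M true b)
    (hc' : IsNull 𝒜 D M false c) (hd' : IsNull 𝒜 D M false d) :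
    ENNReal.ofReal (muNaive 𝒜 D (box M a b c d)) ≤ muStar 𝒜 D M NI (box M a b c d) := by
  refine le_iInf₂ fun Y hY => ?_
  refine ENNReal.le_of_forall_pos_le_add fun δ hδ _ => ?_
  obtain ⟨ε, hε, hlt⟩ := exists_sides_small hφ ha' hb' hc' hd' (δ := δ) (by exact_mod_cast hδ)
  set K : Set ℂ := Icc (a + ε) (b - ε) ×ℂ Icc (c + ε) (d - ε) with hK
  have hKc : IsCompact K := isCompact_Icc.reProdIm isCompact_Icc
  have hopen := isOpen_box ha hb hc hd
  have hKbox : K ⊆ box M a b c d := by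
    rintro z hz
    obtain ⟨⟨h1, h2⟩, h3, h4⟩ := Complex.mem_reProdIm.1 hz
    refine ⟨⟨?_, ?_, ?_, ?_⟩, ⟨?_, ?_⟩, ?_, ?_⟩ <;> linarith [ha.1, hb.2, hc.1, hd.2]
  have hint : box M a b c d ⊆ interior (square M) := interior_maximal (fun z hz => hz.1) hopen
  have hYo : ∀ i, IsOpen (Y i) := fun i => by
    obtain ⟨a, ha, b, hb, c, hc, d, hd, h⟩ := hY.1 i
    rw [h]
    exact isOpen_box (hNI.nice a ha).1 (hNI.nice b hb).1 (hNI.nice c hc).1 (hNI.nice d hd).1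
  obtain ⟨t, ht⟩ := hKc.elim_finite_subcover Y hYo
    (fun z hz => hY.2 ⟨hKbox hz, hint (hKbox hz)⟩)
  have hsub : box M a b c d ⊆ K ∪
      ((strip M true a ε ∪ strip M true b ε) ∪ (strip M false c ε ∪ strip M false d ε)) := by
    rintro z ⟨h0, ⟨h1, h2⟩, h3, h4⟩
    by_cases k1 : a + ε ≤ z.re
    · by_cases k2 : z.re ≤ b - ε
      · by_cases k3 : c + ε ≤ z.im
        · by_cases k4 : z.im ≤ d - ε
          · exact Or.inl (Complex.mem_reProdIm.2 ⟨⟨k1, k2⟩, k3, k4⟩)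
          · exact Or.inr (Or.inr (Or.inr ⟨h0, abs_lt.2 ⟨by simp only [coord]; linarith,
              by simp only [coord]; linarith⟩⟩))
        · exact Or.inr (Or.inr (Or.inl ⟨h0, abs_lt.2 ⟨by simp only [coord]; linarith,
            by simp only [coord]; linarith⟩⟩))
      · exact Or.inr (Or.inl (Or.inr ⟨h0, abs_lt.2 ⟨by simp only [coord]; linarith,
          by simp only [coord]; linarith⟩⟩))
    · exact Or.inr (Or.inl (Or.inl ⟨h0, abs_lt.2 ⟨by simp only [coord]; linarith,
        by simp only [coord]; linarith⟩⟩))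
  have h1 : muNaive 𝒜 D (box M a b c d) ≤ ∑ i ∈ t, muNaive 𝒜 D (Y i) + δ := by
    refine ((muNaive_mono hφ 𝒜 D hsub).trans (muNaive_union_le hφ 𝒜 D _ _)).trans
      (add_le_add ?_ hlt.le)
    exact muNaive_le_sum hφ 𝒜 D t fun z hz => by simpa using ht hz
  calc ENNReal.ofReal (muNaive 𝒜 D (box M a b c d))
      ≤ ENNReal.ofReal (∑ i ∈ t, muNaive 𝒜 D (Y i) + δ) := ENNReal.ofReal_le_ofReal h1
    _ = ∑ i ∈ t, ENNReal.ofReal (muNaive 𝒜 D (Y i)) + δ := by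
      rw [ENNReal.ofReal_add (Finset.sum_nonneg fun i _ => muNaive_nonneg hφ 𝒜 D (Y i)) δ.coe_nonneg,
        ENNReal.ofReal_sum_of_nonneg fun i _ => muNaive_nonneg hφ 𝒜 D (Y i),
        ENNReal.ofReal_coe_nnreal]
    _ ≤ _ := add_le_add (ENNReal.sum_le_tsum t) le_rfl

/-- On boxes whose sides carry no mass, the measure is the naive measure. -/
lemma mu_box_eq (hφ : ‖φ‖ = 1) {𝒜 : ApproxSystem A r φ} {D : Ultrafilter ℕ} {M : ℕ}
    {NI : Set ℝ} (hNI : IsNiceDense 𝒜 D M NI) {a b c d : ℝ}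
    (ha : a ∈ Icc (-(M : ℝ)) M) (hb : b ∈ Icc (-(M : ℝ)) M)
    (hc : c ∈ Icc (-(M : ℝ)) M) (hd : d ∈ Icc (-(M : ℝ)) M)
    (ha' : IsNull 𝒜 D M true a) (hb' : IsNull 𝒜 D M true b)
    (hc' : IsNull 𝒜 D M false c) (hd' : IsNull 𝒜 D M false d) :
    mu 𝒜 D M NI (box M a b c d) = muNaive 𝒜 D (box M a b c d) := by
  rw [mu, le_antisymm (muStar_box_le hφ hNI ha hb hc hd ha' hb' hc' hd')
    (le_muStar_box hφ hNI ha hb hc hd ha' hb' hc' hd'),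
    ENNReal.toReal_ofReal (muNaive_nonneg hφ 𝒜 D _)]

end BoxMass

/-! ### Bounded functionals on `C(S)` and functions supported near lines -/

section Functionals

variable {M : ℕ}

/-- `θ` is bounded by `K` times the supremum of `|f|` on `σ`. -/
def IsBoundedOn (σ : Set ℂ) (K : ℝ) (θ : C(square M, ℂ) →ₛₗ[starRingEnd ℂ] ℂ) : Prop :=
  ∀ (f : C(square M, ℂ)) (c : ℝ), 0 ≤ c → (∀ x : square M, (x : ℂ) ∈ σ → ‖f x‖ ≤ c) →
    ‖θ f‖ ≤ K * c

variable {σ : Set ℂ} {K : ℝ} {θ : C(square M, ℂ) →ₛₗ[starRingEnd ℂ] ℂ}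

lemma IsBoundedOn.eq_zero (hK : IsBoundedOn σ K θ) {f : C(square M, ℂ)}
    (h : ∀ x : square M, (x : ℂ) ∈ σ → f x = 0) : θ f = 0 := by
  have := hK f 0 le_rfl fun x hx => by rw [h x hx, norm_zero]
  rw [mul_zero] at this
  exact norm_le_zero_iff.1 this

/-- Finite total variation: rotating each `f i` by a phase that makes `θ (f i)` non-negative turns
the sum into one value of `θ`, at a function still bounded by `c` because at most one term is
non-zero at each point. -/
lemma IsBoundedOn.sum_norm_le {ι : Type*} (hK : IsBoundedOn σ K θ) (s : Finset ι)
    (f : ι → C(square M, ℂ)) {c : ℝ} (hc : 0 ≤ c) (h : ∀ i ∈ s, ∀ x, ‖f i x‖ ≤ c)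
    (hd : ∀ i ∈ s, ∀ j ∈ s, ∀ x, f i x ≠ 0 → f j x ≠ 0 → i = j) :
    ∑ i ∈ s, ‖θ (f i)‖ ≤ K * c := by
  -- Where `θ (f i) = 0`, division by zero makes this phase `0`, which is harmless. The conjugate in
  -- `hu2` is due to the antilinearity of `θ`.
  set u : ι → ℂ := fun i => θ (f i) / ‖θ (f i)‖ with hu
  have hu1 : ∀ i, ‖u i‖ ≤ 1 := fun i => by
    simp only [hu, norm_div, Complex.norm_real, norm_norm]
    exact div_self_le_one _
  have hu2 : ∀ i, starRingEnd ℂ (u i) * θ (f i) = (‖θ (f i)‖ : ℂ) := fun i => by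
    simp only [hu, map_div₀, Complex.conj_ofReal]
    rw [div_mul_eq_mul_div, mul_comm, Complex.mul_conj, Complex.normSq_eq_norm_sq]
    rcases eq_or_ne (‖θ (f i)‖) 0 with h0 | h0
    · simp [h0]
    · have : (‖θ (f i)‖ : ℂ) ≠ 0 := by exact_mod_cast h0
      push_cast
      field_simp
  have key : θ (∑ i ∈ s, u i • f i) = ((∑ i ∈ s, ‖θ (f i)‖ : ℝ) : ℂ) := by
    rw [map_sum]
    push_cast
    exact Finset.sum_congr rfl fun i _ => by rw [map_smulₛₗ, smul_eq_mul, hu2]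
  have hb := hK (∑ i ∈ s, u i • f i) c hc fun x _ => by
    rw [ContinuousMap.sum_apply]
    by_cases hex : ∃ i ∈ s, f i x ≠ 0
    · obtain ⟨i, hi, hix⟩ := hex
      rw [Finset.sum_eq_single i (fun j hj hji => ?_) (fun hni => absurd hi hni)]
      · rw [ContinuousMap.smul_apply, norm_smul]
        calc ‖u i‖ * ‖f i x‖ ≤ 1 * c :=
              mul_le_mul (hu1 i) (h i hi x) (norm_nonneg _) zero_le_one
          _ = c := one_mul c
      · by_contra h0
        refine hji (hd j hj i hi x (fun h1 => h0 ?_) hix)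
        rw [ContinuousMap.smul_apply, h1, smul_zero]
    · push Not at hex
      rw [Finset.sum_eq_zero fun i hi => by rw [ContinuousMap.smul_apply, hex i hi, smul_zero],
        norm_zero]
      exact hc
  rw [key, Complex.norm_real, Real.norm_eq_abs] at hb
  exact (le_abs_self _).trans hb

/-- A continuous function that is `1` where coordinate `b` is within `ε` of `s`, and `0` where it
is not within `2ε` of `s`. -/
def ramp (M : ℕ) (b : Bool) (s ε : ℝ) : C(square M, ℂ) :=
  ⟨fun x => ((max 0 (min 1 (2 - |coord b x - s| / ε)) : ℝ) : ℂ), by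
    have := (continuous_coord b).comp (continuous_subtype_val (p := fun z => z ∈ square M))
    refine Complex.continuous_ofReal.comp (continuous_const.max (continuous_const.min
      (continuous_const.sub (Continuous.div_const ?_ _))))
    exact (this.sub continuous_const).abs⟩

lemma ramp_apply (b : Bool) (s ε : ℝ) (x : square M) :
    ramp M b s ε x = ((max 0 (min 1 (2 - |coord b x - s| / ε)) : ℝ) : ℂ) := rfl

lemma norm_ramp_le (b : Bool) (s ε : ℝ) (x : square M) : ‖ramp M b s ε x‖ ≤ 1 := by
  rw [ramp_apply, Complex.norm_real, Real.norm_of_nonneg (le_max_left _ _)]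
  exact max_le zero_le_one (min_le_left _ _)

lemma norm_one_sub_ramp_le (b : Bool) (s ε : ℝ) (x : square M) : ‖1 - ramp M b s ε x‖ ≤ 1 := by
  rw [ramp_apply, ← Complex.ofReal_one, ← Complex.ofReal_sub, Complex.norm_real,
    Real.norm_eq_abs, abs_le]
  have h1 : 0 ≤ max 0 (min 1 (2 - |coord b x - s| / ε)) := le_max_left _ _
  have h2 : max 0 (min 1 (2 - |coord b x - s| / ε)) ≤ 1 := max_le zero_le_one (min_le_left _ _)
  constructor <;> linarith

lemma ramp_eq_one {b : Bool} {s ε : ℝ} (hε : 0 < ε) {x : square M} (h : |coord b x - s| ≤ ε) :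
    ramp M b s ε x = 1 := by
  have : |coord b x - s| / ε ≤ 1 := (div_le_one hε).2 h
  rw [ramp_apply, min_eq_left (by linarith), max_eq_right zero_le_one, Complex.ofReal_one]

lemma ramp_eq_zero {b : Bool} {s ε : ℝ} (hε : 0 < ε) {x : square M}
    (h : 2 * ε ≤ |coord b x - s|) : ramp M b s ε x = 0 := by
  have : 2 ≤ |coord b x - s| / ε := (le_div_iff₀ hε).2 h
  rw [ramp_apply, min_eq_right (by linarith), max_eq_left (by linarith), Complex.ofReal_zero]

/-- A function that is supported near finitely many lines is split into functions each of which is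
supported near one of them. -/
lemma norm_le_sum_of_near_lines {ι : Type*} (t : Finset ι) (b : ι → Bool) (s : ι → ℝ) {ε : ℝ}
    (hε : 0 < ε) (η : ι → ℝ)
    (hη : ∀ i ∈ t, ∀ f, IsXFunction (strip M (b i) (s i) (2 * ε)) f → ‖θ f‖ ≤ η i)
    (f : C(square M, ℂ)) (hf : ∀ x, ‖f x‖ ≤ 1)
    (hf0 : ∀ x : square M, (∀ i ∈ t, ε < |coord (b i) x - s i|) → f x = 0) :
    ‖θ f‖ ≤ ∑ i ∈ t, η i := by
  classical
  induction t using Finset.induction_on generalizing f with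
  | empty =>
    have : f = 0 := ContinuousMap.ext fun x => hf0 x (by simp)
    simp [this]
  | insert i t hi ih =>
    rw [Finset.sum_insert hi]
    -- The first summand is supported in the strip of width `2ε` about line `i`. The second vanishes
    -- within `ε` of that line and falls under the induction hypothesis for the other lines.
    have hsplit : f = f * ramp M (b i) (s i) ε + f * (1 - ramp M (b i) (s i) ε) := by ring
    rw [hsplit, map_add]
    refine (norm_add_le _ _).trans (add_le_add ?_ ?_)
    · refine hη i (Finset.mem_insert_self i t) _ ⟨fun x => ?_, fun x hx => ?_⟩
      · rw [ContinuousMap.mul_apply, norm_mul]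
        exact mul_le_one₀ (hf x) (norm_nonneg _) (norm_ramp_le _ _ _ _)
      · rw [ContinuousMap.mul_apply, ramp_eq_zero hε, mul_zero]
        by_contra hlt
        exact hx ⟨x.2, not_le.1 hlt⟩
    · refine ih (fun j hj => hη j (Finset.mem_insert_of_mem hj)) _ (fun x => ?_) fun x hx => ?_
      · rw [ContinuousMap.mul_apply, norm_mul]
        exact mul_le_one₀ (hf x) (norm_nonneg _) (norm_one_sub_ramp_le _ _ _ _)
      · rw [ContinuousMap.mul_apply, ContinuousMap.sub_apply, ContinuousMap.one_apply]
        rcases le_or_gt (|coord (b i) x - s i|) ε with h | h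
        · rw [ramp_eq_one hε h, sub_self, mul_zero]
        · rw [hf0 x fun j hj => ?_, zero_mul]
          rcases Finset.mem_insert.1 hj with rfl | hj
          · exact h
          · exact hx j hj

/-- Functions that are supported near a line have small `θ`-values. -/
def IsThetaNull (θ : C(square M, ℂ) →ₛₗ[starRingEnd ℂ] ℂ) (b : Bool) (s : ℝ) : Prop :=
  ∀ δ > 0, ∃ ε > 0, ∀ f, IsXFunction (strip M b s ε) f → ‖θ f‖ < δ

lemma IsXFunction.mono {X Y : Set ℂ} (h : X ⊆ Y) {f : C(square M, ℂ)} (hf : IsXFunction X f) :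
    IsXFunction Y f := ⟨hf.1, fun x hx => hf.2 x fun hX => hx (h hX)⟩

lemma exists_near_lines_lt {ι : Type*} (t : Finset ι) (b : ι → Bool) (s : ι → ℝ)
    (h : ∀ i ∈ t, IsThetaNull θ (b i) (s i)) {δ : ℝ} (hδ : 0 < δ) :
    ∃ ε > 0, ∀ f : C(square M, ℂ), (∀ x, ‖f x‖ ≤ 1) →
      (∀ x : square M, (∀ i ∈ t, ε < |coord (b i) x - s i|) → f x = 0) → ‖θ f‖ < δ := by
  have hη : 0 < δ / (t.card + 1) := by positivity
  have hev : ∀ᶠ ε in 𝓝[>] (0 : ℝ), ∀ i ∈ t, ∀ f, IsXFunction (strip M (b i) (s i) (2 * ε)) f →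
      ‖θ f‖ ≤ δ / (t.card + 1) := by
    refine (Finset.eventually_all t).2 fun i hi => ?_
    obtain ⟨ε, hε, hf⟩ := h i hi _ hη
    filter_upwards [Ioo_mem_nhdsGT (half_pos hε)] with ε' hε' f hf'
    exact (hf f (hf'.mono (strip_mono M _ _ (by linarith [hε'.2])))).le
  obtain ⟨ε, h1, hε⟩ := (hev.and self_mem_nhdsWithin).exists
  refine ⟨ε, hε, fun f hf hf0 => ?_⟩
  refine (norm_le_sum_of_near_lines t b s hε _ h1 f hf hf0).trans_lt ?_
  rw [Finset.sum_const, nsmul_eq_mul, mul_div_assoc', div_lt_iff₀ (by positivity)]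
  nlinarith

end Functionals

/-! ### Only countably many lines are exceptional -/

section Countability

lemma exists_separation (t : Finset ℝ) :
    ∃ ε > 0, ∀ s ∈ t, ∀ s' ∈ t, s ≠ s' → 2 * ε ≤ |s - s'| := by
  have hev : ∀ᶠ ε in 𝓝[>] (0 : ℝ), ∀ p ∈ t.offDiag, 2 * ε ≤ |p.1 - p.2| := by
    refine (Finset.eventually_all _).2 fun p hp => ?_
    have : 0 < |p.1 - p.2| := abs_pos.2 (sub_ne_zero.2 (Finset.mem_offDiag.1 hp).2.2)
    filter_upwards [Ioo_mem_nhdsGT (half_pos this)] with ε hε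
    linarith [hε.2]
  obtain ⟨ε, h1, hε⟩ := (hev.and self_mem_nhdsWithin).exists
  exact ⟨ε, hε, fun s hs s' hs' hne => h1 (s, s') (Finset.mem_offDiag.2 ⟨hs, hs', hne⟩)⟩

/-- Abstract form of the fact that a finite measure has countably many atoms. If infinitely many `s`
had weight at least `1 / (n + 1)` at every scale, more than `C (n + 1)` of them could be separated
by disjoint strips, against the total bound `C`. -/
lemma countable_of_card_mul_le (T : ℝ → ℝ → ℝ → Prop) (C : ℝ)
    (hmono : ∀ s ε δ δ', δ' ≤ δ → T s ε δ → T s ε δ')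
    (h : ∀ (t : Finset ℝ) (ε δ : ℝ), 0 < ε → 0 < δ →
      (∀ s ∈ t, ∀ s' ∈ t, s ≠ s' → 2 * ε ≤ |s - s'|) → (∀ s ∈ t, T s ε δ) → t.card * δ ≤ C) :
    {s | ∃ δ > 0, ∀ ε > 0, T s ε δ}.Countable := by
  refine Countable.mono (s₂ := ⋃ n : ℕ, {s | ∀ ε > 0, T s ε (1 / ((n : ℝ) + 1))}) ?_
    (countable_iUnion fun n => Set.Finite.countable ?_)
  · rintro s ⟨δ, hδ, hs⟩
    obtain ⟨n, hn⟩ := exists_nat_one_div_lt hδ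
    exact mem_iUnion.2 ⟨n, fun ε hε => hmono _ _ _ _ hn.le (hs ε hε)⟩
  · by_contra hinf
    obtain ⟨k, hk⟩ := exists_nat_gt (C * (n + 1))
    obtain ⟨t, ht, htk⟩ := (show Set.Infinite _ from hinf).exists_subset_card_eq k
    obtain ⟨ε, hε, hsep⟩ := exists_separation t
    have := h t ε (1 / ((n : ℝ) + 1)) hε (by positivity) hsep fun s hs => ht hs ε hε
    rw [htk, mul_one_div, div_le_iff₀ (by positivity)] at this
    linarith

lemma strip_disjoint {M : ℕ} {b : Bool} {t : Finset ℝ} {ε : ℝ}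
    (hsep : ∀ s ∈ t, ∀ s' ∈ t, s ≠ s' → 2 * ε ≤ |s - s'|) :
    ∀ s ∈ t, ∀ s' ∈ t, ∀ z, z ∈ strip M b s ε → z ∈ strip M b s' ε → s = s' := by
  intro s hs s' hs' z hz hz'
  by_contra hne
  have h1 := hsep s hs s' hs' hne
  have h2 := abs_sub_le s (coord b z) s'
  rw [abs_sub_comm s (coord b z)] at h2
  linarith [hz.2, hz'.2]

lemma countable_not_thetaNull {M : ℕ} {σ : Set ℂ} {K : ℝ}
    {θ : C(square M, ℂ) →ₛₗ[starRingEnd ℂ] ℂ} (hK : IsBoundedOn σ K θ) (b : Bool) :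
    {s | ¬ IsThetaNull θ b s}.Countable := by
  refine (countable_of_card_mul_le
    (fun s ε δ => ∃ f, IsXFunction (strip M b s ε) f ∧ δ ≤ ‖θ f‖) (K * 1) ?_ ?_).mono ?_
  · rintro s ε δ δ' hδ ⟨f, hf, h⟩
    exact ⟨f, hf, hδ.trans h⟩
  · intro t ε δ _ _ hsep h
    choose! f hf hfδ using h
    refine le_trans ?_ (hK.sum_norm_le t f zero_le_one (fun s hs => (hf s hs).1) ?_)
    · rw [← nsmul_eq_mul]
      exact Finset.card_nsmul_le_sum t _ δ hfδ
    · intro s hs s' hs' x h1 h2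
      exact strip_disjoint hsep s hs s' hs' x
        (not_not.1 fun h => h1 ((hf s hs).2 x h)) (not_not.1 fun h => h2 ((hf s' hs').2 x h))
  · intro s hs
    simp only [IsThetaNull, mem_ofPred_eq] at hs ⊢
    push Not at hs
    exact hs

variable {H : Type*} [NormedAddCommGroup H] [InnerProductSpace ℂ H] [CompleteSpace H]
variable {A : H →L[ℂ] H} {r : ℝ} {φ : H}

lemma countable_not_null (hφ : ‖φ‖ = 1) (𝒜 : ApproxSystem A r φ) (D : Ultrafilter ℕ) (M : ℕ)
    (b : Bool) : {s | ¬ IsNull 𝒜 D M b s}.Countable := by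
  refine (countable_of_card_mul_le
    (fun s ε δ => δ ≤ muNaive 𝒜 D (strip M b s ε)) 1 ?_ ?_).mono ?_
  · exact fun s ε δ δ' hδ h => hδ.trans h
  · intro t ε δ _ _ hsep h
    refine le_trans ?_ (sum_muNaive_le_one hφ 𝒜 D t (strip_disjoint (M := M) (b := b) hsep))
    rw [← nsmul_eq_mul]
    exact Finset.card_nsmul_le_sum t _ δ h
  · intro s hs
    simp only [IsNull, mem_ofPred_eq] at hs ⊢
    push Not at hs
    exact hs

end Countability

/-! ### Nested subdivisions that avoid a countable set -/

section GridExistence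

/-- Away from a countable set, `[-M, M]` has nested subdivisions whose meshes tend to `0`. -/
lemma exists_subdivisions {M : ℕ} (hM : 0 < (M : ℝ)) {Z : Set ℝ} (hZ : Z.Countable) :
    ∃ ρ : ℕ → ℕ → ℝ,
      (∀ n, ∀ i < 2 ^ (n + 2), ρ n i < ρ n (i + 1) ∧ ρ n (i + 1) - ρ n i < 2 * M / (n + 1)) ∧
      (∀ n, ρ n 0 = -(M : ℝ) ∧ ρ n (2 ^ (n + 2)) = M) ∧
      (∀ n i, ρ n i = ρ (n + 1) (2 * i)) ∧
      ∀ n i, 0 < i → i < 2 ^ (n + 2) → ρ n i ∉ Z ∧ -(M : ℝ) < ρ n i ∧ ρ n i < M := by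
  -- A one-parameter perturbation of the affine map `[0, 1] → [-M, M]` that fixes both ends. For `0
  -- < x < 1` the value is injective in `t`, so each dyadic `x` excludes only countably many `t`;
  -- one good `t` then serves all levels, and the images of the dyadic points are automatically
  -- nested.
  set h : ℝ → ℝ → ℝ := fun t x => -(M : ℝ) + 2 * M * (x + t * (x * (1 - x))) with hh
  have hbad : (⋃ p : ℕ × ℕ, {t | (0 < p.2 ∧ p.2 < 2 ^ (p.1 + 2)) ∧
      h t ((p.2 : ℝ) / 2 ^ (p.1 + 2)) ∈ Z}).Countable := by
    refine countable_iUnion fun p => ?_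
    by_cases hp : 0 < p.2 ∧ p.2 < 2 ^ (p.1 + 2)
    · refine (hZ.preimage_of_injOn (f := fun t => h t ((p.2 : ℝ) / 2 ^ (p.1 + 2))) ?_).mono
        fun t ht => ht.2
      intro t _ t' _ htt
      have h1 : (0 : ℝ) < (p.2 : ℝ) / 2 ^ (p.1 + 2) := by
        have : (0 : ℝ) < p.2 := by exact_mod_cast hp.1
        positivity
      have h2 : (p.2 : ℝ) / 2 ^ (p.1 + 2) < 1 := by
        rw [div_lt_one (by positivity)]
        exact_mod_cast hp.2
      generalize (p.2 : ℝ) / 2 ^ (p.1 + 2) = x at *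
      have h3 : 0 < 2 * M * (x * (1 - x)) := by
        have : 0 < 1 - x := by linarith
        positivity
      simp only [hh] at htt
      have : (t - t') * (2 * M * (x * (1 - x))) = 0 := by linear_combination htt
      rcases mul_eq_zero.1 this with h4 | h4
      · linarith
      · exact absurd h4 h3.ne'
    · convert countable_empty
      exact eq_empty_of_forall_notMem fun t ht => hp ht.1
  obtain ⟨t, htZ, ht0, ht1⟩ := (hbad.dense_compl ℝ).exists_between
    (show (0 : ℝ) < 1 / 2 by norm_num)
  have hdiff : ∀ x y, h t y - h t x = 2 * M * ((y - x) * (1 + t * (1 - x - y))) := fun x y => by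
    simp only [hh]; ring
  have hstep : ∀ x y, 0 ≤ x → x < y → y ≤ 1 →
      h t x < h t y ∧ h t y - h t x ≤ 2 * M * (3 / 2 * (y - x)) := by
    intro x y hx hxy hy
    -- As `|1 - x - y| ≤ 1` and `0 < t < 1/2`, the difference quotients stay within a factor between
    -- `1/2` and `3/2` of the unperturbed ones.
    have h1 : 1 / 2 ≤ 1 + t * (1 - x - y) := by nlinarith
    have h2 : 1 + t * (1 - x - y) ≤ 3 / 2 := by nlinarith
    have h3 : 0 < y - x := by linarith
    constructor
    · have : 0 < 2 * M * ((y - x) * (1 + t * (1 - x - y))) := by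
        have : 0 < 1 + t * (1 - x - y) := by linarith
        positivity
      linarith [hdiff x y]
    · rw [hdiff]
      refine mul_le_mul_of_nonneg_left ?_ (by positivity)
      rw [mul_comm]
      exact mul_le_mul_of_nonneg_right h2 h3.le
  have h0 : h t 0 = -(M : ℝ) := by simp [hh]
  have h1 : h t 1 = M := by simp [hh]; ring
  refine ⟨fun n i => h t ((i : ℝ) / 2 ^ (n + 2)), fun n i hi => ?_, fun n => ?_, fun n i => ?_,
    fun n i hi hi' => ?_⟩
  · have hi' : ((i : ℝ) + 1) ≤ 2 ^ (n + 2) := by exact_mod_cast hi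
    have hlt : (i : ℝ) / 2 ^ (n + 2) < ((i + 1 : ℕ) : ℝ) / 2 ^ (n + 2) := by
      push_cast
      gcongr
      linarith
    have hle : ((i + 1 : ℕ) : ℝ) / 2 ^ (n + 2) ≤ 1 := by
      push_cast
      exact (div_le_one (by positivity)).2 hi'
    obtain ⟨k1, k2⟩ := hstep _ _ (by positivity) hlt hle
    refine ⟨k1, k2.trans_lt ?_⟩
    have e : ((i + 1 : ℕ) : ℝ) / 2 ^ (n + 2) - (i : ℝ) / 2 ^ (n + 2) = 1 / 2 ^ (n + 2) := by
      push_cast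
      ring
    rw [e, mul_div_assoc]
    have hn : ((n : ℝ) + 1) ≤ 2 ^ n := by exact_mod_cast Nat.lt_two_pow_self (n := n)
    have hn0 : (0 : ℝ) < n + 1 := by positivity
    -- The distortion `3/2` is absorbed by the four intervals already present at level `0`, and `n +
    -- 1 ≤ 2^n` does the rest.
    have hlt' : 3 / 2 * (1 / (2 : ℝ) ^ (n + 2)) < 1 / (n + 1) := by
      rw [mul_one_div, div_lt_div_iff₀ (by positivity) hn0, pow_add]
      nlinarith
    calc 2 * (M : ℝ) * (3 / 2 * (1 / 2 ^ (n + 2))) < 2 * M * (1 / (n + 1)) :=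
          mul_lt_mul_of_pos_left hlt' (by positivity)
      _ = 2 * (M / (n + 1)) := by ring
  · refine ⟨by simpa using h0, ?_⟩
    push_cast
    rw [div_self (by positivity), h1]
  · have : ((2 * i : ℕ) : ℝ) / 2 ^ (n + 1 + 2) = (i : ℝ) / 2 ^ (n + 2) := by
      push_cast
      rw [show n + 1 + 2 = (n + 2) + 1 from rfl, pow_succ']
      exact mul_div_mul_left _ _ two_ne_zero
    simp only [this]
  · have k1 : (0 : ℝ) < (i : ℝ) / 2 ^ (n + 2) := by
      have : (0 : ℝ) < i := by exact_mod_cast hi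
      positivity
    have k2 : (i : ℝ) / 2 ^ (n + 2) < 1 := by
      rw [div_lt_one (by positivity)]
      exact_mod_cast hi'
    refine ⟨fun hmem => htZ (mem_iUnion.2 ⟨(n, i), ⟨hi, hi'⟩, hmem⟩), ?_, ?_⟩
    · have := (hstep _ _ le_rfl k1 k2.le).1
      rwa [h0] at this
    · have := (hstep _ _ k1.le k2 le_rfl).1
      rwa [h1] at this

end GridExistence

/-! ### Grids, the numbers `θ(B, 1)` and Riemann sums for `θ` -/

section Grid

variable {H : Type*} [NormedAddCommGroup H] [InnerProductSpace ℂ H] [CompleteSpace H]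
variable {A : H →L[ℂ] H} {r : ℝ} {φ : H}
variable {M : ℕ} {𝒜 : ApproxSystem A r φ} {D : Ultrafilter ℕ}
variable {θ : C(square M, ℂ) →ₛₗ[starRingEnd ℂ] ℂ} {ρ : ℕ → ℕ → ℝ}

lemma strip_edge_norm_lt {b : Bool} {s ε : ℝ} (hs : |s| = M) {z : ℂ} (hz : z ∈ strip M b s ε) :
    M - ε < ‖z‖ := by
  have h1 : |coord b z| ≤ ‖z‖ := by
    cases b
    · exact Complex.abs_im_le_norm z
    · exact Complex.abs_re_le_norm z
  have h2 := abs_sub_abs_le_abs_sub s (coord b z)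
  rw [abs_sub_comm] at h2
  linarith [hz.2]

/-- Within `M - R` of an edge of the square there is no point of the disc of radius `R`, which
contains `σ`. The edges need this separate argument, since the ends of a grid cannot be moved off
the exceptional set. -/
lemma isThetaNull_edge {σ : Set ℂ} {K R : ℝ} (hK : IsBoundedOn σ K θ)
    (hσ : ∀ z ∈ σ, ‖z‖ ≤ R) (hR : R < M) (b : Bool) {s : ℝ} (hs : |s| = M) :
    IsThetaNull θ b s := by
  refine fun δ hδ => ⟨M - R, sub_pos.2 hR, fun f hf => ?_⟩
  rw [hK.eq_zero fun x hx => hf.2 x fun hx' => ?_, norm_zero]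
  · exact hδ
  · have := strip_edge_norm_lt hs hx'
    linarith [hσ x hx]

lemma isNull_edge (hφ : ‖φ‖ = 1) (𝒜 : ApproxSystem A r φ) (D : Ultrafilter ℕ) {R : ℝ}
    (hlam : ∀ N k, ‖𝒜.lam N k‖ ≤ R) (hR : R < M) (b : Bool) {s : ℝ} (hs : |s| = M) :
    IsNull 𝒜 D M b s := by
  refine fun δ hδ => ⟨M - R, sub_pos.2 hR, ?_⟩
  rw [muNaive_eq_zero hφ 𝒜 D fun N k hk => ?_]
  · exact hδ
  · have := strip_edge_norm_lt hs hk
    linarith [hlam N k]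

lemma exists_isGrid (hφ : ‖φ‖ = 1) (𝒜 : ApproxSystem A r φ) (D : Ultrafilter ℕ)
    {σ : Set ℂ} {K R : ℝ} (hK : IsBoundedOn σ K θ) (hσ : ∀ z ∈ σ, ‖z‖ ≤ R)
    (hlam : ∀ N k, ‖𝒜.lam N k‖ ≤ R) (hR0 : 0 ≤ R) (hR : R < M) :
    ∃ ρ : ℕ → ℕ → ℝ, IsGrid 𝒜 D θ ρ := by
  have hM : 0 < (M : ℝ) := hR0.trans_lt hR
  obtain ⟨ρ, h1, h2, h3, h4⟩ := exists_subdivisions hM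
    (((countable_not_thetaNull hK true).union (countable_not_thetaNull hK false)).union
      ((countable_not_null hφ 𝒜 D M true).union (countable_not_null hφ 𝒜 D M false)))
  have hcase : ∀ n, ∀ i < 2 ^ (n + 2) + 1, (i = 0 ∨ i = 2 ^ (n + 2)) ∨
      0 < i ∧ i < 2 ^ (n + 2) := fun n i hi => by omega
  have hedge : ∀ n i, (i = 0 ∨ i = 2 ^ (n + 2)) → |ρ n i| = M := by
    rintro n i (rfl | rfl)
    · rw [(h2 n).1, abs_neg, abs_of_pos hM]
    · rw [(h2 n).2, abs_of_pos hM]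
  refine ⟨ρ, ⟨fun n i hi => ?_, h1, fun n i hi => ?_, (h2 0).1, (h2 0).2, fun n i hi => ?_⟩⟩
  · rcases hcase n i hi with h | h
    · exact abs_le.1 (hedge n i h).le
    · exact ⟨(h4 n i h.1 h.2).2.1.le, (h4 n i h.1 h.2).2.2.le⟩
  · have key : ∀ b, IsThetaNull θ b (ρ n i) ∧ IsNull 𝒜 D M b (ρ n i) := by
      intro b
      rcases hcase n i hi with h | h
      · exact ⟨isThetaNull_edge hK hσ hR b (hedge n i h), isNull_edge hφ 𝒜 D hlam hR b (hedge n i h)⟩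
      · have := (h4 n i h.1 h.2).1
        simp only [mem_union, mem_ofPred_eq, not_or, not_not] at this
        cases b
        · exact ⟨this.1.2, this.2.2⟩
        · exact ⟨this.1.1, this.2.1⟩
    exact ⟨key true, key false⟩
  · refine ⟨2 * i, ?_, h3 n i⟩
    have : 2 ^ (n + 3) = 2 * 2 ^ (n + 2) := pow_succ' 2 (n + 2)
    omega

namespace IsGrid

lemma thetaNull (hG : IsGrid 𝒜 D θ ρ) {n i : ℕ} (hi : i < 2 ^ (n + 2) + 1) :
    ∀ b, IsThetaNull θ b (ρ n i)
  | true => (hG.veryGood n i hi).1.1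
  | false => (hG.veryGood n i hi).2.1

lemma null (hG : IsGrid 𝒜 D θ ρ) {n i : ℕ} (hi : i < 2 ^ (n + 2) + 1) :
    ∀ b, IsNull 𝒜 D M b (ρ n i)
  | true => (hG.veryGood n i hi).1.2
  | false => (hG.veryGood n i hi).2.2

lemma le_of_le (hG : IsGrid 𝒜 D θ ρ) {n i j : ℕ} (hij : i ≤ j) (hj : j ≤ 2 ^ (n + 2)) :
    ρ n i ≤ ρ n j := by
  induction j, hij using Nat.le_induction with
  | base => exact le_rfl
  | succ j _ ih => exact (ih (by omega)).trans (hG.mesh n j (by omega)).1.le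

/-- The end is prescribed at level `0` only; it must recur at each finer level, where the points
increase and stay in `[-M, M]`, so it is again the first one. -/
lemma zero (hG : IsGrid 𝒜 D θ ρ) (n : ℕ) : ρ n 0 = -(M : ℝ) := by
  induction n with
  | zero => exact hG.first
  | succ n ih =>
    obtain ⟨j, hj, h⟩ := hG.refine n 0 (Nat.succ_pos _)
    have h1 := hG.le_of_le (n := n + 1) (Nat.zero_le j) (Nat.lt_succ_iff.1 hj)
    have h2 := (hG.mem (n + 1) 0 (Nat.succ_pos _)).1
    linarith

lemma top (hG : IsGrid 𝒜 D θ ρ) (n : ℕ) : ρ n (2 ^ (n + 2)) = M := by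
  induction n with
  | zero => exact hG.last
  | succ n ih =>
    obtain ⟨j, hj, h⟩ := hG.refine n (2 ^ (n + 2)) (Nat.lt_succ_self _)
    have h1 : ρ (n + 1) j ≤ ρ (n + 1) (2 ^ (n + 1 + 2)) :=
      hG.le_of_le (n := n + 1) (Nat.lt_succ_iff.1 hj) le_rfl
    have h2 := (hG.mem (n + 1) (2 ^ (n + 1 + 2)) (Nat.lt_succ_self _)).2
    linarith

lemma exists_cell (hG : IsGrid 𝒜 D θ ρ) (n : ℕ) {t : ℝ} (ht : t ∈ Icc (-(M : ℝ)) M)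
    (hne : ∀ i < 2 ^ (n + 2) + 1, t ≠ ρ n i) :
    ∃ i < 2 ^ (n + 2), ρ n i < t ∧ t < ρ n (i + 1) := by
  have key : ∀ m ≤ 2 ^ (n + 2), t < ρ n m → ∃ i < m, ρ n i < t ∧ t < ρ n (i + 1) := by
    intro m
    induction m with
    | zero =>
      intro _ h
      rw [hG.zero] at h
      exact absurd ht.1 (not_le.2 h)
    | succ m ih =>
      intro hm h
      rcases lt_or_gt_of_ne (hne m (by omega)) with h1 | h1
      · obtain ⟨i, hi, h2⟩ := ih (by omega) h1
        exact ⟨i, by omega, h2⟩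
      · exact ⟨m, by omega, h1, h⟩
  refine key _ le_rfl (lt_of_le_of_ne ?_ (hne _ (Nat.lt_succ_self _)))
  rw [hG.top]
  exact ht.2

lemma cell_unique (hG : IsGrid 𝒜 D θ ρ) {n i i' : ℕ} (hi : i < 2 ^ (n + 2))
    (hi' : i' < 2 ^ (n + 2)) {t : ℝ} (h1 : ρ n i < t) (h2 : t < ρ n (i + 1)) (h1' : ρ n i' < t)
    (h2' : t < ρ n (i' + 1)) : i = i' := by
  by_contra hne
  rcases lt_or_gt_of_ne hne with h | h
  · have := hG.le_of_le (n := n) (i := i + 1) (j := i') h hi'.le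
    linarith
  · have := hG.le_of_le (n := n) (i := i' + 1) (j := i) h hi.le
    linarith

lemma box_unique (hG : IsGrid 𝒜 D θ ρ) {n : ℕ} {p q : ℕ × ℕ}
    (hp : p ∈ Finset.range (2 ^ (n + 2)) ×ˢ Finset.range (2 ^ (n + 2)))
    (hq : q ∈ Finset.range (2 ^ (n + 2)) ×ˢ Finset.range (2 ^ (n + 2))) {z : ℂ}
    (h : z ∈ B M ρ n p.1 p.2) (h' : z ∈ B M ρ n q.1 q.2) : p = q := by
  simp only [Finset.mem_product, Finset.mem_range] at hp hq
  exact Prod.ext (hG.cell_unique hp.1 hq.1 h.2.1.1 h.2.1.2 h'.2.1.1 h'.2.1.2)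
    (hG.cell_unique hp.2 hq.2 h.2.2.1 h.2.2.2 h'.2.2.1 h'.2.2.2)

end IsGrid

/-- The indices of the lines of the `n`-th subdivision. -/
def gridLines (n : ℕ) : Finset (Bool × ℕ) := Finset.univ ×ˢ Finset.range (2 ^ (n + 2) + 1)

/-- The indices of the boxes of the `n`-th subdivision. -/
def cells (n : ℕ) : Finset (ℕ × ℕ) :=
  Finset.range (2 ^ (n + 2)) ×ˢ Finset.range (2 ^ (n + 2))

lemma mem_gridLines {n : ℕ} {p : Bool × ℕ} : p ∈ gridLines n ↔ p.2 < 2 ^ (n + 2) + 1 := by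
  simp [gridLines]

lemma mem_cells {n : ℕ} {p : ℕ × ℕ} : p ∈ cells n ↔ p.1 < 2 ^ (n + 2) ∧ p.2 < 2 ^ (n + 2) := by
  simp [cells]

lemma IsGrid.exists_theta_lt (hG : IsGrid 𝒜 D θ ρ) (n : ℕ) {δ : ℝ} (hδ : 0 < δ) :
    ∃ ε > 0, ∀ f : C(square M, ℂ), (∀ x, ‖f x‖ ≤ 1) →
      (∀ x : square M, (∀ p ∈ gridLines n, ε < |coord p.1 x - ρ n p.2|) → f x = 0) → ‖θ f‖ < δ :=
  exists_near_lines_lt (gridLines n) (fun p => p.1) (fun p => ρ n p.2)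
    (fun _ hp => hG.thetaNull (mem_gridLines.1 hp) _) hδ

/-- A point that is not near the lines of the subdivision lies well inside one of the boxes. -/
lemma IsGrid.exists_inner_box (hG : IsGrid 𝒜 D θ ρ) (n : ℕ) {ε : ℝ} (hε : 0 ≤ ε) {z : ℂ}
    (hz : z ∈ square M) (h : ∀ p ∈ gridLines n, ε < |coord p.1 z - ρ n p.2|) :
    ∃ p ∈ cells n, z ∈ box M (ρ n p.1 + ε) (ρ n (p.1 + 1) - ε) (ρ n p.2 + ε)
      (ρ n (p.2 + 1) - ε) := by
  have key : ∀ b, ∃ i < 2 ^ (n + 2), ρ n i + ε < coord b z ∧ coord b z < ρ n (i + 1) - ε := by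
    intro b
    have hb : ∀ i < 2 ^ (n + 2) + 1, ε < |coord b z - ρ n i| := fun i hi =>
      h (b, i) (mem_gridLines.2 hi)
    obtain ⟨i, hi, h1, h2⟩ := hG.exists_cell n (coord_mem_Icc hz b) fun i hi heq => by
      have := hb i hi
      rw [heq, sub_self, abs_zero] at this
      linarith
    have h3 := hb i (by omega)
    have h4 := hb (i + 1) (by omega)
    rw [abs_of_pos (by linarith)] at h3
    rw [abs_of_neg (by linarith)] at h4
    exact ⟨i, hi, by linarith, by linarith⟩
  obtain ⟨i, hi, h1⟩ := key true
  obtain ⟨j, hj, h2⟩ := key false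
  exact ⟨(i, j), mem_cells.2 ⟨hi, hj⟩, hz, h1, h2⟩

/-! ### The plateau functions -/

/-- The distance of a point of a box to the sides of the box. -/
def sideDist (ρ : ℕ → ℕ → ℝ) (n i j : ℕ) (z : ℂ) : ℝ :=
  min (min (z.re - ρ n i) (ρ n (i + 1) - z.re)) (min (z.im - ρ n j) (ρ n (j + 1) - z.im))

/-- A standard element of `plateau M ρ n i j ε`. -/
def plateauFn (M : ℕ) (ρ : ℕ → ℕ → ℝ) (n i j : ℕ) (ε : ℝ) : C(square M, ℂ) :=
  ⟨fun x => ((max 0 (min 1 (sideDist ρ n i j x / ε)) : ℝ) : ℂ), by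
    have h1 := Complex.continuous_re.comp (continuous_subtype_val (p := fun z => z ∈ square M))
    have h2 := Complex.continuous_im.comp (continuous_subtype_val (p := fun z => z ∈ square M))
    refine Complex.continuous_ofReal.comp (continuous_const.max (continuous_const.min
      (Continuous.div_const ?_ _)))
    exact ((h1.sub continuous_const).min (continuous_const.sub h1)).min
      ((h2.sub continuous_const).min (continuous_const.sub h2))⟩

lemma plateauFn_apply (n i j : ℕ) (ε : ℝ) (x : square M) :
    plateauFn M ρ n i j ε x = ((max 0 (min 1 (sideDist ρ n i j x / ε)) : ℝ) : ℂ) := rfl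

lemma plateauFn_mem (n i j : ℕ) {ε : ℝ} (hε : 0 < ε) :
    plateauFn M ρ n i j ε ∈ plateau M ρ n i j ε := by
  refine ⟨⟨fun x => ?_, fun x hx => ?_⟩, fun x hx => ?_⟩
  · rw [plateauFn_apply, Complex.norm_real, Real.norm_of_nonneg (le_max_left _ _)]
    exact max_le zero_le_one (min_le_left _ _)
  · have : sideDist ρ n i j x ≤ 0 := by
      by_contra hpos
      obtain ⟨⟨h1, h2⟩, h3, h4⟩ := by
        simpa only [sideDist, not_le, lt_min_iff, sub_pos] using hpos
      exact hx ⟨x.2, ⟨h1, h2⟩, h3, h4⟩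
    rw [plateauFn_apply, max_eq_left, Complex.ofReal_zero]
    exact (min_le_right _ _).trans (div_nonpos_of_nonpos_of_nonneg this hε.le)
  · obtain ⟨_, ⟨h1, h2⟩, h3, h4⟩ := hx
    have : ε ≤ sideDist ρ n i j x :=
      le_min (le_min (by linarith) (by linarith)) (le_min (by linarith) (by linarith))
    rw [plateauFn_apply, min_eq_left ((one_le_div hε).2 this), max_eq_right zero_le_one,
      Complex.ofReal_one]

lemma plateau_mono (n i j : ℕ) {ε ε' : ℝ} (h : ε ≤ ε') :
    plateau M ρ n i j ε ⊆ plateau M ρ n i j ε' := by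
  rintro f ⟨h1, h2⟩
  refine ⟨h1, fun x hx => h2 x ?_⟩
  obtain ⟨h0, ⟨h1, h2⟩, h3, h4⟩ := hx
  exact ⟨h0, ⟨by linarith, by linarith⟩, by linarith, by linarith⟩

lemma plateau_mem_plateauFilter (n i j : ℕ) {ε : ℝ} (hε : 0 < ε) :
    plateau M ρ n i j ε ∈ plateauFilter M ρ n i j :=
  mem_iInf_of_mem ε (mem_iInf_of_mem hε (mem_principal_self _))

lemma tendsto_plateauFn (n i j : ℕ) :
    Tendsto (plateauFn M ρ n i j) (𝓝[>] 0) (plateauFilter M ρ n i j) := by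
  refine tendsto_iInf.2 fun ε => tendsto_iInf.2 fun hε => tendsto_principal.2 ?_
  filter_upwards [Ioo_mem_nhdsGT (mem_Ioi.1 hε)] with ε' hε'
  exact plateau_mono n i j hε'.2.le (plateauFn_mem n i j hε'.1)

/-- The limits that define `θ(B, 1)` exist. -/
lemma IsGrid.tendsto_thetaBox (hG : IsGrid 𝒜 D θ ρ) {n i j : ℕ} (hi : i < 2 ^ (n + 2))
    (hj : j < 2 ^ (n + 2)) :
    Tendsto θ (plateauFilter M ρ n i j) (𝓝 (thetaBox θ ρ n i j)) := by
  refine tendsto_nhds_limUnder ?_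
  have : NeBot (plateauFilter M ρ n i j) := (tendsto_plateauFn n i j).neBot
  refine cauchy_map_iff_exists_tendsto.1 (Metric.cauchy_iff.2 ⟨inferInstance, fun δ hδ => ?_⟩)
  -- Two plateau functions for the same `ε` agree at all points farther than `ε` from the grid
  -- lines, so their difference has a small `θ`-value. The factor `1/2` below brings the difference
  -- under the bound `1`.
  obtain ⟨ε, hε, h⟩ := hG.exists_theta_lt n (half_pos hδ)
  refine ⟨_, image_mem_map (plateau_mem_plateauFilter n i j hε), ?_⟩
  rintro _ ⟨f, hf, rfl⟩ _ ⟨g, hg, rfl⟩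
  have key := h ((1 / 2 : ℂ) • (f - g)) (fun x => ?_) fun x hx => ?_
  · rw [map_smulₛₗ, map_sub, norm_smul] at key
    rw [dist_eq_norm]
    norm_num at key
    linarith
  · rw [ContinuousMap.smul_apply, ContinuousMap.sub_apply, norm_smul]
    have := (norm_sub_le (f x) (g x)).trans (add_le_add (hf.1.1 x) (hg.1.1 x))
    norm_num
    linarith
  · rw [ContinuousMap.smul_apply, ContinuousMap.sub_apply]
    by_cases hB : (x : ℂ) ∈ B M ρ n i j
    · obtain ⟨p, hp, hxp⟩ := hG.exists_inner_box n hε.le x.2 hx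
      have hpB : (x : ℂ) ∈ B M ρ n p.1 p.2 := by
        obtain ⟨h0, ⟨h1, h2⟩, h3, h4⟩ := hxp
        exact ⟨h0, ⟨by linarith, by linarith⟩, by linarith, by linarith⟩
      have hij : (i, j) ∈ cells n := mem_cells.2 ⟨hi, hj⟩
      obtain rfl : (i, j) = p := hG.box_unique hij hp hB hpB
      rw [hf.2 x hxp, hg.2 x hxp, sub_self, smul_zero]
    · rw [hf.1.2 x hB, hg.1.2 x hB, sub_self, smul_zero]

lemma IsGrid.tendsto_plateauFn (hG : IsGrid 𝒜 D θ ρ) {n : ℕ} {p : ℕ × ℕ} (hp : p ∈ cells n) :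
    Tendsto (fun ε => θ (plateauFn M ρ n p.1 p.2 ε)) (𝓝[>] 0) (𝓝 (thetaBox θ ρ n p.1 p.2)) :=
  (hG.tendsto_thetaBox (mem_cells.1 hp).1 (mem_cells.1 hp).2).comp
    (UltraDist.tendsto_plateauFn n p.1 p.2)

lemma plateauFn_ne_zero {n i j : ℕ} {ε : ℝ} (hε : 0 < ε) {x : square M}
    (h : plateauFn M ρ n i j ε x ≠ 0) : (x : ℂ) ∈ B M ρ n i j :=
  not_not.1 fun hB => h ((plateauFn_mem n i j hε).1.2 x hB)

/-- All functions supported in a box that misses `σ` vanish on `σ`, so `θ` kills them. -/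
lemma IsGrid.thetaBox_eq_zero (hG : IsGrid 𝒜 D θ ρ) {σ : Set ℂ} {K : ℝ} (hK : IsBoundedOn σ K θ)
    {n : ℕ} {p : ℕ × ℕ} (hp : p ∈ cells n) (h : ∀ z ∈ σ, z ∉ B M ρ n p.1 p.2) :
    thetaBox θ ρ n p.1 p.2 = 0 := by
  refine tendsto_nhds_unique (hG.tendsto_plateauFn hp) (tendsto_const_nhds.congr' ?_)
  filter_upwards [self_mem_nhdsWithin] with ε hε
  exact (hK.eq_zero fun x hx => (plateauFn_mem _ _ _ hε).1.2 x (h x hx)).symm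

lemma IsGrid.sum_norm_thetaBox_le (hG : IsGrid 𝒜 D θ ρ) {σ : Set ℂ} {K : ℝ}
    (hK : IsBoundedOn σ K θ) (n : ℕ) : ∑ p ∈ cells n, ‖thetaBox θ ρ n p.1 p.2‖ ≤ K := by
  refine le_of_tendsto (tendsto_finsetSum _ fun p hp => (hG.tendsto_plateauFn hp).norm) ?_
  filter_upwards [self_mem_nhdsWithin] with ε hε
  rw [← mul_one K]
  exact hK.sum_norm_le _ _ zero_le_one (fun p _ => (plateauFn_mem _ _ _ hε).1.1)
    fun p hp q hq x h1 h2 => hG.box_unique hp hq (plateauFn_ne_zero hε h1) (plateauFn_ne_zero hε h2)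

lemma compactSpace_square (M : ℕ) : CompactSpace (square M) := by
  refine isCompact_iff_compactSpace.1 (Metric.isCompact_of_isClosed_isBounded ?_ ?_)
  · have h1 := Complex.continuous_re
    have h2 := Complex.continuous_im
    exact (isClosed_le continuous_const h1).inter ((isClosed_le h1 continuous_const).inter
      ((isClosed_le continuous_const h2).inter (isClosed_le h2 continuous_const)))
  · refine isBounded_iff_forall_norm_le.2 ⟨M + M, fun z hz => ?_⟩
    exact (Complex.norm_le_abs_re_add_abs_im z).trans
      (add_le_add (abs_le.2 ⟨hz.1, hz.2.1⟩) (abs_le.2 ⟨hz.2.2.1, hz.2.2.2⟩))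

/-- Riemann sums of `f` against the numbers `θ(B, 1)` approximate `θ(f)`. -/
lemma IsGrid.norm_sub_sum_le (hG : IsGrid 𝒜 D θ ρ) {σ : Set ℂ} {K : ℝ}
    (hK : IsBoundedOn σ K θ) (n : ℕ) (f : C(square M, ℂ)) (c : ℕ × ℕ → ℂ) {ω : ℝ} (hω : 0 ≤ ω)
    (hc : ∀ p ∈ cells n, ∀ x : square M, (x : ℂ) ∈ B M ρ n p.1 p.2 → ‖f x - c p‖ ≤ ω) :
    ‖θ f - ∑ p ∈ cells n, starRingEnd ℂ (c p) * thetaBox θ ρ n p.1 p.2‖ ≤ K * ω := by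
  obtain ⟨C, hC⟩ : ∃ C : ℝ, ∀ x, ‖f x‖ ≤ C := by
    have := compactSpace_square M
    exact ⟨‖f‖, f.norm_coe_le_norm⟩
  refine le_of_forall_pos_le_add fun δ hδ => ?_
  -- Dividing by this positive bound of `|f|` yields a function of norm at most `1`, to which the
  -- estimate near the lines applies.
  set C' := max C 1
  have hC' : 0 < C' := lt_max_of_lt_right one_pos
  obtain ⟨ε₀, hε₀, hsmall⟩ := hG.exists_theta_lt n (div_pos hδ hC')
  have hlim : Tendsto (fun ε => ‖θ f -
      ∑ p ∈ cells n, starRingEnd ℂ (c p) * θ (plateauFn M ρ n p.1 p.2 ε)‖) (𝓝[>] 0)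
      (𝓝 ‖θ f - ∑ p ∈ cells n, starRingEnd ℂ (c p) * thetaBox θ ρ n p.1 p.2‖) :=
    (tendsto_const_nhds.sub (tendsto_finsetSum _ fun p hp =>
      (hG.tendsto_plateauFn hp).const_mul _)).norm
  refine le_of_tendsto hlim ?_
  filter_upwards [Ioo_mem_nhdsGT hε₀] with ε hε
  set P : ℕ × ℕ → C(square M, ℂ) := fun p => plateauFn M ρ n p.1 p.2 ε
  have hP : ∀ p, P p ∈ plateau M ρ n p.1 p.2 ε := fun p => plateauFn_mem _ _ _ hε.1
  have hdisj : ∀ p ∈ cells n, ∀ q ∈ cells n, ∀ x, P p x ≠ 0 → P q x ≠ 0 → p = q :=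
    fun p hp q hq x h1 h2 =>
      hG.box_unique hp hq (plateauFn_ne_zero hε.1 h1) (plateauFn_ne_zero hε.1 h2)
  -- Three parts: one that lives near the grid lines, contributing less than `δ`; the deviations of
  -- `f` from the constants, with disjoint supports and hence at most `K ω` in total; and the step
  -- function whose `θ`-value tends to the Riemann sum.
  have hsplit : f = f * (1 - ∑ p ∈ cells n, P p) + ∑ p ∈ cells n, (f - c p • 1) * P p +
      ∑ p ∈ cells n, c p • P p := by
    have : ∀ p, (f - c p • 1) * P p = f * P p - c p • P p := fun p => by
      rw [sub_mul, smul_mul_assoc, one_mul]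
    simp only [this, Finset.sum_sub_distrib, ← Finset.mul_sum]
    ring
  have hθ : θ f - ∑ p ∈ cells n, starRingEnd ℂ (c p) * θ (P p) =
      θ (f * (1 - ∑ p ∈ cells n, P p)) + ∑ p ∈ cells n, θ ((f - c p • 1) * P p) := by
    conv_lhs => rw [hsplit]
    rw [map_add, map_add, map_sum, map_sum]
    simp only [map_smulₛₗ, smul_eq_mul]
    ring
  have hsum1 : ∀ x, ‖1 - ∑ p ∈ cells n, P p x‖ ≤ 1 := by
    intro x
    by_cases hex : ∃ p ∈ cells n, P p x ≠ 0
    · obtain ⟨p, hp, hpx⟩ := hex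
      rw [Finset.sum_eq_single p (fun q hq hqp => not_not.1 fun h => hqp (hdisj q hq p hp x h hpx))
        fun h => absurd hp h]
      change ‖1 - plateauFn M ρ n p.1 p.2 ε x‖ ≤ 1
      rw [plateauFn_apply, ← Complex.ofReal_one, ← Complex.ofReal_sub, Complex.norm_real,
        Real.norm_eq_abs, abs_le]
      have h1 : 0 ≤ max 0 (min 1 (sideDist ρ n p.1 p.2 x / ε)) := le_max_left _ _
      have h2 : max 0 (min 1 (sideDist ρ n p.1 p.2 x / ε)) ≤ 1 :=
        max_le zero_le_one (min_le_left _ _)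
      constructor <;> linarith
    · push Not at hex
      rw [Finset.sum_eq_zero hex]
      simp
  rw [hθ]
  refine (norm_add_le _ _).trans ?_
  rw [add_comm]
  refine add_le_add ?_ ?_
  · refine (norm_sum_le _ _).trans (hK.sum_norm_le _ _ hω (fun p hp x => ?_)
      fun p hp q hq x h1 h2 => hdisj p hp q hq x ?_ ?_)
    · by_cases hx : (x : ℂ) ∈ B M ρ n p.1 p.2
      · rw [ContinuousMap.mul_apply, norm_mul]
        calc _ ≤ ω * 1 := mul_le_mul (by simpa using hc p hp x hx) ((hP p).1.1 x) (norm_nonneg _) hω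
          _ = ω := mul_one ω
      · rw [ContinuousMap.mul_apply, (hP p).1.2 x hx, mul_zero, norm_zero]
        exact hω
    · exact fun h => h1 (by rw [ContinuousMap.mul_apply, h, mul_zero])
    · exact fun h => h2 (by rw [ContinuousMap.mul_apply, h, mul_zero])
  · have key := hsmall (((C' : ℂ)⁻¹) • (f * (1 - ∑ p ∈ cells n, P p))) (fun x => ?_) fun x hx => ?_
    · rw [map_smulₛₗ, norm_smul, map_inv₀, Complex.conj_ofReal, norm_inv, Complex.norm_real,
        Real.norm_of_nonneg hC'.le, inv_mul_eq_div] at key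
      exact ((div_lt_div_iff_of_pos_right hC').1 key).le
    · rw [ContinuousMap.smul_apply, ContinuousMap.mul_apply, norm_smul, norm_mul, norm_inv,
        Complex.norm_real, Real.norm_of_nonneg hC'.le, inv_mul_eq_div, div_le_one hC']
      calc ‖f x‖ * ‖(1 - ∑ p ∈ cells n, P p) x‖ ≤ C' * 1 := by
            refine mul_le_mul ((hC x).trans (le_max_left _ _)) ?_ (norm_nonneg _) hC'.le
            rw [ContinuousMap.sub_apply, ContinuousMap.sum_apply]
            exact hsum1 x
        _ = C' := mul_one _
    · obtain ⟨p, hp, hxp⟩ := hG.exists_inner_box n hε.1.le x.2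
        fun p hp => hε.2.trans (hx p hp)
      have h1 : P p x = 1 := (hP p).2 x hxp
      have : ∑ q ∈ cells n, P q x = 1 := by
        rw [Finset.sum_eq_single p (fun q hq hqp => not_not.1 fun h =>
          hqp (hdisj q hq p hp x h (by rw [h1]; exact one_ne_zero))) fun h => absurd hp h, h1]
      rw [ContinuousMap.smul_apply, ContinuousMap.mul_apply, ContinuousMap.sub_apply,
        ContinuousMap.sum_apply, this, ContinuousMap.one_apply, sub_self, mul_zero, smul_zero]

end Grid

/-! ### Existence of good pairs -/

section GoodPairs

variable {H : Type*} [NormedAddCommGroup H] [InnerProductSpace ℂ H] [CompleteSpace H]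
variable {A : H →L[ℂ] H} {r : ℝ} {φ : H}
variable {M : ℕ} {𝒜 : ApproxSystem A r φ} {D : Ultrafilter ℕ} {NI : Set ℝ}
variable {θ : C(square M, ℂ) →ₛₗ[starRingEnd ℂ] ℂ} {ρ : ℕ → ℕ → ℝ}

lemma IsGrid.mu_cell (hG : IsGrid 𝒜 D θ ρ) (hφ : ‖φ‖ = 1) (hNI : IsNiceDense 𝒜 D M NI) {n : ℕ}
    {p : ℕ × ℕ} (hp : p ∈ cells n) :
    mu 𝒜 D M NI (B M ρ n p.1 p.2) = muNaive 𝒜 D (B M ρ n p.1 p.2) := by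
  obtain ⟨h1, h2⟩ := mem_cells.1 hp
  exact mu_box_eq hφ hNI (hG.mem n _ (by omega)) (hG.mem n _ (by omega)) (hG.mem n _ (by omega))
    (hG.mem n _ (by omega)) (hG.null (by omega) _) (hG.null (by omega) _) (hG.null (by omega) _)
    (hG.null (by omega) _)

lemma IsGrid.isOpen_cell (hG : IsGrid 𝒜 D θ ρ) {n : ℕ} {p : ℕ × ℕ} (hp : p ∈ cells n) :
    IsOpen (B M ρ n p.1 p.2) := by
  obtain ⟨h1, h2⟩ := mem_cells.1 hp
  exact isOpen_box (hG.mem n _ (by omega)) (hG.mem n _ (by omega)) (hG.mem n _ (by omega))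
    (hG.mem n _ (by omega))

lemma mem_R {n : ℕ} {ε : ℝ} {z : ℂ} :
    z ∈ R M ρ n ε ↔ ∃ p ∈ gridLines n, z ∈ strip M p.1 (ρ n p.2) ε := by
  simp only [R, mem_iUnion, Finset.mem_range]
  constructor
  · rintro ⟨i, hi, h | h⟩
    · exact ⟨(true, i), mem_gridLines.2 hi, h⟩
    · exact ⟨(false, i), mem_gridLines.2 hi, h⟩
  · rintro ⟨⟨b, i⟩, hi, h⟩
    refine ⟨i, mem_gridLines.1 hi, ?_⟩
    cases b
    · exact Or.inr h
    · exact Or.inl h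

lemma IsGrid.eventually_muNaive_R_lt (hG : IsGrid 𝒜 D θ ρ) (hφ : ‖φ‖ = 1) (n : ℕ) {δ : ℝ}
    (hδ : 0 < δ) : ∀ᶠ ε in 𝓝[>] (0 : ℝ), muNaive 𝒜 D (R M ρ n ε) < δ := by
  have hη : 0 < δ / ((gridLines n).card + 1) := by positivity
  have hev : ∀ᶠ ε in 𝓝[>] (0 : ℝ), ∀ p ∈ gridLines n,
      muNaive 𝒜 D (strip M p.1 (ρ n p.2) ε) ≤ δ / ((gridLines n).card + 1) := by
    refine (Finset.eventually_all _).2 fun p hp => ?_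
    obtain ⟨ε, hε, hf⟩ := hG.null (mem_gridLines.1 hp) p.1 _ hη
    filter_upwards [Ioo_mem_nhdsGT hε] with ε' hε'
    exact (muNaive_mono hφ 𝒜 D (strip_mono M _ _ hε'.2.le)).trans hf.le
  filter_upwards [hev] with ε hε
  refine ((muNaive_le_sum hφ 𝒜 D (gridLines n) fun z hz => mem_R.1 hz).trans
    (Finset.sum_le_sum hε)).trans_lt ?_
  rw [Finset.sum_const, nsmul_eq_mul, mul_div_assoc', div_lt_iff₀ (by positivity)]
  nlinarith

lemma IsGrid.eventually_theta_R_lt (hG : IsGrid 𝒜 D θ ρ) (n : ℕ) {δ : ℝ} (hδ : 0 < δ) :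
    ∀ᶠ ε in 𝓝[>] (0 : ℝ), ∀ f, IsXFunction (R M ρ n ε) f → ‖θ f‖ < δ := by
  obtain ⟨ε₀, hε₀, h⟩ := hG.exists_theta_lt n hδ
  filter_upwards [Ioo_mem_nhdsGT hε₀] with ε hε f hf
  refine h f hf.1 fun x hx => hf.2 x fun hR => ?_
  obtain ⟨p, hp, hxp⟩ := mem_R.1 hR
  exact absurd (hx p hp) (not_lt.2 (hxp.2.le.trans hε.2.le))

/-- Some box of the subdivision has a positive mass. -/
lemma IsGrid.exists_mu_pos (hG : IsGrid 𝒜 D θ ρ) (hφ : ‖φ‖ = 1) (hNI : IsNiceDense 𝒜 D M NI)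
    (hlam : ∀ N k, 𝒜.lam N k ∈ square M) (n : ℕ) :
    ∃ p ∈ cells n, 0 < mu 𝒜 D M NI (B M ρ n p.1 p.2) := by
  by_contra! hcon
  have hzero : ∀ p ∈ cells n, muNaive 𝒜 D (B M ρ n p.1 p.2) ≤ 0 := fun p hp => by
    rw [← hG.mu_cell hφ hNI hp]
    exact hcon p hp
  obtain ⟨ε, hR, hε⟩ :=
    ((hG.eventually_muNaive_R_lt hφ n one_pos).and self_mem_nhdsWithin).exists
  have h1 : (1 : ℝ) ≤ muNaive 𝒜 D (square M) := by
    refine ge_of_tendsto' (tendsto_muN hφ 𝒜 D _) fun N => ?_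
    rw [muN_eq, ← sum_xi_sq hφ 𝒜 N]
    exact Finset.sum_le_sum fun k _ => by rw [if_pos (hlam N k)]
  have h2 : square M ⊆ (⋃ p ∈ cells n, B M ρ n p.1 p.2) ∪ R M ρ n ε := by
    intro z hz
    by_cases hzR : z ∈ R M ρ n ε
    · exact Or.inr hzR
    · have hε' : (0 : ℝ) < ε := hε
      obtain ⟨p, hp, h0, ⟨h1, h2⟩, h3, h4⟩ := hG.exists_inner_box n (half_pos hε').le hz
        -- Membership in `R` is strict, so a point outside has distance at least `ε` from the lines;
        -- halving `ε` gives the strict inequality required.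
        fun p hp => by
          by_contra hlt
          exact hzR (mem_R.2 ⟨p, hp, hz, by linarith [not_lt.1 hlt]⟩)
      refine Or.inl (mem_iUnion₂.2 ⟨p, hp, h0, ⟨?_, ?_⟩, ?_, ?_⟩) <;> linarith
  have h3 := (muNaive_mono hφ 𝒜 D h2).trans (muNaive_union_le hφ 𝒜 D _ _)
  have h4 : muNaive 𝒜 D (⋃ p ∈ cells n, B M ρ n p.1 p.2) ≤ 0 :=
    (muNaive_le_sum hφ 𝒜 D (cells n) fun z hz => by simpa using hz).trans
      (Finset.sum_nonpos hzero)
  linarith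

lemma isNice_of_isNull {s : ℝ} (hs : s ∈ Icc (-(M : ℝ)) M) (hφ : ‖φ‖ = 1)
    (h1 : IsNull 𝒜 D M true s) (h2 : IsNull 𝒜 D M false s) : IsNice 𝒜 D M s := by
  refine ⟨hs, fun δ hδ => ?_⟩
  obtain ⟨ε₁, hε₁, k1⟩ := h1 δ hδ
  obtain ⟨ε₂, hε₂, k2⟩ := h2 δ hδ
  exact ⟨min ε₁ ε₂, lt_min hε₁ hε₂,
    (muNaive_mono hφ 𝒜 D (strip_mono M true s (min_le_left _ _))).trans_lt k1,
    (muNaive_mono hφ 𝒜 D (strip_mono M false s (min_le_right _ _))).trans_lt k2⟩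

lemma countable_not_isVeryNice (hφ : ‖φ‖ = 1) (𝒜 : ApproxSystem A r φ) (D : Ultrafilter ℕ)
    (M : ℕ) (ρ : ℕ → ℕ → ℝ) (n : ℕ) : {ε | ¬ IsVeryNice 𝒜 D M ρ n ε}.Countable := by
  set Z : Set ℝ := {s | ¬ IsNull 𝒜 D M true s} ∪ {s | ¬ IsNull 𝒜 D M false s} with hZdef
  have hZ : Z.Countable := (countable_not_null hφ 𝒜 D M true).union
    (countable_not_null hφ 𝒜 D M false)
  refine (countable_iUnion fun i : ℕ => (hZ.preimage (f := fun ε => ρ n i - ε)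
    fun x y h => by simpa using h).union (hZ.preimage (f := fun ε => ρ n i + ε)
    fun x y h => by simpa using h)).mono ?_
  intro ε hε
  by_contra hcon
  refine hε fun i _ s hs => ?_
  have hsZ : s ∉ Z := by
    simp only [mem_iUnion, not_exists, mem_union, mem_preimage, not_or] at hcon
    rcases hs with rfl | rfl
    · exact (hcon i).1
    · exact (hcon i).2
  simp only [hZdef, mem_union, mem_ofPred_eq, not_or, not_not] at hsZ
  by_cases h1 : s < -(M : ℝ)
  · exact Or.inr (Or.inl h1)
  · by_cases h2 : (M : ℝ) < s
    · exact Or.inr (Or.inr h2)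
    · exact Or.inl (isNice_of_isNull ⟨not_lt.1 h1, not_lt.1 h2⟩ hφ hsZ.1 hsZ.2)

/-- Condition (ii) of the definition of good pairs, for a single `N`. -/
def IsGoodAt (𝒜 : ApproxSystem A r φ) (D : Ultrafilter ℕ) (NI : Set ℝ)
    (θ : C(square M, ℂ) →ₛₗ[starRingEnd ℂ] ℂ) (ρ : ℕ → ℕ → ℝ) (N n : ℕ) (ε : ℝ) : Prop :=
  (∀ f, IsXFunction (R M ρ n ε) f → ‖θ f‖ < deltaN 𝒜 D M NI ρ N n) ∧
  muN 𝒜 N (R M ρ n ε) < deltaN 𝒜 D M NI ρ N n ∧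
  ∀ i < 2 ^ (n + 2), ∀ j < 2 ^ (n + 2),
    |muN 𝒜 N (B M ρ n i j) - mu 𝒜 D M NI (B M ρ n i j)| < deltaN 𝒜 D M NI ρ N n

lemma IsGrid.exists_width (hG : IsGrid 𝒜 D θ ρ) (hφ : ‖φ‖ = 1) (hNI : IsNiceDense 𝒜 D M NI)
    (hlam : ∀ N k, 𝒜.lam N k ∈ square M) (n : ℕ) :
    ∃ ε > 0, ε < 1 / ((n : ℝ) + 1) ∧ IsVeryNice 𝒜 D M ρ n ε ∧
      (∀ i < 2 ^ (n + 2), ρ n i + ε < ρ n (i + 1) - ε) ∧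
      ∀ᶠ N in (D : Filter ℕ), IsGoodAt 𝒜 D NI θ ρ N n ε := by
  obtain ⟨p₀, hp₀, hpos⟩ := hG.exists_mu_pos hφ hNI hlam n
  obtain ⟨c, hcle, hc⟩ : ∃ c, (∀ p ∈ cells n, 0 < mu 𝒜 D M NI (B M ρ n p.1 p.2) →
      c ≤ mu 𝒜 D M NI (B M ρ n p.1 p.2)) ∧ c ∈ Ioi (0 : ℝ) := by
    refine Eventually.exists (f := 𝓝[>] (0 : ℝ)) (.and ?_ self_mem_nhdsWithin)
    refine (Finset.eventually_all _).2 fun p _ => ?_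
    by_cases h : 0 < mu 𝒜 D M NI (B M ρ n p.1 p.2)
    · filter_upwards [Ioo_mem_nhdsGT h] with c hc _ using hc.2.le
    · exact Eventually.of_forall fun _ h' => absurd h' h
  have hc : 0 < c := hc
  -- A bound that does not depend on `N`: once each `μ_N(B)` is within `δ ≤ c / 2` of `μ(B)`, the
  -- boxes with `μ(B) > 0` have `μ_N(B) ≥ c / 2`, and so `δ` is at most `deltaN`.
  set δ := c / 2 / 2 ^ (3 * (n + 2)) with hδdef
  have hδ : 0 < δ := by positivity
  have hδc : δ ≤ c / 2 := div_le_self (by positivity) (one_le_pow₀ one_le_two)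
  have hsep : ∀ᶠ ε in 𝓝[>] (0 : ℝ), ∀ i ∈ Finset.range (2 ^ (n + 2)),
      ρ n i + ε < ρ n (i + 1) - ε := by
    refine (Finset.eventually_all _).2 fun i hi => ?_
    have := (hG.mesh n i (Finset.mem_range.1 hi)).1
    filter_upwards [Ioo_mem_nhdsGT (half_pos (sub_pos.2 this))] with ε hε
    linarith [hε.2]
  have hall := ((hG.eventually_theta_R_lt n hδ).and
    (hG.eventually_muNaive_R_lt hφ n hδ)).and (hsep.and
      (Ioo_mem_nhdsGT (show (0 : ℝ) < 1 / ((n : ℝ) + 1) by positivity)))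
  obtain ⟨ε₀, hε₀, hsub⟩ := mem_nhdsGT_iff_exists_Ioo_subset.1 hall
  -- All the other conditions hold on an interval `(0, ε₀)`; being very nice excludes only countably
  -- many widths.
  obtain ⟨ε, hεn, hε1, hε2⟩ :=
    ((countable_not_isVeryNice hφ 𝒜 D M ρ n).dense_compl ℝ).exists_between hε₀
  obtain ⟨⟨k1, k2⟩, k3, k4⟩ := hsub ⟨hε1, hε2⟩
  refine ⟨ε, hε1, k4.2, not_not.1 hεn, fun i hi => k3 i (Finset.mem_range.2 hi), ?_⟩
  have hclose : ∀ᶠ N in (D : Filter ℕ), ∀ p ∈ cells n,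
      |muN 𝒜 N (B M ρ n p.1 p.2) - mu 𝒜 D M NI (B M ρ n p.1 p.2)| < δ := by
    refine (Finset.eventually_all _).2 fun p hp => ?_
    have := Metric.tendsto_nhds.1 (tendsto_muN hφ 𝒜 D (B M ρ n p.1 p.2)) δ hδ
    rw [hG.mu_cell hφ hNI hp]
    exact this
  filter_upwards [hclose, (tendsto_muN hφ 𝒜 D _).eventually_lt_const k2] with N h1 h2
  have hle : δ ≤ deltaN 𝒜 D M NI ρ N n := by
    rw [hδdef, deltaN]
    refine div_le_div_of_nonneg_right ?_ (by positivity)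
    refine le_csInf ⟨_, p₀.1, (mem_cells.1 hp₀).1, p₀.2, (mem_cells.1 hp₀).2, hpos, rfl⟩ ?_
    rintro _ ⟨i, hi, j, hj, hij, rfl⟩
    have e1 := hcle (i, j) (mem_cells.2 ⟨hi, hj⟩) hij
    have e2 := (abs_lt.1 (h1 (i, j) (mem_cells.2 ⟨hi, hj⟩))).1
    dsimp only at e1 e2
    linarith
  exact ⟨fun f hf => (k1 f hf).trans_le hle, h2.trans_le hle,
    fun i hi j hj => (h1 (i, j) (mem_cells.2 ⟨hi, hj⟩)).trans_le hle⟩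

/-- A diagonal choice: `n(N)` is the largest level `m ≤ N` whose width is good at `N`. Level `m + 1`
is good for `D`-many `N ≥ m + 1`, so `n(N) > m` there. Level `0` is always admitted as a fallback;
condition (ii) says nothing about it, which is why the witnessing set can be everything. -/
lemma IsGrid.exists_isThetaGoodOn (hG : IsGrid 𝒜 D θ ρ) (hφ : ‖φ‖ = 1)
    (hNI : IsNiceDense 𝒜 D M NI) (hlam : ∀ N k, 𝒜.lam N k ∈ square M)
    (hD : ∀ m, ∀ᶠ N in (D : Filter ℕ), m ≤ N) :
    ∃ (n : ℕ → ℕ) (ε : ℕ → ℝ), IsThetaGoodOn 𝒜 D NI θ ρ univ n ε ∧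
      ∀ N : ℕ, ∀ i < 2 ^ (n N + 2), ρ (n N) i + ε N < ρ (n N) (i + 1) - ε N := by
  classical
  choose w hw0 hw1 hw2 hw3 hw4 using hG.exists_width hφ hNI hlam
  set n : ℕ → ℕ := fun N => Nat.findGreatest (fun m => m = 0 ∨ IsGoodAt 𝒜 D NI θ ρ N m (w m)) N
  have hspec : ∀ N, 0 < n N → IsGoodAt 𝒜 D NI θ ρ N (n N) (w (n N)) := fun N hN =>
    (Nat.findGreatest_spec (P := fun m => m = 0 ∨ IsGoodAt 𝒜 D NI θ ρ N m (w m))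
      (Nat.zero_le N) (Or.inl rfl)).resolve_left hN.ne'
  refine ⟨n, fun N => w (n N), ⟨fun N => hw0 _, fun m hm => ?_, fun N _ hN => (hspec N hN).1,
    fun N _ hN => (hspec N hN).2.1, fun N _ hN => (hspec N hN).2.2, fun N => hw2 _⟩,
    fun N => hw3 _⟩
  filter_upwards [hw4 (m + 1), hD (m + 1)] with N h1 h2
  have hlt : m + 1 ≤ n N := Nat.le_findGreatest h2 (Or.inr h1)
  refine ⟨hlt, (hw1 _).trans_le ?_⟩
  have hm' : (0 : ℝ) < m := by exact_mod_cast hm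
  have : (m : ℝ) ≤ n N := by exact_mod_cast (by omega : m ≤ n N)
  exact one_div_le_one_div_of_le hm' (by linarith)

end GoodPairs

/-! ### The dual norms on the approximations and their ultralimits -/

section Norms

variable {H : Type*} [NormedAddCommGroup H] [InnerProductSpace ℂ H] [CompleteSpace H]
variable {A : H →L[ℂ] H} {r : ℝ} {φ : H} {𝒜 : ApproxSystem A r φ} {D : Ultrafilter ℕ}

lemma repr_sum_smul (𝒜 : ApproxSystem A r φ) (N : ℕ)
    (c : Fin (Module.finrank ℂ (HN A φ N)) → ℂ) (k) :
    (𝒜.u N).repr (∑ l, c l • 𝒜.u N l) k = c k := by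
  classical
  rw [OrthonormalBasis.repr_apply_apply, inner_sum, Finset.sum_eq_single k]
  · rw [inner_smul_right, orthonormal_iff_ite.1 (𝒜.u N).orthonormal, if_pos rfl, mul_one]
  · intro l _ hl
    rw [inner_smul_right, orthonormal_iff_ite.1 (𝒜.u N).orthonormal, if_neg (Ne.symm hl), mul_zero]
  · simp

lemma inner_eq_sum_repr (𝒜 : ApproxSystem A r φ) (N : ℕ) (v w : HN A φ N) :
    ⟪v, w⟫_ℂ = ∑ k, starRingEnd ℂ ((𝒜.u N).repr v k) * (𝒜.u N).repr w k := by
  rw [← (𝒜.u N).sum_inner_mul_inner v w]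
  refine Finset.sum_congr rfl fun k _ => ?_
  rw [OrthonormalBasis.repr_apply_apply, OrthonormalBasis.repr_apply_apply, inner_conj_symm]

/-- Weighted `ℓ¹`-`ℓ^∞` duality. The bound on `v` is required only on the support of `w`, so that
for `w = u_N(θ)` control near the spectrum is enough. -/
lemma norm_inner_le_mul_norm0 {N : ℕ} {v w : HN A φ N} {C : ℝ}
    (h : ∀ k, (𝒜.u N).repr w k ≠ 0 → ‖(𝒜.u N).repr v k‖ ≤ C * xi 𝒜 N k) :
    ‖⟪v, w⟫_ℂ‖ ≤ C * norm0 𝒜 N w := by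
  rw [inner_eq_sum_repr 𝒜, norm0, Finset.mul_sum]
  refine (norm_sum_le _ _).trans (Finset.sum_le_sum fun k _ => ?_)
  rw [norm_mul, RCLike.norm_conj]
  by_cases hk : (𝒜.u N).repr w k = 0
  · simp [hk]
  · rw [← mul_assoc]
    exact mul_le_mul_of_nonneg_right (h k hk) (norm_nonneg _)

lemma ratio_nonneg (𝒜 : ApproxSystem A r φ) (N : ℕ) (v : HN A φ N) (k) :
    0 ≤ (xi 𝒜 N k)⁻¹ * ‖(𝒜.u N).repr v k‖ :=
  mul_nonneg (inv_nonneg.2 (xi_nonneg 𝒜 N k)) (norm_nonneg _)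

lemma normSup_nonneg (𝒜 : ApproxSystem A r φ) (X : Set ℂ) (N : ℕ) (v : HN A φ N) :
    0 ≤ normSup 𝒜 X N v :=
  Real.sSup_nonneg fun _ ⟨k, _, ht⟩ => ht ▸ ratio_nonneg 𝒜 N v k

lemma normSup_le {X : Set ℂ} {N : ℕ} {v : HN A φ N} {C : ℝ} (hC : 0 ≤ C)
    (h : ∀ k, 𝒜.lam N k ∈ X → (xi 𝒜 N k)⁻¹ * ‖(𝒜.u N).repr v k‖ ≤ C) :
    normSup 𝒜 X N v ≤ C :=
  Real.sSup_le (fun _ ⟨k, hk, ht⟩ => ht ▸ h k hk) hC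

lemma le_normSup {X : Set ℂ} {N : ℕ} (v : HN A φ N) {k} (hk : 𝒜.lam N k ∈ X) :
    (xi 𝒜 N k)⁻¹ * ‖(𝒜.u N).repr v k‖ ≤ normSup 𝒜 X N v := by
  refine le_csSup (Set.Finite.bddAbove ?_) ⟨k, hk, rfl⟩
  exact (finite_range fun k => (xi 𝒜 N k)⁻¹ * ‖(𝒜.u N).repr v k‖).subset
    fun _ ⟨k, _, ht⟩ => ⟨k, ht.symm⟩

lemma normSup_mono {X Y : Set ℂ} (h : X ⊆ Y) (N : ℕ) (v : HN A φ N) :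
    normSup 𝒜 X N v ≤ normSup 𝒜 Y N v :=
  normSup_le (normSup_nonneg 𝒜 Y N v) fun _ hk => le_normSup v (h hk)

lemma exists_stdPart_eq {g : ℕ → ℝ} {C : ℝ} (h0 : ∀ N, 0 ≤ g N)
    (hC : ∀ᶠ N in (D : Filter ℕ), g N ≤ C) :
    ∃ q, 0 ≤ q ∧ q ≤ C ∧ Tendsto g D (𝓝 q) ∧
      stdPart (g : Filter.Germ (D : Filter ℕ) ℝ) = ENNReal.ofReal q := by
  obtain ⟨x, hxm, hx⟩ := (isCompact_Icc (a := (0 : ℝ)) (b := C)).ultrafilter_le_nhds'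
    (D.map g) (Filter.mem_map.2 (hC.mono fun _ hN => ⟨h0 _, hN⟩))
  have hex : ∃ q : ℝ, (g : Filter.Germ (D : Filter ℕ) ℝ).Tendsto (𝓝 q) := ⟨x, hx⟩
  refine ⟨x, hxm.1, hxm.2, hx, ?_⟩
  rw [stdPart, dif_pos hex]
  exact congrArg _ (tendsto_nhds_unique (f := g) (l := (D : Filter ℕ)) hex.choose_spec hx)

/-- The coordinates of the `v_N` are uniformly dominated by those of `φ`. -/
def IsUniformlyBounded (𝒜 : ApproxSystem A r φ) (D : Ultrafilter ℕ) (v : ∀ N, HN A φ N) : Prop :=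
  ∃ p : ℕ, ∀ᶠ N in (D : Filter ℕ), ∀ k, (xi 𝒜 N k)⁻¹ * ‖(𝒜.u N).repr (v N) k‖ < (p : ℝ)

lemma IsUniformlyBounded.exists_normEps_eq {v : ∀ N, HN A φ N} {C : ℝ} (hC : 0 ≤ C)
    (hv : ∀ᶠ N in (D : Filter ℕ), ∀ k, (xi 𝒜 N k)⁻¹ * ‖(𝒜.u N).repr (v N) k‖ ≤ C) (ε : ℝ) :
    ∃ q, 0 ≤ q ∧ q ≤ C ∧ Tendsto (fun N => normSup 𝒜 (nearSpectrum A ε) N (v N)) D (𝓝 q) ∧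
      normEps 𝒜 D ε (toHu D v) = ENNReal.ofReal q :=
  exists_stdPart_eq (fun _ => normSup_nonneg 𝒜 _ _ _)
    (hv.mono fun _ hN => normSup_le hC fun k _ => hN k)

/-- `‖v‖_∞^ε` increases with `ε`, since the supremum is taken over larger sets; hence the limit as
`ε → 0` exists and `limUnder` attains it. -/
lemma IsUniformlyBounded.tendsto_normEps {v : ∀ N, HN A φ N} (hv : IsUniformlyBounded 𝒜 D v) :
    Tendsto (fun ε => normEps 𝒜 D ε (toHu D v)) (𝓝[>] 0) (𝓝 (normInf 𝒜 D (toHu D v))) := by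
  obtain ⟨p, hp⟩ := hv
  have hp' := hp.mono fun N h k => (h k).le
  have hmono : Monotone fun ε => normEps 𝒜 D ε (toHu D v) := by
    intro ε ε' hεε
    obtain ⟨q, _, _, hq, he⟩ := exists_normEps_eq (Nat.cast_nonneg p) hp' ε
    obtain ⟨q', _, _, hq', he'⟩ := exists_normEps_eq (Nat.cast_nonneg p) hp' ε'
    simp only [he, he']
    exact ENNReal.ofReal_le_ofReal (le_of_tendsto_of_tendsto' hq hq' fun N =>
      normSup_mono (fun z hz => le_trans hz hεε) N _)
  have hex : ∃ p : ℕ, (ultra D (fun N x => ∀ k, (xi 𝒜 N k)⁻¹ * ‖(𝒜.u N).repr x k‖ < (p : ℝ))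
      (toHu D v)).LiftPred (fun P : Prop => P) := ⟨p, hp⟩
  rw [normInf, if_pos hex]
  exact tendsto_nhds_limUnder ⟨_, hmono.tendsto_nhdsGT 0⟩

lemma IsUniformlyBounded.normInf_le {v : ∀ N, HN A φ N} (hv : IsUniformlyBounded 𝒜 D v) {C : ℝ}
    (hC : 0 ≤ C)
    (h : ∀ᶠ N in (D : Filter ℕ), ∀ k, (xi 𝒜 N k)⁻¹ * ‖(𝒜.u N).repr (v N) k‖ ≤ C) :
    normInf 𝒜 D (toHu D v) ≤ ENNReal.ofReal C := by
  refine le_of_tendsto' hv.tendsto_normEps fun ε => ?_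
  obtain ⟨q, _, hq, _, he⟩ := exists_normEps_eq hC h ε
  rw [he]
  exact ENNReal.ofReal_le_ofReal hq

lemma isUniformlyBounded_of_normInf {v : ∀ N, HN A φ N} (h : normInf 𝒜 D (toHu D v) = 0) :
    IsUniformlyBounded 𝒜 D v := by
  by_contra hcon
  have hex : ¬ ∃ p : ℕ, (ultra D (fun N x => ∀ k, (xi 𝒜 N k)⁻¹ * ‖(𝒜.u N).repr x k‖ < (p : ℝ))
      (toHu D v)).LiftPred (fun P : Prop => P) := hcon
  rw [normInf, if_neg hex] at h
  exact ENNReal.top_ne_zero h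

/-- Turns a vanishing double limit into a usable estimate: one fixed neighbourhood of the spectrum,
valid for `D`-many `N`. -/
lemma exists_normSup_lt {v : ∀ N, HN A φ N} (h : normInf 𝒜 D (toHu D v) = 0) {η : ℝ}
    (hη : 0 < η) :
    ∃ ε > 0, ∀ᶠ N in (D : Filter ℕ), normSup 𝒜 (nearSpectrum A ε) N (v N) < η := by
  have hv := isUniformlyBounded_of_normInf h
  have hlim := hv.tendsto_normEps
  rw [h] at hlim
  obtain ⟨ε, hlt, hε⟩ := ((hlim.eventually_lt_const (ENNReal.ofReal_pos.2 hη)).and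
    self_mem_nhdsWithin).exists
  obtain ⟨p, hp⟩ := hv
  obtain ⟨q, hq0, _, hq, he⟩ := IsUniformlyBounded.exists_normEps_eq (Nat.cast_nonneg p)
    (hp.mono fun N h k => (h k).le) ε
  rw [he, ENNReal.ofReal_lt_ofReal_iff hη] at hlt
  exact ⟨ε, hε, hq.eventually_lt_const hlt⟩

end Norms

/-! ### Coordinates of `u_N(θ)` and its products with `F_N(f)` -/

section Representation

variable {H : Type*} [NormedAddCommGroup H] [InnerProductSpace ℂ H] [CompleteSpace H]
variable {A : H →L[ℂ] H} {r : ℝ} {φ : H}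
variable {M : ℕ} {𝒜 : ApproxSystem A r φ} {D : Ultrafilter ℕ} {NI : Set ℝ}
variable {θ : C(square M, ℂ) →ₛₗ[starRingEnd ℂ] ℂ} {ρ : ℕ → ℕ → ℝ}

lemma repr_FN (𝒜 : ApproxSystem A r φ) (f : C(square M, ℂ)) (N : ℕ) (k) :
    (𝒜.u N).repr (FN 𝒜 f N) k = (xi 𝒜 N k : ℂ) * evalAt f (𝒜.lam N k) :=
  repr_sum_smul 𝒜 N _ k

lemma evalAt_of_mem (f : C(square M, ℂ)) {z : ℂ} (hz : z ∈ square M) : evalAt f z = f ⟨z, hz⟩ :=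
  dif_pos hz

open Classical in
/-- The boxes of the `n`-th subdivision with non-zero mass. -/
def chargedCells (𝒜 : ApproxSystem A r φ) (D : Ultrafilter ℕ) (M : ℕ) (NI : Set ℝ)
    (ρ : ℕ → ℕ → ℝ) (n : ℕ) : Finset (ℕ × ℕ) :=
  {p ∈ cells n | mu 𝒜 D M NI (B M ρ n p.1 p.2) ≠ 0}

lemma mem_chargedCells {n : ℕ} {p : ℕ × ℕ} : p ∈ chargedCells 𝒜 D M NI ρ n ↔
    p ∈ cells n ∧ mu 𝒜 D M NI (B M ρ n p.1 p.2) ≠ 0 := by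
  classical
  exact Finset.mem_filter

open Classical in
lemma repr_uN (n : ℕ → ℕ) (N : ℕ) (k) :
    (𝒜.u N).repr (uN 𝒜 D NI θ ρ n N) k = ∑ p ∈ chargedCells 𝒜 D M NI ρ (n N),
      if 𝒜.lam N k ∈ B M ρ (n N) p.1 p.2 then
        (xi 𝒜 N k : ℂ) * thetaBox θ ρ (n N) p.1 p.2 / (muN 𝒜 N (B M ρ (n N) p.1 p.2) : ℂ)
      else 0 := by
  suffices h : uN 𝒜 D NI θ ρ n N = ∑ k, (∑ p ∈ chargedCells 𝒜 D M NI ρ (n N),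
      if 𝒜.lam N k ∈ B M ρ (n N) p.1 p.2 then
        (xi 𝒜 N k : ℂ) * thetaBox θ ρ (n N) p.1 p.2 / (muN 𝒜 N (B M ρ (n N) p.1 p.2) : ℂ)
      else 0) • 𝒜.u N k by
    rw [h, repr_sum_smul]
  simp only [Finset.sum_smul]
  rw [Finset.sum_comm, uN]
  refine Finset.sum_congr rfl fun p _ => ?_
  rw [Finset.sum_filter]
  refine Finset.sum_congr rfl fun k _ => ?_
  split_ifs
  · rfl
  · rw [zero_smul]

lemma IsGrid.dist_lt (hG : IsGrid 𝒜 D θ ρ) {n : ℕ} {p : ℕ × ℕ} (hp : p ∈ cells n) {z w : ℂ}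
    (hz : z ∈ B M ρ n p.1 p.2) (hw : w ∈ B M ρ n p.1 p.2) :
    dist z w < 4 * M / ((n : ℝ) + 1) := by
  obtain ⟨h1, h2⟩ := mem_cells.1 hp
  have m1 := (hG.mesh n p.1 h1).2
  have m2 := (hG.mesh n p.2 h2).2
  obtain ⟨_, ⟨a1, a2⟩, a3, a4⟩ := hz
  obtain ⟨_, ⟨b1, b2⟩, b3, b4⟩ := hw
  have e1 : |(z - w).re| < 2 * M / ((n : ℝ) + 1) := by
    rw [Complex.sub_re]
    exact abs_lt.2 ⟨by linarith, by linarith⟩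
  have e2 : |(z - w).im| < 2 * M / ((n : ℝ) + 1) := by
    rw [Complex.sub_im]
    exact abs_lt.2 ⟨by linarith, by linarith⟩
  rw [dist_eq_norm]
  calc ‖z - w‖ ≤ |(z - w).re| + |(z - w).im| := Complex.norm_le_abs_re_add_abs_im _
    _ < 2 * M / ((n : ℝ) + 1) + 2 * M / ((n : ℝ) + 1) := add_lt_add e1 e2
    _ = 4 * M / ((n : ℝ) + 1) := by ring

/-- The coordinates of `u_N(θ)` are supported near the spectrum. -/
lemma IsGrid.exists_dist_lt_of_repr_ne_zero (hG : IsGrid 𝒜 D θ ρ) {σ : Set ℂ} {K : ℝ}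
    (hK : IsBoundedOn σ K θ) {n : ℕ → ℕ} {N : ℕ} {k}
    (h : (𝒜.u N).repr (uN 𝒜 D NI θ ρ n N) k ≠ 0) :
    ∃ z ∈ σ, dist (𝒜.lam N k) z < 4 * M / ((n N : ℝ) + 1) := by
  classical
  rw [repr_uN] at h
  obtain ⟨p, hp, hne⟩ := Finset.exists_ne_zero_of_sum_ne_zero h
  have hpc := (mem_chargedCells.1 hp).1
  have hlam : 𝒜.lam N k ∈ B M ρ (n N) p.1 p.2 := by
    by_contra hlam
    exact hne (if_neg hlam)
  by_contra! hcon
  -- A non-zero coordinate forces its box to meet `σ`, and the box has diameter below twice the mesh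
  -- bound.
  have : thetaBox θ ρ (n N) p.1 p.2 = 0 := hG.thetaBox_eq_zero hK hpc fun z hz hzB =>
    absurd (hG.dist_lt hpc hlam hzB) (not_lt.2 (hcon z hz))
  rw [this] at hne
  simp at hne

lemma IsGrid.norm0_uN_le (hG : IsGrid 𝒜 D θ ρ) {σ : Set ℂ} {K : ℝ}
    (hK : IsBoundedOn σ K θ) (n : ℕ → ℕ) (N : ℕ) : norm0 𝒜 N (uN 𝒜 D NI θ ρ n N) ≤ K := by
  classical
  have h1 : norm0 𝒜 N (uN 𝒜 D NI θ ρ n N) ≤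
      ∑ k, ∑ p ∈ chargedCells 𝒜 D M NI ρ (n N), ‖thetaBox θ ρ (n N) p.1 p.2‖ /
        muN 𝒜 N (B M ρ (n N) p.1 p.2) *
        (if 𝒜.lam N k ∈ B M ρ (n N) p.1 p.2 then xi 𝒜 N k ^ 2 else 0) := by
    refine Finset.sum_le_sum fun k _ => ?_
    rw [repr_uN]
    refine (mul_le_mul_of_nonneg_left (norm_sum_le _ _) (xi_nonneg 𝒜 N k)).trans ?_
    rw [Finset.mul_sum]
    refine Finset.sum_le_sum fun p _ => ?_
    split_ifs
    · rw [norm_div, norm_mul, Complex.norm_real, Complex.norm_real,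
        Real.norm_of_nonneg (xi_nonneg 𝒜 N k), Real.norm_of_nonneg (muN_nonneg 𝒜 N _)]
      exact le_of_eq (by ring)
    · simp
  refine h1.trans ?_
  rw [Finset.sum_comm]
  refine le_trans ?_ (hG.sum_norm_thetaBox_le hK (n N))
  refine (Finset.sum_le_sum fun p _ => ?_).trans (Finset.sum_le_sum_of_subset_of_nonneg
    (fun p hp => (mem_chargedCells.1 hp).1) fun _ _ _ => norm_nonneg _)
  -- Summing `ξ²` over a box restores the `μ_N(B)` in the denominator. The quotient is `1`, or `0`
  -- when the box has no mass, so an inequality suffices.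
  rw [← Finset.mul_sum, ← muN_eq]
  rw [div_mul_eq_mul_div]
  exact div_le_of_le_mul₀ (muN_nonneg 𝒜 N _) (norm_nonneg _) le_rfl

/-- `⟨F_N(f) | u_N(θ)⟩` is a Riemann sum that approximates `θ(f)`. -/
lemma IsGrid.norm_theta_sub_inner_le (hG : IsGrid 𝒜 D θ ρ) {σ : Set ℂ} {K : ℝ}
    (hK : IsBoundedOn σ K θ) (hlam : ∀ N k, 𝒜.lam N k ∈ square M) (f : C(square M, ℂ))
    {n : ℕ → ℕ} {N : ℕ} {ω : ℝ} (hω : 0 ≤ ω)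
    (hzero : ∀ p ∈ cells (n N), mu 𝒜 D M NI (B M ρ (n N) p.1 p.2) = 0 →
      thetaBox θ ρ (n N) p.1 p.2 = 0)
    (hpos : ∀ p ∈ cells (n N), mu 𝒜 D M NI (B M ρ (n N) p.1 p.2) ≠ 0 →
      0 < muN 𝒜 N (B M ρ (n N) p.1 p.2))
    (hf : ∀ p ∈ cells (n N), ∀ x y : square M, (x : ℂ) ∈ B M ρ (n N) p.1 p.2 →
      (y : ℂ) ∈ B M ρ (n N) p.1 p.2 → ‖f x - f y‖ ≤ ω) :
    ‖θ f - ⟪FN 𝒜 f N, uN 𝒜 D NI θ ρ n N⟫_ℂ‖ ≤ K * ω := by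
  classical
  set m : ℕ × ℕ → ℝ := fun p => muN 𝒜 N (B M ρ (n N) p.1 p.2) with hm
  set avg : ℕ × ℕ → ℂ := fun p => (∑ k, if 𝒜.lam N k ∈ B M ρ (n N) p.1 p.2 then
    (xi 𝒜 N k : ℂ) ^ 2 * evalAt f (𝒜.lam N k) else 0) / (m p : ℂ) with havg
  -- On boxes without mass the coefficient is multiplied by `θ(B, 1) = 0`, but the Riemann-sum
  -- estimate still needs it to be within `ω` of `f` on the box: any value of `f` there will do.
  set c : ℕ × ℕ → ℂ := fun p => if mu 𝒜 D M NI (B M ρ (n N) p.1 p.2) ≠ 0 then avg p else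
    if h : ∃ x : square M, (x : ℂ) ∈ B M ρ (n N) p.1 p.2 then f h.choose else 0 with hcdef
  have hinner : ⟪FN 𝒜 f N, uN 𝒜 D NI θ ρ n N⟫_ℂ =
      ∑ p ∈ cells (n N), starRingEnd ℂ (c p) * thetaBox θ ρ (n N) p.1 p.2 := by
    rw [inner_eq_sum_repr 𝒜]
    simp only [repr_uN, repr_FN, Finset.mul_sum]
    rw [Finset.sum_comm]
    rw [← Finset.sum_subset (s₁ := chargedCells 𝒜 D M NI ρ (n N))
      (fun p hp => (mem_chargedCells.1 hp).1) fun p hp hp' => ?_]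
    · refine Finset.sum_congr rfl fun p hp => ?_
      have hc : c p = avg p := if_pos (mem_chargedCells.1 hp).2
      rw [hc, havg]
      simp only [map_div₀, Complex.conj_ofReal, map_sum]
      rw [Finset.sum_div, Finset.sum_mul]
      refine Finset.sum_congr rfl fun k _ => ?_
      split_ifs
      · simp only [map_mul, map_pow, Complex.conj_ofReal, hm]
        ring
      · simp
    · have : mu 𝒜 D M NI (B M ρ (n N) p.1 p.2) = 0 := by
        by_contra hne
        exact hp' (mem_chargedCells.2 ⟨hp, hne⟩)
      rw [hzero p hp this, mul_zero]
  rw [hinner]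
  refine hG.norm_sub_sum_le hK (n N) f c hω fun p hp x hx => ?_
  by_cases hmu : mu 𝒜 D M NI (B M ρ (n N) p.1 p.2) ≠ 0
  · have hc : c p = avg p := if_pos hmu
    have hmp : 0 < m p := hpos p hp hmu
    have hmp' : (m p : ℂ) ≠ 0 := by exact_mod_cast hmp.ne'
    have hsum : (m p : ℂ) = ∑ k, if 𝒜.lam N k ∈ B M ρ (n N) p.1 p.2 then
        (xi 𝒜 N k : ℂ) ^ 2 else 0 := by
      simp only [hm, muN_eq]
      push_cast
      refine Finset.sum_congr rfl fun k _ => ?_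
      split_ifs <;> simp
    have hdiff : f x - c p = (∑ k, if 𝒜.lam N k ∈ B M ρ (n N) p.1 p.2 then
        (xi 𝒜 N k : ℂ) ^ 2 * (f x - evalAt f (𝒜.lam N k)) else 0) / (m p : ℂ) := by
      rw [hc, havg, eq_div_iff hmp', sub_mul]
      simp only []
      rw [div_mul_cancel₀ _ hmp']
      conv_lhs => rw [hsum]
      rw [Finset.mul_sum, ← Finset.sum_sub_distrib]
      refine Finset.sum_congr rfl fun k _ => ?_
      split_ifs
      · ring
      · simp
    rw [hdiff, norm_div, Complex.norm_real, Real.norm_of_nonneg hmp.le, div_le_iff₀ hmp]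
    simp only [hm]
    rw [muN_eq, Finset.mul_sum]
    refine (norm_sum_le _ _).trans (Finset.sum_le_sum fun k _ => ?_)
    split_ifs with hk
    · rw [norm_mul, norm_pow, Complex.norm_real, Real.norm_of_nonneg (xi_nonneg 𝒜 N k), mul_comm,
        evalAt_of_mem f (hlam N k)]
      exact mul_le_mul_of_nonneg_right (hf p hp x ⟨_, hlam N k⟩ hx hk) (sq_nonneg _)
    · simp
  · have hex : ∃ x : square M, (x : ℂ) ∈ B M ρ (n N) p.1 p.2 := ⟨x, hx⟩
    have hc : c p = f hex.choose := by
      rw [hcdef]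
      simp only [if_neg hmu, dif_pos hex]
    rw [hc]
    exact hf p hp x _ hx hex.choose_spec

end Representation

lemma IsGenDistribution.exists_isBoundedOn {H : Type*} [NormedAddCommGroup H]
    [InnerProductSpace ℂ H] {A : H →L[ℂ] H} {M : ℕ}
    {θ : C(square M, ℂ) →ₛₗ[starRingEnd ℂ] ℂ} (hθ : IsGenDistribution A θ) :
    ∃ K : ℝ, 0 ≤ K ∧ IsBoundedOn (spectrum ℂ A) K θ := by
  obtain ⟨K, hK⟩ := hθ
  refine ⟨K, Nat.cast_nonneg K, fun f c hc h => (hK f).trans ?_⟩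
  refine mul_le_mul_of_nonneg_left (Real.sSup_le ?_ hc) (Nat.cast_nonneg K)
  rintro _ ⟨x, hx, rfl⟩
  exact h x hx

/-! ### Membership in the two spaces and the value of the pairing -/

section Pairing

variable {H : Type*} [NormedAddCommGroup H] [InnerProductSpace ℂ H] [CompleteSpace H]
variable {A : H →L[ℂ] H} {r : ℝ} {φ : H}
variable {M : ℕ} {𝒜 : ApproxSystem A r φ} {D : Ultrafilter ℕ} {NI : Set ℝ}
variable {θ : C(square M, ℂ) →ₛₗ[starRingEnd ℂ] ℂ} {ρ : ℕ → ℕ → ℝ}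

lemma IsThetaGoodOn.eventually_mesh_lt {U : Set ℕ} {n : ℕ → ℕ} {ε : ℕ → ℝ}
    (h : IsThetaGoodOn 𝒜 D NI θ ρ U n ε) {η : ℝ} (hη : 0 < η) :
    ∀ᶠ N in (D : Filter ℕ), 4 * M / ((n N : ℝ) + 1) < η := by
  obtain ⟨m, hm⟩ := exists_nat_gt (4 * M / η)
  filter_upwards [h.large (m + 1) (Nat.succ_pos m)] with N hN
  have h1 : (m : ℝ) < n N := by exact_mod_cast (by omega : m < n N)
  rw [div_lt_iff₀ hη] at hm
  rw [div_lt_iff₀ (by positivity)]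
  nlinarith

/-- In a good pair, the boxes of positive mass `μ` have positive mass `μ_N`. -/
lemma IsThetaGoodOn.muN_pos {U : Set ℕ} {n : ℕ → ℕ} {ε : ℕ → ℝ}
    (h : IsThetaGoodOn 𝒜 D NI θ ρ U n ε) {N : ℕ} (hN : N ∈ U) (hn : 0 < n N)
    {p : ℕ × ℕ} (hp : p ∈ cells (n N)) (hmu : mu 𝒜 D M NI (B M ρ (n N) p.1 p.2) ≠ 0) :
    0 < muN 𝒜 N (B M ρ (n N) p.1 p.2) := by
  -- `deltaN` exceeds a non-negative mass, so it is positive, and with it the infimum of the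
  -- `μ_N(B)` from which it is formed.
  have hδ : 0 < deltaN 𝒜 D M NI ρ N (n N) :=
    (muN_nonneg 𝒜 N _).trans_lt (h.mass_small N hN hn)
  rw [deltaN, lt_div_iff₀ (by positivity), zero_mul] at hδ
  refine hδ.trans_le (csInf_le ⟨0, ?_⟩ ⟨p.1, (mem_cells.1 hp).1, p.2, (mem_cells.1 hp).2,
    lt_of_le_of_ne ENNReal.toReal_nonneg hmu.symm, rfl⟩)
  rintro _ ⟨i, _, j, _, _, rfl⟩
  exact muN_nonneg 𝒜 N _

lemma IsGrid.uTheta_mem_Hm0pre (hG : IsGrid 𝒜 D θ ρ) {K : ℝ}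
    (hK : IsBoundedOn (spectrum ℂ A) K θ) {U : Set ℕ} {n : ℕ → ℕ} {ε : ℕ → ℝ}
    (hgood : IsThetaGoodOn 𝒜 D NI θ ρ U n ε) (Sq : ℕ → Set (Set ℂ)) :
    uTheta 𝒜 D NI θ ρ n ∈ Hm0pre 𝒜 D Sq := by
  classical
  constructor
  · rintro m Y ⟨_, d, hd, hfar⟩
    change Tendsto (fun N => partNorm0 𝒜 (farPart (Sq m) Y) N (uN 𝒜 D NI θ ρ n N)) D (𝓝 0)
    refine tendsto_const_nhds.congr' ?_
    -- Once the mesh is finer than the distance from the far tiles to the spectrum, every coordinate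
    -- there vanishes exactly.
    filter_upwards [hgood.eventually_mesh_lt hd] with N hN
    refine (Finset.sum_eq_zero fun k hk => ?_).symm
    have hk' : 𝒜.lam N k ∈ farPart (Sq m) Y := by simpa using hk
    by_cases h0 : (𝒜.u N).repr (uN 𝒜 D NI θ ρ n N) k = 0
    · rw [h0, norm_zero, mul_zero]
    · obtain ⟨z, hz, hlt⟩ := hG.exists_dist_lt_of_repr_ne_zero hK h0
      have := hfar z hz _ (subset_closure hk')
      rw [dist_comm] at this
      linarith
  · obtain ⟨p, hp⟩ := exists_nat_gt K
    exact ⟨p, Eventually.of_forall fun N => (hG.norm0_uN_le hK n N).trans_lt hp⟩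

lemma exists_norm_le (f : C(square M, ℂ)) : ∃ C : ℝ, 0 ≤ C ∧ ∀ x, ‖f x‖ ≤ C := by
  have := compactSpace_square M
  exact ⟨‖f‖, norm_nonneg f, f.norm_coe_le_norm⟩

lemma norm_repr_FN_le (hlam : ∀ N k, 𝒜.lam N k ∈ square M) {f : C(square M, ℂ)} {C : ℝ}
    (hC : ∀ x, ‖f x‖ ≤ C) (N : ℕ) (k) : ‖(𝒜.u N).repr (FN 𝒜 f N) k‖ ≤ C * xi 𝒜 N k := by
  rw [repr_FN, norm_mul, Complex.norm_real, Real.norm_of_nonneg (xi_nonneg 𝒜 N k), mul_comm,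
    evalAt_of_mem f (hlam N k)]
  exact mul_le_mul_of_nonneg_right (hC _) (xi_nonneg 𝒜 N k)

lemma F_mem_HmInfpre (hxi : ∀ N k, 0 < xi 𝒜 N k) (hlam : ∀ N k, 𝒜.lam N k ∈ square M)
    (f : C(square M, ℂ)) : F 𝒜 D f ∈ HmInfpre 𝒜 D := by
  obtain ⟨C, hC0, hC⟩ := exists_norm_le f
  have hle : ∀ N k, (xi 𝒜 N k)⁻¹ * ‖(𝒜.u N).repr (FN 𝒜 f N) k‖ ≤ C := fun N k => by
    rw [inv_mul_le_iff₀ (hxi N k), mul_comm]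
    exact norm_repr_FN_le hlam hC N k
  obtain ⟨p, hp⟩ := exists_nat_gt C
  have hb : IsUniformlyBounded 𝒜 D (FN 𝒜 f) :=
    ⟨p, Eventually.of_forall fun N k => (hle N k).trans_lt hp⟩
  exact (hb.normInf_le hC0 (Eventually.of_forall hle)).trans_lt ENNReal.ofReal_lt_top

lemma toHu_mem_clsInf (v : ∀ N, HN A φ N) : toHu D v ∈ clsInf 𝒜 D (toHu D v) := by
  change normInf 𝒜 D (toHu D fun N => v N - v N) = 0
  have h0 : ∀ N k, (xi 𝒜 N k)⁻¹ * ‖(𝒜.u N).repr (v N - v N) k‖ = 0 := fun N k => by simp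
  have hb : IsUniformlyBounded 𝒜 D fun N => v N - v N :=
    ⟨1, Eventually.of_forall fun N k => by rw [h0]; simp⟩
  simpa using hb.normInf_le le_rfl (Eventually.of_forall fun N k => (h0 N k).le)

lemma toHu_mem_cls0 (v : ∀ N, HN A φ N) : toHu D v ∈ cls0 𝒜 D (toHu D v) := by
  change Tendsto (fun N => norm0 𝒜 N (v N - v N)) D (𝓝 0)
  simp [norm0]

lemma toHu_surjective (w : Hu A φ D) : ∃ v : ∀ N, HN A φ N, w = toHu D v :=
  Quotient.inductionOn w fun v => ⟨v, rfl⟩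

/-- The numbers `⟨F_N(f) | u_N(θ)⟩` converge to `θ(f)`. -/
lemma IsGrid.tendsto_inner (hG : IsGrid 𝒜 D θ ρ) {K : ℝ} (hK0 : 0 ≤ K) {σ : Set ℂ}
    (hK : IsBoundedOn σ K θ) (hlam : ∀ N k, 𝒜.lam N k ∈ square M)
    (hzero : ∀ n, ∀ p ∈ cells n, mu 𝒜 D M NI (B M ρ n p.1 p.2) = 0 →
      thetaBox θ ρ n p.1 p.2 = 0)
    {U : Set ℕ} (hU : U ∈ D) {n : ℕ → ℕ} {ε : ℕ → ℝ} (hgood : IsThetaGoodOn 𝒜 D NI θ ρ U n ε)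
    (f : C(square M, ℂ)) :
    Tendsto (fun N => ⟪FN 𝒜 f N, uN 𝒜 D NI θ ρ n N⟫_ℂ) D (𝓝 (θ f)) := by
  have := compactSpace_square M
  refine Metric.tendsto_nhds.2 fun η hη => ?_
  have hω : 0 < η / (K + 1) := by positivity
  obtain ⟨d, hd, hf⟩ := Metric.uniformContinuous_iff.1
    (CompactSpace.uniformContinuous_of_continuous f.continuous) _ hω
  filter_upwards [hgood.eventually_mesh_lt hd, hU, hgood.large 1 one_pos] with N h1 h2 h3
  have hn : 0 < n N := by omega
  have key := hG.norm_theta_sub_inner_le hK hlam f hω.le (hzero (n N))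
    (fun p hp hmu => hgood.muN_pos h2 hn hp hmu) fun p hp x y hx hy => by
      rw [← dist_eq_norm]
      exact (hf ((hG.dist_lt hp hx hy).trans h1)).le
  rw [dist_comm, dist_eq_norm]
  refine key.trans_lt ?_
  rw [mul_div_assoc', div_lt_iff₀ (by positivity)]
  nlinarith

/-- The pairing value does not depend on the representatives. -/
lemma IsGrid.isPairingValue (hG : IsGrid 𝒜 D θ ρ) (hxi : ∀ N k, 0 < xi 𝒜 N k) {K : ℝ}
    (hK0 : 0 ≤ K) (hK : IsBoundedOn (spectrum ℂ A) K θ)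
    (hlam : ∀ N k, 𝒜.lam N k ∈ square M)
    (hzero : ∀ n, ∀ p ∈ cells n, mu 𝒜 D M NI (B M ρ n p.1 p.2) = 0 →
      thetaBox θ ρ n p.1 p.2 = 0)
    {U : Set ℕ} (hU : U ∈ D) {n : ℕ → ℕ} {ε : ℕ → ℝ} (hgood : IsThetaGoodOn 𝒜 D NI θ ρ U n ε)
    (f : C(square M, ℂ)) :
    IsPairingValue D (clsInf 𝒜 D (F 𝒜 D f)) (cls0 𝒜 D (uTheta 𝒜 D NI θ ρ n)) (θ f) := by
  intro x hx y hy
  obtain ⟨v, rfl⟩ := toHu_surjective x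
  obtain ⟨w, rfl⟩ := toHu_surjective y
  change Tendsto (fun N => ⟪v N, w N⟫_ℂ) D (𝓝 (θ f))
  set e : ∀ N, HN A φ N := fun N => FN 𝒜 f N - v N with he
  set g : ∀ N, HN A φ N := fun N => uN 𝒜 D NI θ ρ n N - w N with hg
  have hx' : normInf 𝒜 D (toHu D e) = 0 := hx
  have hy' : Tendsto (fun N => norm0 𝒜 N (g N)) D (𝓝 0) := hy
  obtain ⟨C, _, hC⟩ := exists_norm_le f
  have t1 := hG.tendsto_inner hK0 hK hlam hzero hU hgood f
  -- With `v = F - e` and `w = u - g`, three error terms must vanish. For `⟨F, g⟩` and `⟨e, g⟩` the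
  -- first entry is uniformly dominated by `ξ` and `‖g‖₀ → 0`.
  have t2 : Tendsto (fun N => ⟪FN 𝒜 f N, g N⟫_ℂ) D (𝓝 0) := by
    refine squeeze_zero_norm (fun N => norm_inner_le_mul_norm0 (𝒜 := 𝒜) fun k _ =>
      norm_repr_FN_le hlam hC N k) ?_
    simpa using hy'.const_mul C
  have t3 : Tendsto (fun N => ⟪e N, g N⟫_ℂ) D (𝓝 0) := by
    obtain ⟨p, hp⟩ := isUniformlyBounded_of_normInf hx'
    refine squeeze_zero_norm' (a := fun N => (p : ℝ) * norm0 𝒜 N (g N)) ?_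
      (by simpa using hy'.const_mul (p : ℝ))
    filter_upwards [hp] with N hN
    refine norm_inner_le_mul_norm0 (𝒜 := 𝒜) fun k _ => ?_
    rw [mul_comm, ← inv_mul_le_iff₀ (hxi N k)]
    exact (hN k).le
  -- Here `‖u‖₀` is merely bounded by `K`, and `e` is known to be small only near the spectrum; this
  -- suffices because `u` is supported there.
  have t4 : Tendsto (fun N => ⟪e N, uN 𝒜 D NI θ ρ n N⟫_ℂ) D (𝓝 0) := by
    refine Metric.tendsto_nhds.2 fun η hη => ?_
    have hω : 0 < η / (K + 1) := by positivity
    obtain ⟨d, hd, hsup⟩ := exists_normSup_lt hx' hω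
    filter_upwards [hsup, hgood.eventually_mesh_lt hd] with N h1 h2
    have key : ‖⟪e N, uN 𝒜 D NI θ ρ n N⟫_ℂ‖ ≤
        η / (K + 1) * norm0 𝒜 N (uN 𝒜 D NI θ ρ n N) := by
      refine norm_inner_le_mul_norm0 (𝒜 := 𝒜) fun k hk => ?_
      obtain ⟨z, hz, hlt⟩ := hG.exists_dist_lt_of_repr_ne_zero hK hk
      have hnear : 𝒜.lam N k ∈ nearSpectrum A d :=
        (Metric.infDist_le_dist_of_mem hz).trans (hlt.trans h2).le
      rw [mul_comm, ← inv_mul_le_iff₀ (hxi N k)]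
      exact (le_normSup (e N) hnear).trans h1.le
    rw [dist_zero_right]
    refine (key.trans (mul_le_mul_of_nonneg_left (hG.norm0_uN_le hK n N) hω.le)).trans_lt ?_
    rw [div_mul_eq_mul_div, div_lt_iff₀ (by positivity)]
    nlinarith
  have hsum := ((t1.sub t2).sub t4).add t3
  simp only [sub_zero, add_zero] at hsum
  have hv : ∀ N, v N = FN 𝒜 f N - e N := fun N => by simp [he]
  have hw : ∀ N, w N = uN 𝒜 D NI θ ρ n N - g N := fun N => by simp [hg]
  clear_value e g
  refine hsum.congr fun N => ?_
  rw [hv, hw, inner_sub_left, inner_sub_right, inner_sub_right]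
  ring

/-- Non-empty classes make the pairing value unique, since it is the limit of one particular
sequence along an ultrafilter; so the chosen value is the given one. -/
lemma pairing_eq {x y : Set (Hu A φ D)} {q : ℂ} (hx : x.Nonempty) (hy : y.Nonempty)
    (h : IsPairingValue D x y q) : pairing D x y = (q : OnePoint ℂ) := by
  have hex : ∃ q : ℂ, IsPairingValue D x y q := ⟨q, h⟩
  obtain ⟨v, hv⟩ := hx
  obtain ⟨w, hw⟩ := hy
  rw [pairing, dif_pos hex]
  have h1 := hex.choose_spec v hv w hw
  have h2 := h v hv w hw
  obtain ⟨v', rfl⟩ := toHu_surjective v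
  obtain ⟨w', rfl⟩ := toHu_surjective w
  exact congrArg _ (tendsto_nhds_unique (f := fun N => ⟪v' N, w' N⟫_ℂ) (l := (D : Filter ℕ)) h1 h2)

end Pairing

end UltraDist

end

theorem theorem4p10 {H : Type*} [NormedAddCommGroup H] [InnerProductSpace ℂ H] [CompleteSpace H]
    [TopologicalSpace.SeparableSpace H]
    (A : H →L[ℂ] H) (r : ℝ) (hr : 0 < r)
    (hA : ContinuousLinearMap.adjoint A * A = (r : ℂ) • (1 : H →L[ℂ] H))
    (hA' : A * ContinuousLinearMap.adjoint A = (r : ℂ) • (1 : H →L[ℂ] H))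
    (φ : H) (hφ : ‖φ‖ = 1) (hcyc : UltraDist.IsCyclic A φ)
    (M : ℕ) (hM : ‖A‖ < M) (hM' : Real.sqrt r < M)
    (D : Ultrafilter ℕ)
    (hD : ∀ m : ℕ, m ≠ 0 → {N : ℕ | N ≠ 0 ∧ ∃ s : ℕ, N = s ^ 2 ∧ m ∣ s} ∈ D)
    (𝒜 : UltraDist.ApproxSystem A r φ)
    (NI : Set ℝ) (hNI : UltraDist.IsNiceDense 𝒜 D M NI)
    (Sq : ℕ → Set (Set ℂ)) (hSq : UltraDist.IsTiling M NI Sq)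
    (θ : C(UltraDist.square M, ℂ) →ₛₗ[starRingEnd ℂ] ℂ) (hθ : UltraDist.IsGenDistribution A θ) :
    -- suitable subdivisions of the square exist
    (∃ ρ : ℕ → ℕ → ℝ, UltraDist.IsGrid 𝒜 D θ ρ) ∧
    ∀ ρ : ℕ → ℕ → ℝ, UltraDist.IsGrid 𝒜 D θ ρ →
      -- the limits that define the numbers `θ(B, 1)` exist
      (∀ n : ℕ, ∀ i < 2 ^ (n + 2), ∀ j < 2 ^ (n + 2),
        Tendsto θ (UltraDist.plateauFilter M ρ n i j) (𝓝 (UltraDist.thetaBox θ ρ n i j))) ∧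
      -- good pairs exist
      (∃ (n : ℕ → ℕ) (ε : ℕ → ℝ), UltraDist.IsThetaGoodOn 𝒜 D NI θ ρ Set.univ n ε ∧
        ∀ N : ℕ, ∀ i < 2 ^ (n N + 2), ρ (n N) i + ε N < ρ (n N) (i + 1) - ε N) ∧
      -- every good pair gives a vector that represents `θ`
      ∀ (n : ℕ → ℕ) (ε : ℕ → ℝ), UltraDist.IsThetaGood 𝒜 D NI θ ρ n ε →
        UltraDist.cls0 𝒜 D (UltraDist.uTheta 𝒜 D NI θ ρ n) ∈ UltraDist.Hm0 𝒜 D Sq ∧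
        ∀ f : C(UltraDist.square M, ℂ),
          UltraDist.clsInf 𝒜 D (UltraDist.F 𝒜 D f) ∈ UltraDist.HmInf 𝒜 D ∧
          UltraDist.pairing D (UltraDist.clsInf 𝒜 D (UltraDist.F 𝒜 D f))
            (UltraDist.cls0 𝒜 D (UltraDist.uTheta 𝒜 D NI θ ρ n)) = ((θ f : ℂ) : OnePoint ℂ) := by
  have hφ0 : φ ≠ 0 := fun h => by simp [h] at hφ
  have : Nontrivial H := ⟨φ, 0, hφ0⟩
  set R₀ := max ‖A‖ (Real.sqrt r)
  have hR : R₀ < M := max_lt hM hM'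
  have hσ : ∀ z ∈ spectrum ℂ A, ‖z‖ ≤ R₀ := fun z hz =>
    (spectrum.norm_le_norm_of_mem hz).trans (le_max_left _ _)
  have hlamR : ∀ N k, ‖𝒜.lam N k‖ ≤ R₀ := fun N k =>
    (UltraDist.norm_lam hr hA 𝒜 N k).le.trans (le_max_right _ _)
  have hlam : ∀ N k, 𝒜.lam N k ∈ UltraDist.square M := fun N k =>
    UltraDist.mem_square_of_norm_le ((hlamR N k).trans hR.le)
  have hxi := UltraDist.xi_pos hr hA hA' 𝒜
  obtain ⟨K, hK0, hK⟩ := hθ.exists_isBoundedOn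
  -- If `N = s²` is non-zero and `m + 1` divides `s`, then `m + 1 ≤ s ≤ N`.
  have hDge : ∀ m, ∀ᶠ N in (D : Filter ℕ), m ≤ N := by
    intro m
    filter_upwards [hD (m + 1) (Nat.succ_ne_zero m)] with N hN
    obtain ⟨h0, s, rfl, hs⟩ := hN
    have hs0 : 0 < s := Nat.pos_of_ne_zero fun h => h0 (by simp [h])
    have h1 := Nat.le_of_dvd hs0 hs
    nlinarith
  refine ⟨UltraDist.exists_isGrid hφ 𝒜 D hK hσ hlamR
    ((norm_nonneg A).trans (le_max_left _ _)) hR, fun ρ hG => ?_⟩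
  -- A cell that meets `σ(A)` is an open neighbourhood of a spectral point, so it has positive mass;
  -- cells of mass zero therefore miss `σ(A)`.
  have hzero : ∀ n, ∀ p ∈ UltraDist.cells n,
      UltraDist.mu 𝒜 D M NI (UltraDist.B M ρ n p.1 p.2) = 0 →
        UltraDist.thetaBox θ ρ n p.1 p.2 = 0 := fun n p hp hmu =>
    hG.thetaBox_eq_zero hK hp fun z hz hzB => by
      have := UltraDist.muNaive_pos hr hA hA' hφ hcyc 𝒜 D hDge hz
        ((hG.isOpen_cell hp).mem_nhds hzB)
      rw [← hG.mu_cell hφ hNI hp, hmu] at this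
      exact lt_irrefl _ this
  refine ⟨fun n i hi j hj => hG.tendsto_thetaBox hi hj,
    hG.exists_isThetaGoodOn hφ hNI hlam hDge, ?_⟩
  rintro n ε ⟨U, hU, hgood⟩
  exact ⟨⟨_, hG.uTheta_mem_Hm0pre hK hgood Sq, rfl⟩, fun f =>
    ⟨⟨_, UltraDist.F_mem_HmInfpre hxi hlam f, rfl⟩,
      UltraDist.pairing_eq ⟨_, UltraDist.toHu_mem_clsInf _⟩ ⟨_, UltraDist.toHu_mem_cls0 _⟩
        (hG.isPairingValue hxi hK0 hK hlam hzero hU hgood f)⟩⟩
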